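/- Let $\Omega=(0,1)^2$, $1\le p,q\le 2$, $\nu_1,\nu_2\in\mathbb R$. \emph{Framelets.} Let $m\ge 1$ and let $\phi_0$ be the univariate B-spline of order $m$ (the $m$-fold convolution power of $\chi_{[0,1]}$) shifted to the left by $\lfloor m/2\rfloor$. For $0\le\ell\le m$ let $q_\ell$ be the filter on $\mathbb Z$ with $\sum_k q_\ell[k]z^k=(-1)^{\lfloor \ell/2\rfloor}\sqrt{\binom m\ell}\,2^{-m}z^{-\lfloor m/2\rfloor}(1-z)^\ell(1+z)^{m-\ell}$ (the B-spline tight frame filters), and for $\beta=(\beta_1,\beta_2)\in\{0,\dots,m\}^2$ put $q^{(\beta)}[k]=q_{\beta_1}[k_1]q_{\beta_2}[k_2]$, $\phi(x)=\phi_0(x_1)\phi_0(x_2)$, $\psi_\beta=4\sum_k q^{(\beta)}[k]\phi(2\cdot-k)$. Let $\beta^1,\dots,\beta^J\in\{0,\dots,m\}^2\setminus\{(0,0)\}$, $J\ge1$, be the bands used; write $q^{(j)},\psi_j$ for $q^{(\beta^j)},\psi_{\beta^j}$, let $D_j=\partial_1^{\beta^j_1}\partial_2^{\beta^j_2}$ be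 the associated differential operator, $s_j=\beta_1^j+\beta_2^j$ its order, and $s=\max_j s_j$. Let $\varphi_j$ be the compactly supported function with $D_j\varphi_j=\psi_j$ and $c_j=\int\varphi_j\ (\neq 0)$; let $\varphi_{ij}$ be the compactly supported function with $D_i\varphi_{ij}=4c_j^{-1}\sum_l q^{(i)}[l]\varphi_j(2\cdot-l/2)$ and $c_{ij}=\int\varphi_{ij}\ (\neq0)$. Put $\phi_{n,k}=2^n\phi(2^n\cdot-k)$ and $\varphi_{j,n-1,k}=2^{n-2}\varphi_j(2^{n-1}\cdot-k/2)$. \emph{Discretization.} Let $M_n=\{k\in\mathbb Z^2:\operatorname{supp}\phi_{n,k}\subset\overline\Omega\}$ and, for a fixed integer $C\ge2$, $K_n=\{k\in M_n: k+C\operatorname{supp}q^{(\beta)}\subset M_n\ \text{for all }\beta\in\{0,\dots,m\}^2\}$. Define $(T_nu)[k]=2^n\langle u,\phi_{n,k}\rangle_{L_2(\Omega)}$ and $(S_nv)[j;k]=2^n\langle v_j,c_j^{-1}\varphi_{j,n-1,k}\rangle_{L_2(\Omega)}$ for $k\in M_n$, and for $k\in K_n$ and arrays $\mathbf u$, $\mathbf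 v=(\mathbf v[1;\cdot],\dots,\mathbf v[J;\cdot])$ on $M_n$ $$(W_n'\mathbf u)[j;k]=c_j^{-1}(-1)^{s_j}2^{(n-1)s_j}\sum_l q^{(j)}[l]\,\mathbf u[k+l],\qquad (W_n''\mathbf v)[i,j;k]=c_{ij}^{-1}(-1)^{s_i}2^{(n-2)s_i}\sum_l q^{(i)}[l]\,\mathbf v[j;k+l].$$ For arrays on $K_n$ with several components let $\|\mathbf a\|_{\ell_p(K_n;\ell_2)}=\bigl(2^{-2n}\sum_{k\in K_n}(\sum_i|\mathbf a[i;k]|^2)^{p/2}\bigr)^{1/p}$. Let $A:L_2(\Omega)\to L_2(\Omega)$ be linear, $f\in L_2(\Omega)$, and let $A_n:\mathbb R^{M_n}\to\mathbb R^{K_n}$ be linear maps with $\lim_{n\to\infty}\|T_nAu-A_nT_nu\|_{\ell_2(K_n)}=0$ for all $u\in L_2(\Omega)$. Put $$F_n(\mathbf u,\mathbf v)=\nu_1\|W_n'\mathbf u-\mathbf v\|^p_{\ell_p(K_n;\ell_2)}+\nu_2\|W_n''\mathbf v\|^q_{\ell_q(K_n;\ell_2)}+\tfrac12\|A_n\mathbf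 u-T_nf\|^2_{\ell_2(K_n)},\qquad E_n(u,v)=F_n(T_nu,S_nv),$$ $$E(u,v)=\nu_1\int_\Omega\Bigl(\sum_{j}|D_ju-v_j|^2\Bigr)^{p/2}dx+\nu_2\int_\Omega\Bigl(\sum_{i,j}|D_iv_j|^2\Bigr)^{q/2}dx+\tfrac12\|Au-f\|_{L_2(\Omega)}^2 .$$ \textbf{Theorem.} For $(u,v)\in W^p_{2s}(\Omega)\times W^q_s(\Omega;\mathbb R^J)$ one has $u\in L_2(\Omega)$ and $v\in L_p(\Omega;\mathbb R^J)$, so that $E(u,v)$ is well defined and finite. For every sequence $(u_n,v_n)\to(u,v)$ in $W^p_{2s}(\Omega)\times W^q_s(\Omega;\mathbb R^J)$ one has $\lim_{n\to\infty}E_n(u_n,v_n)=E(u,v)$. Consequently $E_n$ $\Gamma$-converges to $E$ in $W^p_{2s}(\Omega)\times W^q_s(\Omega;\mathbb R^J)$, i.e. $\liminf_n E_n(u_n,v_n)\ge E(u,v)$ whenever $(u_n,v_n)\to(u,v)$, and every $(u,v)$ is the limit of some sequence $(u_n',v_n')$ with $\limsup_n E_n(u'_n,v'_n)\le E(u,v)$.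 -/

import Mathlib

open MeasureTheory Filter Topology
open scoped ENNReal ContDiff

namespace WaveletFrame

noncomputable section

/-! ### The domain, weak derivatives and Sobolev spaces -/

/-- The open unit square. -/
def Ω : Set (ℝ × ℝ) := Set.Ioo 0 1 ×ˢ Set.Ioo 0 1

/-- Lebesgue measure on the open unit square. -/
abbrev μΩ : Measure (ℝ × ℝ) := volume.restrict Ω

instance : IsFiniteMeasure μΩ :=
  ⟨by
    rw [Measure.restrict_apply_univ]
    refine lt_of_le_of_lt (measure_mono (t := Set.Icc ((0 : ℝ), (0 : ℝ)) (1, 1)) ?_)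
      isCompact_Icc.measure_lt_top
    rintro ⟨x, y⟩ ⟨hx, hy⟩
    exact ⟨⟨hx.1.le, hy.1.le⟩, ⟨hx.2.le, hy.2.le⟩⟩⟩

/-- The classical partial derivative in the direction `e`. -/
def pd (e : ℝ × ℝ) (η : ℝ × ℝ → ℝ) : ℝ × ℝ → ℝ := fun x => fderiv ℝ η x e

/-- The classical partial derivative `∂₁^{α₁} ∂₂^{α₂} η`. -/
def pderiv (α : ℕ × ℕ) (η : ℝ × ℝ → ℝ) : ℝ × ℝ → ℝ :=
  (pd (1, 0))^[α.1] ((pd (0, 1))^[α.2] η)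

/-- Test functions: smooth, with compact support contained in `Ω`. -/
def IsTest (η : ℝ × ℝ → ℝ) : Prop :=
  ContDiff ℝ ∞ η ∧ HasCompactSupport η ∧ tsupport η ⊆ Ω

/-- `g` is the weak derivative `∂^α u` on `Ω`. -/
def HasWeakDeriv (α : ℕ × ℕ) (u g : ℝ × ℝ → ℝ) : Prop :=
  ∀ η : ℝ × ℝ → ℝ, IsTest η →
    ∫ x, u x * pderiv α η x ∂μΩ = (-1) ^ (α.1 + α.2) * ∫ x, g x * η x ∂μΩ

theorem pd_iterate_smooth (e : ℝ × ℝ) (k : ℕ) {η : ℝ × ℝ → ℝ}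
    (h : ContDiff ℝ ∞ η ∧ HasCompactSupport η) :
    ContDiff ℝ ∞ ((pd e)^[k] η) ∧ HasCompactSupport ((pd e)^[k] η) := by
  induction k with
  | zero => exact h
  | succ k ih =>
    rw [Function.iterate_succ_apply']
    exact ⟨(ih.1.fderiv_right (m := ∞) (by simp)).clm_apply contDiff_const,
      ih.2.fderiv_apply ℝ e⟩

theorem integrable_mul_pderiv {p : ℝ≥0∞} [hp : Fact (1 ≤ p)] (u : Lp ℝ p μΩ) (α : ℕ × ℕ)
    {η : ℝ × ℝ → ℝ} (hη : IsTest η) : Integrable (fun x => u x * pderiv α η x) μΩ := by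
  have h := pd_iterate_smooth (1, 0) α.1 (pd_iterate_smooth (0, 1) α.2 ⟨hη.1, hη.2.1⟩)
  obtain ⟨c, hc⟩ := h.2.exists_bound_of_continuous h.1.continuous
  exact ((Lp.memLp u).integrable hp.out).mul_bdd (c := c)
    h.1.continuous.aestronglyMeasurable (Eventually.of_forall hc)

/-- The multi-indices of order at most `k`. -/
def multiIdx (k : ℕ) : Finset (ℕ × ℕ) :=
  (Finset.range (k + 1) ×ˢ Finset.range (k + 1)).filter fun α => α.1 + α.2 ≤ k

theorem mem_multiIdx {k : ℕ} {α : ℕ × ℕ} (h : α.1 + α.2 ≤ k) : α ∈ multiIdx k := by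
  simp only [multiIdx, Finset.mem_filter, Finset.mem_product, Finset.mem_range]
  omega

/-- The multi-index `0`. -/
def zeroIdx (k : ℕ) : multiIdx k := ⟨(0, 0), mem_multiIdx (Nat.zero_le k)⟩

/-- The Sobolev space `W_k^p(Ω)`: a function is recorded together with its weak derivatives of
order at most `k`, all in `L_p(Ω)`, and the norm is `(∑_{|α| ≤ k} ‖∂^α u‖_p^p)^{1/p}`. -/
def Sobolev (k : ℕ) (p : ℝ≥0∞) [Fact (1 ≤ p)] :
    Submodule ℝ (PiLp p fun _ : multiIdx k => Lp ℝ p μΩ) where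
  carrier := {g | ∀ α : multiIdx k, HasWeakDeriv α (g (zeroIdx k)) (g α)}
  zero_mem' := by
    intro α η _
    have h0 : ((0 : Lp ℝ p μΩ) : ℝ × ℝ → ℝ) =ᵐ[μΩ] 0 := Lp.coeFn_zero ℝ p μΩ
    have h (ζ : ℝ × ℝ → ℝ) : ∫ x, (0 : Lp ℝ p μΩ) x * ζ x ∂μΩ = 0 := by
      rw [integral_congr_ae (g := fun _ => (0 : ℝ))
        (h0.mono fun x hx => by dsimp only; rw [hx]; simp)]
      simp
    simp only [PiLp.zero_apply]
    rw [h, h, mul_zero]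
  add_mem' := by
    intro a b ha hb α η hη
    have h (u v : Lp ℝ p μΩ) (β : ℕ × ℕ) : ∫ x, (u + v) x * pderiv β η x ∂μΩ =
        ∫ x, u x * pderiv β η x ∂μΩ + ∫ x, v x * pderiv β η x ∂μΩ := by
      rw [← integral_add (integrable_mul_pderiv _ _ hη) (integrable_mul_pderiv _ _ hη)]
      refine integral_congr_ae ((Lp.coeFn_add u v).mono fun x hx => ?_)
      dsimp only
      rw [hx, Pi.add_apply, add_mul]
    have h1 := h (a α) (b α) (0, 0)
    simp only [pderiv, Function.iterate_zero, id_eq] at h1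
    simp only [PiLp.add_apply]
    rw [h, h1, ha α η hη, hb α η hη, mul_add]
  smul_mem' := by
    intro c a ha α η hη
    have h (u : Lp ℝ p μΩ) (ζ : ℝ × ℝ → ℝ) : ∫ x, (c • u) x * ζ x ∂μΩ =
        c * ∫ x, u x * ζ x ∂μΩ := by
      rw [← integral_const_mul]
      refine integral_congr_ae ((Lp.coeFn_smul c u).mono fun x hx => ?_)
      dsimp only
      rw [hx, Pi.smul_apply, smul_eq_mul, mul_assoc]
    simp only [PiLp.smul_apply]
    rw [h, h, ha α η hη]
    ring

/-- The underlying function of an element of `W_k^p(Ω)`. -/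
def fn {k : ℕ} {p : ℝ≥0∞} [Fact (1 ≤ p)] (u : Sobolev k p) : Lp ℝ p μΩ :=
  u.1 (zeroIdx k)

/-- The weak derivative `∂^α u` of `u ∈ W_k^p(Ω)`, for `|α| ≤ k`. -/
def wderiv {k : ℕ} {p : ℝ≥0∞} [Fact (1 ≤ p)] (u : Sobolev k p) (α : ℕ × ℕ)
    (hα : α.1 + α.2 ≤ k) : Lp ℝ p μΩ :=
  u.1 ⟨α, mem_multiIdx hα⟩

open Classical in
/-- A function class of `L_p(Ω)` regarded as an element of `L_2(Ω)`, whenever it lies there. -/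
def toL2 {p : ℝ≥0∞} (u : Lp ℝ p μΩ) : Lp ℝ 2 μΩ :=
  if h : MemLp u 2 μΩ then h.toLp u else 0

/-! ### B-splines, filters and framelets in one variable -/

/-- The cardinal B-spline of order `m ≥ 1`, supported on `[0, m]`. -/
def bspline : ℕ → ℝ → ℝ
  | 0 => 0
  | 1 => Set.indicator (Set.Icc 0 1) 1
  | m + 2 => fun x => ∫ t in (0 : ℝ)..1, bspline (m + 1) (x - t)

/-- The univariate refinable function: the B-spline of order `m`, shifted by the integer `⌊m/2⌋`
so as to be centred at `0` for even `m` and at `1/2` for odd `m`. -/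
def phi₁ (m : ℕ) (x : ℝ) : ℝ := bspline m (x + (m / 2 : ℕ))

/-- The univariate B-spline tight framelet filters of order `m`, `0 ≤ ℓ ≤ m`, with Fourier series
`± i^ℓ e^{-iκξ/2} √(m choose ℓ) sin^ℓ(ξ/2) cos^{m-ℓ}(ξ/2)`, where `κ ∈ {0, 1}` is the parity of
`m` and the sign is `(-1)^⌊ℓ/2⌋`. With `z = e^{-iξ}` this is
`± √(m choose ℓ) 2^{-m} z^{-⌊m/2⌋} (1 - z)^ℓ (1 + z)^{m-ℓ}`. -/
def filter₁ (m ℓ : ℕ) (k : ℤ) : ℝ :=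
  if 0 ≤ k + (m / 2 : ℕ) then
    (-1) ^ (ℓ / 2) * √(m.choose ℓ) / 2 ^ m *
      ((1 - Polynomial.X) ^ ℓ * (1 + Polynomial.X) ^ (m - ℓ) : Polynomial ℝ).coeff
        (k + (m / 2 : ℕ)).toNat
  else 0

/-- The integer interval `{-⌊m/2⌋, …, m - ⌊m/2⌋}` outside which all filters vanish. -/
def box₁ (m : ℕ) : Finset ℤ := Finset.Icc (-((m / 2 : ℕ) : ℤ)) (m - (m / 2 : ℕ))

/-- The univariate framelets `ψ_ℓ = 2 ∑_k q_ℓ[k] φ(2· - k)`. -/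
def psi₁ (m ℓ : ℕ) (x : ℝ) : ℝ := 2 * ∑ k ∈ box₁ m, filter₁ m ℓ k * phi₁ m (2 * x - k)

/-- The antiderivative vanishing at `-∞`. -/
def prim (g : ℝ → ℝ) (x : ℝ) : ℝ := ∫ t in Set.Iic x, g t

/-- The compactly supported function `φ_ℓ` with `φ_ℓ^{(ℓ)} = ψ_ℓ`. -/
def vphi₁ (m ℓ : ℕ) : ℝ → ℝ := prim^[ℓ] (psi₁ m ℓ)

/-- `c_ℓ = ∫ φ_ℓ`. -/
def c₁ (m ℓ : ℕ) : ℝ := ∫ x, vphi₁ m ℓ x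

/-- The compactly supported function `φ_{aℓ}` whose `a`-th derivative is
`2 c_ℓ⁻¹ ∑_k q_a[k] φ_ℓ(2· - k/2)`. -/
def vphi₂ (m a ℓ : ℕ) : ℝ → ℝ :=
  prim^[a] fun y => 2 * (c₁ m ℓ)⁻¹ * ∑ k ∈ box₁ m, filter₁ m a k * vphi₁ m ℓ (2 * y - k / 2)

/-- `c_{aℓ} = ∫ φ_{aℓ}`. -/
def c₂ (m a ℓ : ℕ) : ℝ := ∫ x, vphi₂ m a ℓ x

/-! ### Tensor products. A band is a pair `β = (β₁, β₂)` with `0 ≤ β₁, β₂ ≤ m`; the band `(0, 0)`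
is the low-pass one, the others are the framelets; the differential operator associated with
`β` is `∂₁^{β₁} ∂₂^{β₂}`. -/

/-- The order of the differential operator of a band. -/
def ord (β : ℕ × ℕ) : ℕ := β.1 + β.2

/-- The bivariate filter `q^{(β)}`. -/
def filt (m : ℕ) (β : ℕ × ℕ) (k : ℤ × ℤ) : ℝ := filter₁ m β.1 k.1 * filter₁ m β.2 k.2

/-- `c_β = ∫ φ_β`. -/
def cst (m : ℕ) (β : ℕ × ℕ) : ℝ := c₁ m β.1 * c₁ m β.2

/-- `c_{γβ} = ∫ φ_{γβ}`. -/
def cst₂ (m : ℕ) (γ β : ℕ × ℕ) : ℝ := c₂ m γ.1 β.1 * c₂ m γ.2 β.2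

/-- `φ_{n,k} = 2^n φ(2^n · - k)`. -/
def phi (m n : ℕ) (k : ℤ × ℤ) (x : ℝ × ℝ) : ℝ :=
  2 ^ n * (phi₁ m (2 ^ n * x.1 - k.1) * phi₁ m (2 ^ n * x.2 - k.2))

/-- `φ_{β,n-1,k} = 2^{n-2} φ_β(2^{n-1} · - k/2)`. -/
def vphi (m : ℕ) (β : ℕ × ℕ) (n : ℕ) (k : ℤ × ℤ) (x : ℝ × ℝ) : ℝ :=
  (2 : ℝ) ^ ((n : ℤ) - 2) *
    (vphi₁ m β.1 ((2 : ℝ) ^ ((n : ℤ) - 1) * x.1 - k.1 / 2) *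
      vphi₁ m β.2 ((2 : ℝ) ^ ((n : ℤ) - 1) * x.2 - k.2 / 2))

/-! ### Index sets, sampling operators and transforms -/

/-- `O_n`: the `k ∈ ℤ²` with `2^{-n} k` in the closed unit square. -/
def O (n : ℕ) : Finset (ℤ × ℤ) := Finset.Icc 0 (2 ^ n) ×ˢ Finset.Icc 0 (2 ^ n)

open Classical in
/-- `M_n`: the indices for which `supp φ_{n,k}` lies in the closed unit square. -/
def M (m n : ℕ) : Finset (ℤ × ℤ) :=
  (O n).filter fun k => tsupport (phi m n k) ⊆ closure Ω

open Classical in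
/-- `K_n`: the `k ∈ M_n` such that `k + C · supp q^{(β)} ⊆ M_n` for all bands `β`. -/
def K (m C n : ℕ) : Finset (ℤ × ℤ) :=
  (M m n).filter fun k =>
    ∀ β : ℕ × ℕ, β.1 ≤ m → β.2 ≤ m → ∀ l : ℤ × ℤ, filt m β l ≠ 0 → k + (C : ℤ) • l ∈ M m n

open Classical in
/-- `K_n ⊆ M_n`. -/
def toM {m C n : ℕ} (k : K m C n) : M m n := ⟨k.1, (Finset.mem_filter.1 k.2).1⟩

/-- The array `a` on `M_n`, extended by `0`. -/
def ext {m n : ℕ} (a : M m n → ℝ) (k : ℤ × ℤ) : ℝ := if h : k ∈ M m n then a ⟨k, h⟩ else 0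

/-- `(q^{(β)}[-·] ⊛ a)[k] = ∑_l q^{(β)}[l] a[k + l]`, for `k ∈ K_n`. -/
def conv {m n : ℕ} (C : ℕ) (β : ℕ × ℕ) (a : M m n → ℝ) (k : K m C n) : ℝ :=
  ∑ l ∈ box₁ m ×ˢ box₁ m, filt m β l * ext a (k.1 + l)

/-- The sampling operator `T_n`. -/
def T (m n : ℕ) (g : ℝ × ℝ → ℝ) (k : M m n) : ℝ := 2 ^ n * ∫ x, g x * phi m n k x ∂μΩ

/-- The sampling operator `S_n` associated with the bands `α 1, …, α J`. -/
def S (m n : ℕ) {J : ℕ} (α : Fin J → ℕ × ℕ) (v : Fin J → ℝ × ℝ → ℝ) (j : Fin J)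
    (k : M m n) : ℝ :=
  2 ^ n * ∫ x, v j x * ((cst m (α j))⁻¹ * vphi m (α j) n k x) ∂μΩ

/-- The weighted transform `W'_n`, with weights `λ'_j = c_j⁻¹ (-1)^{s_j} 2^{(n-1) s_j}`. -/
def W' (m C n : ℕ) {J : ℕ} (α : Fin J → ℕ × ℕ) (u : M m n → ℝ) (j : Fin J)
    (k : K m C n) : ℝ :=
  (cst m (α j))⁻¹ * (-1) ^ ord (α j) * (2 : ℝ) ^ (((n : ℤ) - 1) * ord (α j)) *
    conv C (α j) u k

/-- The weighted transform `W''_n`, with weights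
`λ''_{ij} = c_{ij}⁻¹ (-1)^{s_i} 2^{(n-2) s_i}`. -/
def W'' (m C n : ℕ) {J : ℕ} (α : Fin J → ℕ × ℕ) (v : Fin J → M m n → ℝ)
    (ij : Fin J × Fin J) (k : K m C n) : ℝ :=
  (cst₂ m (α ij.1) (α ij.2))⁻¹ * (-1) ^ ord (α ij.1) *
    (2 : ℝ) ^ (((n : ℤ) - 2) * ord (α ij.1)) * conv C (α ij.1) (v ij.2) k

/-- The norm of `ℓ_p(K_n; ℓ_2)`. -/
def arrayNorm {m C n : ℕ} {ι : Type} [Fintype ι] (p : ℝ≥0∞) (a : ι → K m C n → ℝ) : ℝ :=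
  ((2 ^ (2 * n))⁻¹ * ∑ k, (∑ i, |a i k| ^ 2) ^ (p.toReal / 2)) ^ (1 / p.toReal)

/-- The norm of `ℓ_2(K_n)`. -/
def arrayNorm₂ {m C n : ℕ} (a : K m C n → ℝ) : ℝ :=
  √((2 ^ (2 * n))⁻¹ * ∑ k, |a k| ^ 2)

/-- The norm of `L_p(Ω; ℓ_2)`. -/
def vecNorm {ι : Type} [Fintype ι] (p : ℝ≥0∞) (g : ι → ℝ × ℝ → ℝ) : ℝ :=
  (∫ x, (∑ i, |g i x| ^ 2) ^ (p.toReal / 2) ∂μΩ) ^ (1 / p.toReal)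

/-! ### The energies -/

/-- The order `s = max_j |D_j|` of the differential operator `D' = (D_1, …, D_J)`. -/
def order {J : ℕ} (α : Fin J → ℕ × ℕ) : ℕ := Finset.univ.sup fun j => ord (α j)

theorem ord_le_order {J : ℕ} (α : Fin J → ℕ × ℕ) (j : Fin J) :
    (α j).1 + (α j).2 ≤ order α :=
  Finset.le_sup (f := fun j => ord (α j)) (Finset.mem_univ j)

theorem ord_le_two_order {J : ℕ} (α : Fin J → ℕ × ℕ) (j : Fin J) :
    (α j).1 + (α j).2 ≤ 2 * order α :=
  (ord_le_order α j).trans (Nat.le_mul_of_pos_left _ two_pos)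

/-- The discrete objective function `F_n`. -/
def F {m C n J : ℕ} (α : Fin J → ℕ × ℕ) (p q : ℝ≥0∞) (ν₁ ν₂ : ℝ)
    (A : (M m n → ℝ) →ₗ[ℝ] (K m C n → ℝ)) (f : M m n → ℝ)
    (u : M m n → ℝ) (v : Fin J → M m n → ℝ) : ℝ :=
  ν₁ * arrayNorm p (fun j k => W' m C n α u j k - v j (toM k)) ^ p.toReal
    + ν₂ * arrayNorm q (W'' m C n α v) ^ q.toReal
    + 1 / 2 * arrayNorm₂ (fun k => A u k - f (toM k)) ^ 2

/-- The space `W_{2s}^p(Ω) × W_s^q(Ω; ℝ^J)`. -/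
abbrev Space {J : ℕ} (α : Fin J → ℕ × ℕ) (p q : ℝ≥0∞) [Fact (1 ≤ p)] [Fact (1 ≤ q)] : Type :=
  Sobolev (2 * order α) p × (Fin J → Sobolev (order α) q)

/-- `E_n(u, v) = F_n(T_n u, S_n v)`, with data `f_n = T_n f`. -/
def En (m C n : ℕ) {J : ℕ} (α : Fin J → ℕ × ℕ) (p q : ℝ≥0∞) [Fact (1 ≤ p)] [Fact (1 ≤ q)]
    (ν₁ ν₂ : ℝ) (A : (M m n → ℝ) →ₗ[ℝ] (K m C n → ℝ)) (f : Lp ℝ 2 μΩ)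
    (w : Space α p q) : ℝ :=
  F α p q ν₁ ν₂ A (T m n f) (T m n (fn w.1)) (S m n α fun j => fn (w.2 j))

/-- `E(u, v) = ν₁ ‖D'u - v‖_p^p + ν₂ ‖D''v‖_q^q + ½ ‖Au - f‖_2²`. -/
def E {J : ℕ} (α : Fin J → ℕ × ℕ) (p q : ℝ≥0∞) [Fact (1 ≤ p)] [Fact (1 ≤ q)]
    (ν₁ ν₂ : ℝ) (A : Lp ℝ 2 μΩ →ₗ[ℝ] Lp ℝ 2 μΩ) (f : Lp ℝ 2 μΩ) (w : Space α p q) : ℝ :=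
  ν₁ * vecNorm p (fun j x =>
      wderiv w.1 (α j) (ord_le_two_order α j) x - fn (w.2 j) x) ^ p.toReal
    + ν₂ * vecNorm q (fun (ij : Fin J × Fin J) x =>
      wderiv (w.2 ij.2) (α ij.1) (ord_le_order α ij.1) x) ^ q.toReal
    + 1 / 2 * ‖A (toL2 (fn w.1)) - f‖ ^ 2

/-- Sequential Γ-convergence of real functionals. -/
def GammaConverges {X : Type} [TopologicalSpace X] (G : ℕ → X → ℝ) (G₀ : X → ℝ) : Prop :=
  (∀ (w : ℕ → X) (w₀ : X), Tendsto w atTop (𝓝 w₀) →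
    (G₀ w₀ : EReal) ≤ liminf (fun n => (G n (w n) : EReal)) atTop) ∧
  ∀ w₀ : X, ∃ w : ℕ → X, Tendsto w atTop (𝓝 w₀) ∧
    limsup (fun n => (G n (w n) : EReal)) atTop ≤ (G₀ w₀ : EReal)

end

end WaveletFrame

open WaveletFrame

namespace WaveletFrame

noncomputable section

/-! ### Lebesgue measure on the unit square -/

/-! The discrete arrays are samples of derivatives. By `fsum_eq`, filtering with `q_a` applies, up
to a factor, the polynomial `(1 - τ)^a (1 + τ)^(m-a)` in the unit translation `τ`, followed by an
integer shift. Since `F - F(· - 1)` is the derivative of the unit-window average of `F`, a filtered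
function is an `a`-fold derivative of a compactly supported function. Normalized to preserve
integrals, that function is `smear m a F`. Integration by parts moves the derivatives onto the
Sobolev function, and the weights of the transforms are exactly those which cancel every constant.
Hence `W'_n T_n u` samples `D_j u` against dilates of `smear φ`, the same functions against which
`S_n` samples `v_j`, and `W''_n S_n v` samples `D_i v_j` against dilates of `smear (smear φ)`
(`W'_eq_samp`, `S_eq_samp`, `W''_eq_samp`). All these sampling functions have integral one, and `2 ≤
C` keeps their supports inside the closed square for `k ∈ K_n`. They may touch the boundary and need
not be smooth, so the integration by parts is done for smooth approximations of the Sobolev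
function, obtained by contracting the square and mollifying (`HasWeakDeriv.integral_mul_prod`).

An array on `K_n` is identified with a piecewise constant function on dyadic cells, which turns
discrete norms into `L_p` norms. Sampling becomes an integral operator whose kernel concentrates on
the diagonal: Schur's test bounds it uniformly on `L_r`, it converges on continuous functions of
compact support, and so it converges along every convergent sequence (`ApproxKernel.tendsto`,
`tendsto_step_samp`). This settles the two regularizing terms.

For the data term, `T_n` is asymptotically isometric on `L_2`, so consistency makes the seminorms
`‖A_n T_n ·‖` pointwise bounded; the uniform boundedness principle then makes them equicontinuous
(`tendsto_data_term`). The required `L_2` convergence of `u_n`, and the membership of `v_j` in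
`L_p`, come from the embedding of `W_1^1` into `L_2`, available since every band has positive order.

The energies thus converge along every convergent sequence, which is stronger than Γ-convergence:
constant sequences serve as recovery sequences. -/

theorem closure_Ω : closure Ω = Set.Icc 0 1 ×ˢ Set.Icc 0 1 := by
  rw [Ω, closure_prod_eq, closure_Ioo (by norm_num)]

theorem isOpen_Ω : IsOpen Ω := isOpen_Ioo.prod isOpen_Ioo

theorem measurableSet_Ω : MeasurableSet Ω := isOpen_Ω.measurableSet

theorem Ω_ae_eq_Icc : Ω =ᵐ[volume] (Set.Icc 0 1 ×ˢ Set.Icc 0 1 : Set (ℝ × ℝ)) :=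
  Measure.set_prod_ae_eq Ioo_ae_eq_Icc Ioo_ae_eq_Icc

theorem Ω_ae_eq_Ico : Ω =ᵐ[volume] (Set.Ico 0 1 ×ˢ Set.Ico 0 1 : Set (ℝ × ℝ)) :=
  Measure.set_prod_ae_eq Ioo_ae_eq_Ico Ioo_ae_eq_Ico

theorem μΩ_eq_prod :
    μΩ = (volume.restrict (Set.Ioo (0 : ℝ) 1)).prod (volume.restrict (Set.Ioo (0 : ℝ) 1)) :=
  (Measure.prod_restrict _ _).symm

instance : IsProbabilityMeasure μΩ :=
  ⟨by
    rw [Measure.restrict_apply_univ, Ω, Measure.volume_eq_prod, Measure.prod_prod]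
    simp⟩

instance : IsProbabilityMeasure (volume.restrict (Set.Ioo (0 : ℝ) 1)) := ⟨by simp⟩

instance : Measure.Regular μΩ := by
  unfold μΩ
  exact Measure.Regular.restrict_of_measure_ne_top
    (by rw [← Measure.restrict_apply_univ]; exact measure_ne_top μΩ _)

theorem ae_mem_Ω : ∀ᵐ x ∂μΩ, x ∈ Ω := ae_restrict_mem measurableSet_Ω

theorem volume_closedBall_prod (x : ℝ × ℝ) (r : ℝ) :
    volume (Metric.closedBall x r) = ENNReal.ofReal (2 * r) * ENNReal.ofReal (2 * r) := by
  obtain ⟨a, b⟩ := x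
  rw [← closedBall_prod_same, Measure.volume_eq_prod, Measure.prod_prod, Real.volume_closedBall,
    Real.volume_closedBall]

/-! ### Integral operators and approximate identities -/

/-- Schur's test. -/
theorem lintegral_rpow_lintegral_mul_le {X : Type*} [MeasurableSpace X] {μ : Measure X} [SFinite μ]
    {w : X → X → ℝ≥0∞} (hw : Measurable (Function.uncurry w)) {f : X → ℝ≥0∞}
    (hf : AEMeasurable f μ) {r : ℝ} (hr : 1 ≤ r) {D : ℝ≥0∞}
    (hx : ∀ᵐ x ∂μ, ∫⁻ y, w x y ∂μ ≤ D) (hy : ∀ y, ∫⁻ x, w x y ∂μ ≤ D) :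
    ∫⁻ x, (∫⁻ y, w x y * f y ∂μ) ^ r ∂μ ≤ D ^ r * ∫⁻ y, f y ^ r ∂μ := by
  have hr0 : 0 < r := by linarith
  have key : ∀ᵐ x ∂μ, (∫⁻ y, w x y * f y ∂μ) ^ r ≤ D ^ (r - 1) * ∫⁻ y, w x y * f y ^ r ∂μ := by
    filter_upwards [hx] with x hx
    have hwx : Measurable (w x) := hw.comp measurable_prodMk_left
    have h := ENNReal.lintegral_mul_norm_pow_le (μ := μ) (f := fun y => w x y * f y ^ r)
      (g := w x) (hwx.aemeasurable.mul (hf.pow_const r)) hwx.aemeasurable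
      (p := 1 / r) (q := 1 - 1 / r) (by positivity)
      (by rw [sub_nonneg, div_le_one hr0]; exact hr) (by ring)
    have e : ∀ y, (w x y * f y ^ r) ^ (1 / r) * w x y ^ (1 - 1 / r) = w x y * f y := by
      intro y
      rw [ENNReal.mul_rpow_of_nonneg _ _ (by positivity), ← ENNReal.rpow_mul,
        mul_one_div_cancel hr0.ne', ENNReal.rpow_one, mul_right_comm,
        ← ENNReal.rpow_add_of_nonneg _ _ (by positivity)
          (by rw [sub_nonneg, div_le_one hr0]; exact hr)]
      simp
    simp only [e] at h
    calc (∫⁻ y, w x y * f y ∂μ) ^ r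
        ≤ ((∫⁻ y, w x y * f y ^ r ∂μ) ^ (1 / r) * (∫⁻ y, w x y ∂μ) ^ (1 - 1 / r)) ^ r := by
          gcongr
      _ = (∫⁻ y, w x y ∂μ) ^ (r - 1) * ∫⁻ y, w x y * f y ^ r ∂μ := by
          rw [ENNReal.mul_rpow_of_nonneg _ _ hr0.le, ← ENNReal.rpow_mul, ← ENNReal.rpow_mul,
            one_div_mul_cancel hr0.ne', ENNReal.rpow_one, mul_comm]
          congr 2
          field_simp
      _ ≤ _ := by gcongr
  have hm : AEMeasurable (Function.uncurry fun x y => w x y * f y ^ r) (μ.prod μ) :=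
    hw.aemeasurable.mul ((hf.pow_const r).comp_quasiMeasurePreserving
      Measure.quasiMeasurePreserving_snd)
  calc ∫⁻ x, (∫⁻ y, w x y * f y ∂μ) ^ r ∂μ
      ≤ ∫⁻ x, D ^ (r - 1) * ∫⁻ y, w x y * f y ^ r ∂μ ∂μ := lintegral_mono_ae key
    _ = D ^ (r - 1) * ∫⁻ y, ∫⁻ x, w x y * f y ^ r ∂μ ∂μ := by
        rw [← lintegral_lintegral_swap hm]
        exact lintegral_const_mul'' _ hm.lintegral_prod_right'
    _ ≤ D ^ (r - 1) * ∫⁻ y, D * f y ^ r ∂μ := by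
        gcongr with y
        have hwy : Measurable fun x => w x y := hw.comp measurable_prodMk_right
        rw [lintegral_mul_const _ hwy]
        gcongr
        exact hy y
    _ = _ := by
        rw [lintegral_const_mul'' _ (hf.pow_const r), ← mul_assoc]
        congr 1
        nth_rewrite 2 [← ENNReal.rpow_one D]
        rw [← ENNReal.rpow_add_of_nonneg _ _ (by linarith) zero_le_one]
        congr 1
        ring

/-- The integral operator on `Ω` with kernel `k`. -/
def kop (k : ℝ × ℝ → ℝ × ℝ → ℝ) (g : ℝ × ℝ → ℝ) (x : ℝ × ℝ) : ℝ := ∫ y, k x y * g y ∂μΩ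

/-- Kernels concentrating on the diagonal, uniformly bounded in the sense of Schur's test. -/
structure ApproxKernel (k : ℕ → ℝ × ℝ → ℝ × ℝ → ℝ) (D R : ℝ) : Prop where
  meas : ∀ n, Measurable (Function.uncurry (k n))
  bdd : ∀ n, ∃ B, ∀ x y, ‖k n x y‖ ≤ B
  row : ∀ n, ∀ x ∈ Ω, ∫⁻ y, ‖k n x y‖ₑ ∂μΩ ≤ ENNReal.ofReal D
  col : ∀ n y, ∫⁻ x, ‖k n x y‖ₑ ∂μΩ ≤ ENNReal.ofReal D
  supp : ∀ n, ∀ x ∈ Ω, ∀ y, k n x y ≠ 0 → dist x y ≤ R * (2 ^ n)⁻¹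
  mass : ∀ x ∈ Ω, ∀ᶠ n in atTop, ∫ y, k n x y ∂μΩ = 1

/-- A kernel of height `B 4^n` supported within distance `R 2^{-n}` of the diagonal has rows and
columns of mass at most the height times the area `(2 R 2^{-n})²` of a ball in the maximum norm,
which is `4 B R²`. -/
theorem ApproxKernel.of_bound {k : ℕ → ℝ × ℝ → ℝ × ℝ → ℝ} {B R : ℝ} (hR : 0 ≤ R)
    (hm : ∀ n, Measurable (Function.uncurry (k n)))
    (hB : ∀ n x y, ‖k n x y‖ ≤ B * 4 ^ n)
    (hs : ∀ n, ∀ x ∈ Ω, ∀ y, k n x y ≠ 0 → dist x y ≤ R * (2 ^ n)⁻¹)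
    (h1 : ∀ x ∈ Ω, ∀ᶠ n in atTop, ∫ y, k n x y ∂μΩ = 1) :
    ApproxKernel k (4 * B * R ^ 2) R := by
  have hB0 : 0 ≤ B := by simpa using (norm_nonneg _).trans (hB 0 0 0)
  have key (n : ℕ) (x : ℝ × ℝ) : ∫⁻ y, (Metric.closedBall x (R * (2 ^ n)⁻¹)).indicator
      (fun _ => ENNReal.ofReal (B * 4 ^ n)) y ∂μΩ ≤ ENNReal.ofReal (4 * B * R ^ 2) := by
    refine (setLIntegral_le_lintegral _ _).trans ?_
    rw [lintegral_indicator Metric.isClosed_closedBall.measurableSet, setLIntegral_const,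
      volume_closedBall_prod, ← ENNReal.ofReal_mul (by positivity),
      ← ENNReal.ofReal_mul (by positivity)]
    refine ENNReal.ofReal_le_ofReal (le_of_eq ?_)
    have : (4 : ℝ) ^ n = 2 ^ n * 2 ^ n := by rw [← mul_pow]; norm_num
    rw [this]
    field_simp
    ring
  refine ⟨hm, fun n => ⟨_, hB n⟩, fun n x hx => ?_, fun n y => ?_, hs, h1⟩
  · refine (lintegral_mono fun y => ?_).trans (key n x)
    by_cases h : k n x y = 0
    · simp [h]
    · rw [Set.indicator_of_mem (by rw [Metric.mem_closedBall, dist_comm]; exact hs n x hx y h),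
        ← ofReal_norm]
      exact ENNReal.ofReal_le_ofReal (hB n x y)
  · refine (lintegral_mono_ae ?_).trans (key n y)
    filter_upwards [ae_mem_Ω] with x hx
    by_cases h : k n x y = 0
    · simp [h]
    · rw [Set.indicator_of_mem (by rw [Metric.mem_closedBall]; exact hs n x hx y h),
        ← ofReal_norm]
      exact ENNReal.ofReal_le_ofReal (hB n x y)

section

variable {k : ℕ → ℝ × ℝ → ℝ × ℝ → ℝ} {D R : ℝ}

theorem ApproxKernel.integrable (hk : ApproxKernel k D R) (n : ℕ) (x : ℝ × ℝ) {g : ℝ × ℝ → ℝ}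
    (hg : Integrable g μΩ) : Integrable (fun y => k n x y * g y) μΩ := by
  obtain ⟨B, hB⟩ := hk.bdd n
  exact hg.bdd_mul ((hk.meas n).comp measurable_prodMk_left).aestronglyMeasurable
    (Eventually.of_forall fun y => hB x y)

theorem ApproxKernel.aestronglyMeasurable (hk : ApproxKernel k D R) (n : ℕ) {g : ℝ × ℝ → ℝ}
    (hg : AEStronglyMeasurable g μΩ) : AEStronglyMeasurable (kop (k n) g) μΩ := by
  have h : AEStronglyMeasurable (fun z : (ℝ × ℝ) × (ℝ × ℝ) => k n z.1 z.2 * g z.2)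
      (μΩ.prod μΩ) :=
    (hk.meas n).aestronglyMeasurable.mul hg.comp_snd
  exact h.integral_prod_right'

theorem ApproxKernel.kop_sub (hk : ApproxKernel k D R) (n : ℕ) {g g' : ℝ × ℝ → ℝ}
    (hg : Integrable g μΩ) (hg' : Integrable g' μΩ) :
    kop (k n) (g - g') = kop (k n) g - kop (k n) g' := by
  funext x
  simp only [kop, Pi.sub_apply, mul_sub]
  exact integral_sub (hk.integrable n x hg) (hk.integrable n x hg')

theorem ApproxKernel.eLpNorm_le (hk : ApproxKernel k D R) (n : ℕ) {r : ℝ≥0∞} (hr : 1 ≤ r)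
    (hr' : r ≠ ⊤) {g : ℝ × ℝ → ℝ} (hg : AEStronglyMeasurable g μΩ) :
    eLpNorm (kop (k n) g) r μΩ ≤ ENNReal.ofReal D * eLpNorm g r μΩ := by
  have h0 : r ≠ 0 := (zero_lt_one.trans_le hr).ne'
  have h1 : 1 ≤ r.toReal := by simpa using ENNReal.toReal_mono hr' hr
  have h1' : 0 < r.toReal := by linarith
  rw [eLpNorm_eq_lintegral_rpow_enorm_toReal h0 hr', eLpNorm_eq_lintegral_rpow_enorm_toReal h0 hr']
  have := lintegral_rpow_lintegral_mul_le (μ := μΩ) (w := fun x y => ‖k n x y‖ₑ)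
    (f := fun y => ‖g y‖ₑ) (hk.meas n).enorm hg.enorm h1
    (ae_mem_Ω.mono fun x hx => hk.row n x hx) (hk.col n)
  calc _ ≤ (∫⁻ x, (∫⁻ y, ‖k n x y‖ₑ * ‖g y‖ₑ ∂μΩ) ^ r.toReal ∂μΩ) ^ (1 / r.toReal) := by
        gcongr with x
        refine (enorm_integral_le_lintegral_enorm _).trans (le_of_eq ?_)
        simp only [enorm_mul]
    _ ≤ (ENNReal.ofReal D ^ r.toReal * ∫⁻ y, ‖g y‖ₑ ^ r.toReal ∂μΩ) ^ (1 / r.toReal) := by gcongr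
    _ = _ := by
        rw [ENNReal.mul_rpow_of_nonneg _ _ (by positivity), ← ENNReal.rpow_mul,
          mul_one_div_cancel h1'.ne', ENNReal.rpow_one]

/-- Bounded pointwise convergence on `Ω` implies convergence in `L_r(Ω)`. -/
theorem tendsto_eLpNorm_of_bounded {F : ℕ → ℝ × ℝ → ℝ} {r : ℝ≥0∞} (hr : 1 ≤ r) (hr' : r ≠ ⊤)
    (hF : ∀ n, AEStronglyMeasurable (F n) μΩ) {B : ℝ} (hB : ∀ n, ∀ x ∈ Ω, ‖F n x‖ ≤ B)
    (h : ∀ x ∈ Ω, Tendsto (fun n => F n x) atTop (𝓝 0)) :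
    Tendsto (fun n => eLpNorm (F n) r μΩ) atTop (𝓝 0) := by
  have h0 : r ≠ 0 := (zero_lt_one.trans_le hr).ne'
  have h1 : 1 ≤ r.toReal := by simpa using ENNReal.toReal_mono hr' hr
  have h1' : 0 < r.toReal := by linarith
  simp only [eLpNorm_eq_lintegral_rpow_enorm_toReal h0 hr']
  have : Tendsto (fun n => ∫⁻ x, ‖F n x‖ₑ ^ r.toReal ∂μΩ) atTop
      (𝓝 (∫⁻ x, ((fun _ => 0) : ℝ × ℝ → ℝ≥0∞) x ∂μΩ)) := by
    refine tendsto_lintegral_of_dominated_convergence' (fun _ => ENNReal.ofReal B ^ r.toReal)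
      (fun n => (hF n).enorm.pow_const _) (fun n => ?_) ?_ ?_
    · filter_upwards [ae_mem_Ω] with x hx
      rw [← ofReal_norm]
      gcongr
      exact hB n x hx
    · rw [lintegral_const]
      exact ENNReal.mul_ne_top (ENNReal.rpow_ne_top_of_nonneg h1'.le ENNReal.ofReal_ne_top)
        (measure_ne_top _ _)
    · filter_upwards [ae_mem_Ω] with x hx
      have := ((h x hx).enorm).ennrpow_const r.toReal
      simpa [h1'] using this
  have h2 := this.ennrpow_const (1 / r.toReal)
  simpa [h1'] using h2

theorem ApproxKernel.norm_integral_le (hk : ApproxKernel k D R) (n : ℕ) {x : ℝ × ℝ} (hx : x ∈ Ω)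
    (hD : 0 ≤ D) {h : ℝ × ℝ → ℝ} {ε : ℝ} (hε : 0 ≤ ε)
    (hh : ∀ y, dist x y ≤ R * (2 ^ n)⁻¹ → ‖h y‖ ≤ ε) : ‖kop (k n) h x‖ ≤ D * ε := by
  have : ‖kop (k n) h x‖ₑ ≤ ENNReal.ofReal D * ENNReal.ofReal ε := by
    calc _ ≤ ∫⁻ y, ‖k n x y‖ₑ * ENNReal.ofReal ε ∂μΩ := by
          refine (enorm_integral_le_lintegral_enorm _).trans (lintegral_mono fun y => ?_)
          by_cases hy : k n x y = 0
          · simp [hy]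
          · rw [enorm_mul]
            gcongr
            rw [← ofReal_norm]
            exact ENNReal.ofReal_le_ofReal (hh y (hk.supp n x hx y hy))
      _ ≤ _ := by
          rw [lintegral_mul_const' _ _ ENNReal.ofReal_ne_top]
          gcongr
          exact hk.row n x hx
  rw [← ENNReal.ofReal_mul hD, ← ofReal_norm] at this
  exact (ENNReal.ofReal_le_ofReal_iff (by positivity)).1 this

/-- Once the row of `x` has mass one, the error at `x` is the operator applied to `y ↦ h y - h x`,
which is small near `x` by continuity. The mass condition holds only from some index depending on
`x`, so convergence is pointwise and is upgraded by domination. -/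
theorem ApproxKernel.tendsto_of_continuous (hk : ApproxKernel k D R) (hD : 0 ≤ D) {r : ℝ≥0∞}
    (hr : 1 ≤ r) (hr' : r ≠ ⊤) {h : ℝ × ℝ → ℝ} (hc : Continuous h) (hs : HasCompactSupport h) :
    Tendsto (fun n => eLpNorm (kop (k n) h - h) r μΩ) atTop (𝓝 0) := by
  obtain ⟨B, hB⟩ := hs.exists_bound_of_continuous hc
  have hB0 : 0 ≤ B := (norm_nonneg _).trans (hB 0)
  have hint : Integrable h μΩ := (hc.integrable_of_hasCompactSupport hs).restrict
  refine tendsto_eLpNorm_of_bounded hr hr'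
    (fun n => (hk.aestronglyMeasurable n hc.aestronglyMeasurable).sub hc.aestronglyMeasurable)
    (B := D * B + B) (fun n x hx => ?_) fun x hx => ?_
  · exact (norm_sub_le _ _).trans
      (add_le_add (hk.norm_integral_le n hx hD hB0 fun y _ => hB y) (hB x))
  · rw [Metric.tendsto_atTop']
    intro ε hε
    have hε' : 0 < ε / (D + 1) := by positivity
    obtain ⟨δ, hδ, hδ'⟩ := Metric.continuous_iff.1 hc x _ hε'
    have hlim : Tendsto (fun n : ℕ => R * ((2 : ℝ) ^ n)⁻¹) atTop (𝓝 0) := by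
      simpa using (tendsto_inv_atTop_zero.comp
        (tendsto_pow_atTop_atTop_of_one_lt (one_lt_two (α := ℝ)))).const_mul R
    obtain ⟨N, hN⟩ := ((hk.mass x hx).and (hlim.eventually_lt_const hδ)).exists_forall_of_atTop
    refine ⟨N, fun n hn => ?_⟩
    obtain ⟨h1, h2⟩ := hN n hn.le
    have e : (kop (k n) h - h) x = kop (k n) (fun y => h y - h x) x := by
      simp only [kop, Pi.sub_apply, mul_sub]
      rw [integral_sub (hk.integrable n x hint) (hk.integrable n x (integrable_const _)),
        integral_mul_const, h1, one_mul]
    rw [dist_zero_right, e]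
    refine (hk.norm_integral_le n hx hD hε'.le fun y hy => ?_).trans_lt ?_
    · have := (hδ' y (by rw [dist_comm]; exact hy.trans_lt h2)).le
      rwa [dist_eq_norm] at this
    · rw [mul_div_assoc', div_lt_iff₀ (by positivity)]
      nlinarith

/-- Strong convergence of uniformly bounded operators on a dense set extends to the whole space.
Uniform boundedness also absorbs a moving argument `g n`. -/
theorem ApproxKernel.tendsto (hk : ApproxKernel k D R) (hD : 0 ≤ D) {r : ℝ≥0∞}
    (hr : 1 ≤ r) (hr' : r ≠ ⊤) {g : ℕ → ℝ × ℝ → ℝ} {g₀ : ℝ × ℝ → ℝ} (hg : ∀ n, MemLp (g n) r μΩ)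
    (hg₀ : MemLp g₀ r μΩ) (hlim : Tendsto (fun n => eLpNorm (g n - g₀) r μΩ) atTop (𝓝 0)) :
    Tendsto (fun n => eLpNorm (kop (k n) (g n) - g₀) r μΩ) atTop (𝓝 0) := by
  rw [ENNReal.tendsto_nhds_zero]
  intro ε hε
  set D' := ENNReal.ofReal D with hD'
  have hc : D' + 4 ≠ ⊤ := by simp [hD']
  have hc0 : D' + 4 ≠ 0 := by simp
  -- The triangle inequality below produces the error `D' * e` twice and `e` twice. The summand `4`
  -- is more than enough to absorb the latter and keeps the denominator nonzero.
  set e := ε / (D' + 4) / 2 with he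
  by_cases hεt : ε = ⊤
  · simp [hεt]
  have he0 : e ≠ 0 := ENNReal.div_ne_zero.2 ⟨ENNReal.div_ne_zero.2 ⟨hε.ne', hc⟩, by simp⟩
  have hele : D' * e + (D' * e + (e + e)) ≤ ε := by
    have : (D' + 4) * (e + e) = ε := by
      rw [he, ENNReal.add_halves, ENNReal.mul_div_cancel hc0 hc]
    rw [← this]
    calc D' * e + (D' * e + (e + e)) = D' * (e + e) + (e + e) := by ring
      _ ≤ D' * (e + e) + 4 * (e + e) := by
          gcongr
          exact le_mul_of_one_le_left' (by norm_num)
      _ = _ := by ring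
  obtain ⟨h, hs, happ, hcont, hmem⟩ := hg₀.exists_hasCompactSupport_eLpNorm_sub_le hr' he0
  have h1 := (ENNReal.tendsto_nhds_zero.1 hlim) e he0.bot_lt
  have h2 := (ENNReal.tendsto_nhds_zero.1 (hk.tendsto_of_continuous hD hr hr' hcont hs)) e
    he0.bot_lt
  filter_upwards [h1, h2] with n h1 h2
  have i0 := hg₀.integrable hr
  have i1 := (hg n).integrable hr
  have i2 := hmem.integrable hr
  have split : kop (k n) (g n) - g₀ =
      kop (k n) (g n - g₀) + (kop (k n) (g₀ - h) + ((kop (k n) h - h) + (h - g₀))) := by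
    rw [hk.kop_sub n i1 i0, hk.kop_sub n i0 i2]
    abel
  have m1 := ((hg n).sub hg₀).1
  have m2 := (hg₀.sub hmem).1
  have m3 := (hk.aestronglyMeasurable n hmem.1).sub hmem.1
  have m4 := (hmem.sub hg₀).1
  rw [split]
  refine (eLpNorm_add_le (hk.aestronglyMeasurable n m1)
    ((hk.aestronglyMeasurable n m2).add (m3.add m4)) hr).trans (le_trans ?_ hele)
  gcongr
  · exact (hk.eLpNorm_le n hr hr' m1).trans (by gcongr)
  refine (eLpNorm_add_le (hk.aestronglyMeasurable n m2) (m3.add m4) hr).trans ?_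
  gcongr
  · exact (hk.eLpNorm_le n hr hr' m2).trans (by gcongr)
  refine (eLpNorm_add_le m3 m4 hr).trans ?_
  gcongr
  rwa [eLpNorm_sub_comm]

end

/-! ### Averages, differences and bounded functions of compact support on the line -/

/-- Bounded measurable functions vanishing outside `[a, b]`. -/
structure BddSupp (a b : ℝ) (F : ℝ → ℝ) : Prop where
  meas : Measurable F
  bdd : ∃ B, ∀ x, ‖F x‖ ≤ B
  supp : ∀ x, F x ≠ 0 → x ∈ Set.Icc a b

/-- `∫_0^h F(x - t) dt`. -/
def avg (h : ℝ) (F : ℝ → ℝ) (x : ℝ) : ℝ := ∫ t in (0 : ℝ)..h, F (x - t)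

/-- Translation by `h`. -/
def shift (h : ℝ) : Module.End ℝ (ℝ → ℝ) where
  toFun F x := F (x - h)
  map_add' _ _ := rfl
  map_smul' _ _ := rfl

@[simp] theorem shift_apply (h : ℝ) (F : ℝ → ℝ) (x : ℝ) : shift h F x = F (x - h) := rfl

theorem shift_pow_apply (h : ℝ) (j : ℕ) (F : ℝ → ℝ) (x : ℝ) :
    (shift h ^ j) F x = F (x - j * h) := by
  induction j generalizing x with
  | zero => simp
  | succ j ih =>
    rw [pow_succ', Module.End.mul_apply, shift_apply, ih]
    push_cast
    ring_nf

namespace BddSupp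

variable {a b a' b' h : ℝ} {F G : ℝ → ℝ}

theorem integrable (hF : BddSupp a b F) : Integrable F := by
  obtain ⟨B, hB⟩ := hF.bdd
  rw [← integrableOn_iff_integrable_of_support_subset (s := Set.Icc a b) fun x hx => hF.supp x hx]
  exact IntegrableOn.of_bound isCompact_Icc.measure_lt_top hF.meas.aestronglyMeasurable B
    (Eventually.of_forall hB)

theorem integrable_mul (hF : BddSupp a b F) {U : ℝ → ℝ} (hU : Continuous U) :
    Integrable fun x => U x * F x := by
  obtain ⟨B, hB⟩ := hF.bdd
  rw [← integrableOn_iff_integrable_of_support_subset (s := Set.Icc a b)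
    fun x hx => hF.supp x (right_ne_zero_of_mul hx)]
  exact (hU.integrableOn_Icc).mul_bdd hF.meas.aestronglyMeasurable (Eventually.of_forall hB)

theorem mono (hF : BddSupp a b F) (ha : a' ≤ a) (hb : b ≤ b') : BddSupp a' b' F :=
  ⟨hF.meas, hF.bdd, fun x hx => Set.Icc_subset_Icc ha hb (hF.supp x hx)⟩

theorem add (hF : BddSupp a b F) (hG : BddSupp a b G) : BddSupp a b (F + G) := by
  obtain ⟨B, hB⟩ := hF.bdd
  obtain ⟨B', hB'⟩ := hG.bdd
  refine ⟨hF.meas.add hG.meas, ⟨B + B', fun x => (norm_add_le _ _).trans (add_le_add (hB x) (hB' x))⟩,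
    fun x hx => ?_⟩
  by_cases h : F x = 0
  · exact hG.supp x fun h' => hx (by simp [h, h'])
  · exact hF.supp x h

theorem smul (hF : BddSupp a b F) (c : ℝ) : BddSupp a b (c • F) := by
  obtain ⟨B, hB⟩ := hF.bdd
  refine ⟨hF.meas.const_smul c, ⟨‖c‖ * B, fun x => ?_⟩, fun x hx => hF.supp x fun h => hx (by simp [h])⟩
  rw [Pi.smul_apply, norm_smul]
  gcongr
  exact hB x

/-- Affine changes of variables. -/
theorem comp_affine (hF : BddSupp a b F) {l κ : ℝ} (hl : 0 < l) :
    BddSupp ((a + κ) / l) ((b + κ) / l) fun x => F (l * x - κ) := by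
  obtain ⟨B, hB⟩ := hF.bdd
  refine ⟨hF.meas.comp (by fun_prop), ⟨B, fun x => hB _⟩, fun x hx => ?_⟩
  have := hF.supp _ hx
  rw [Set.mem_Icc] at this ⊢
  rw [div_le_iff₀ hl, le_div_iff₀ hl]
  constructor <;> linarith [this.1, this.2]

theorem shift (hF : BddSupp a b F) (h : ℝ) : BddSupp (a + h) (b + h) (shift h F) := by
  have := hF.comp_affine (l := 1) (κ := h) one_pos
  simpa [WaveletFrame.shift] using this

theorem one_add_shift (hF : BddSupp a b F) (hh : 0 ≤ h) :
    BddSupp a (b + h) ((1 + WaveletFrame.shift h) F) :=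
  (hF.mono le_rfl (by linarith)).add ((hF.shift h).mono (by linarith) le_rfl)

theorem one_sub_shift (hF : BddSupp a b F) (hh : 0 ≤ h) :
    BddSupp a (b + h) ((1 - WaveletFrame.shift h) F) := by
  have := (hF.mono (b' := b + h) le_rfl (by linarith)).add
    (((hF.shift h).mono (a' := a) (by linarith) le_rfl).smul (-1))
  convert this using 1
  simp [sub_eq_add_neg]

theorem one_add_shift_pow (hF : BddSupp a b F) (hh : 0 ≤ h) (j : ℕ) :
    BddSupp a (b + j * h) (((1 + WaveletFrame.shift h) ^ j) F) := by
  induction j with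
  | zero => simpa using hF
  | succ j ih =>
    rw [pow_succ', Module.End.mul_apply]
    exact (ih.one_add_shift hh).mono le_rfl (by push_cast; linarith)

theorem one_sub_shift_pow (hF : BddSupp a b F) (hh : 0 ≤ h) (j : ℕ) :
    BddSupp a (b + j * h) (((1 - WaveletFrame.shift h) ^ j) F) := by
  induction j with
  | zero => simpa using hF
  | succ j ih =>
    rw [pow_succ', Module.End.mul_apply]
    exact (ih.one_sub_shift hh).mono le_rfl (by push_cast; linarith)

theorem avg_eq (F : ℝ → ℝ) (h x : ℝ) : avg h F x = ∫ t in (x - h)..x, F t := by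
  rw [avg, intervalIntegral.integral_comp_sub_left (fun t => F t) x]
  simp

theorem avg (hF : BddSupp a b F) (hh : 0 ≤ h) : BddSupp a (b + h) (avg h F) := by
  obtain ⟨B, hB⟩ := hF.bdd
  refine ⟨?_, ⟨B * |h - 0|, fun x => ?_⟩, fun x hx => ?_⟩
  · have e : WaveletFrame.avg h F = fun x => (∫ t in (0 : ℝ)..x, F t) - ∫ t in (0 : ℝ)..(x - h), F t := by
      funext x
      rw [avg_eq, intervalIntegral.integral_interval_sub_left] <;>
        exact hF.integrable.intervalIntegrable
    have hc : Continuous fun x => ∫ t in (0 : ℝ)..x, F t :=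
      intervalIntegral.continuous_primitive (fun _ _ => hF.integrable.intervalIntegrable) 0
    rw [e]
    exact (hc.sub (hc.comp (by fun_prop))).measurable
  · exact intervalIntegral.norm_integral_le_of_norm_le_const fun t _ => hB _
  · by_contra hx'
    refine hx ?_
    rw [WaveletFrame.avg, intervalIntegral.integral_congr (g := fun _ => 0)]
    · simp
    · intro t ht
      rw [Set.uIcc_of_le hh] at ht
      by_contra hne
      have := hF.supp _ hne
      exact hx' ⟨by linarith [this.1, ht.1], by linarith [this.2, ht.2]⟩

theorem avg_iterate (hF : BddSupp a b F) (hh : 0 ≤ h) (j : ℕ) :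
    BddSupp a (b + j * h) ((WaveletFrame.avg h)^[j] F) := by
  induction j with
  | zero => simpa using hF
  | succ j ih =>
    rw [Function.iterate_succ_apply']
    exact (ih.avg hh).mono le_rfl (by push_cast; linarith)

/-- Fubini's theorem for `U(x) F(x - t)`, `0 ≤ t ≤ h`. -/
theorem integral_mul_avg (hF : BddSupp a b F) (hh : 0 ≤ h) {U : ℝ → ℝ} (hU : Continuous U) :
    ∫ x, U x * WaveletFrame.avg h F x = ∫ x, (∫ t in (0 : ℝ)..h, U (x + t)) * F x := by
  obtain ⟨B, hB⟩ := hF.bdd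
  have i1 : Integrable (fun z : ℝ × ℝ => U z.1 * F (z.1 - z.2))
      (volume.prod (volume.restrict (Set.Ioc 0 h))) := by
    have hm : Measurable fun z : ℝ × ℝ => F (z.1 - z.2) := hF.meas.comp (by fun_prop)
    have h1 : Integrable (fun z : ℝ × ℝ => U z.1)
        ((volume.restrict (Set.Icc a (b + h))).prod (volume.restrict (Set.Ioc 0 h))) :=
      (hU.integrableOn_Icc : Integrable U (volume.restrict (Set.Icc a (b + h)))).comp_fst _
    have h2 := h1.mul_bdd (c := B) hm.aestronglyMeasurable (Eventually.of_forall fun z => hB _)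
    rw [Measure.prod_restrict] at h2
    have : (volume : Measure ℝ).prod (volume.restrict (Set.Ioc 0 h)) =
        (volume.prod volume).restrict (Set.univ ×ˢ Set.Ioc 0 h) := by
      rw [← Measure.prod_restrict, Measure.restrict_univ]
    rw [this]
    refine IntegrableOn.of_forall_sdiff_eq_zero h2
      (MeasurableSet.univ.prod measurableSet_Ioc) ?_
    rintro ⟨x, t⟩ ⟨hz, hz'⟩
    have hz2 : t ∈ Set.Ioc 0 h := hz.2
    by_contra hne
    have := hF.supp _ (right_ne_zero_of_mul hne)
    exact hz' ⟨⟨by linarith [this.1, hz2.1], by linarith [this.2, hz2.2]⟩, hz2⟩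
  have i2 : Integrable (fun z : ℝ × ℝ => U (z.1 + z.2) * F z.1)
      (volume.prod (volume.restrict (Set.Ioc 0 h))) := by
    have hm : Continuous fun z : ℝ × ℝ => U (z.1 + z.2) := by fun_prop
    obtain ⟨B', hB'⟩ := (isCompact_Icc.prod isCompact_Icc :
      IsCompact (Set.Icc a b ×ˢ Set.Icc 0 h)).exists_bound_of_continuousOn hm.continuousOn
    have h1 : Integrable (fun z : ℝ × ℝ => B' * ‖F z.1‖)
        (volume.prod (volume.restrict (Set.Ioc 0 h))) :=
      (hF.integrable.norm.comp_fst _).const_mul B'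
    refine h1.mono' (hm.measurable.mul (hF.meas.comp measurable_fst)).aestronglyMeasurable ?_
    have hae : ∀ᵐ z ∂((volume : Measure ℝ).prod (volume.restrict (Set.Ioc 0 h))),
        z.2 ∈ Set.Ioc 0 h :=
      Measure.quasiMeasurePreserving_snd.ae (ae_restrict_mem measurableSet_Ioc)
    filter_upwards [hae] with z hz
    by_cases hne : F z.1 = 0
    · simp [hne]
    · rw [norm_mul]
      gcongr
      exact hB' z ⟨hF.supp _ hne, hz.1.le, hz.2⟩
  have e1 : ∫ x, U x * WaveletFrame.avg h F x =
      ∫ x, ∫ t in Set.Ioc 0 h, U x * F (x - t) := by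
    refine integral_congr_ae (Eventually.of_forall fun x => ?_)
    simp only [WaveletFrame.avg]
    rw [intervalIntegral.integral_of_le hh, integral_const_mul]
  have e2 : ∫ x, (∫ t in (0 : ℝ)..h, U (x + t)) * F x =
      ∫ x, ∫ t in Set.Ioc 0 h, U (x + t) * F x := by
    refine integral_congr_ae (Eventually.of_forall fun x => ?_)
    simp only
    rw [intervalIntegral.integral_of_le hh, integral_mul_const]
  rw [e1, e2, integral_integral_swap i1, integral_integral_swap (f := fun x t => U (x + t) * F x) i2]
  refine integral_congr_ae (Eventually.of_forall fun t => ?_)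
  simp only
  rw [← integral_add_right_eq_self (fun x => U x * F (x - t)) t]
  simp

theorem integral_avg (hF : BddSupp a b F) (hh : 0 ≤ h) :
    ∫ x, WaveletFrame.avg h F x = h * ∫ x, F x := by
  have := hF.integral_mul_avg hh (U := fun _ => 1) continuous_const
  simpa [integral_const_mul] using this

theorem integral_avg_iterate (hF : BddSupp a b F) (hh : 0 ≤ h) (j : ℕ) :
    ∫ x, (WaveletFrame.avg h)^[j] F x = h ^ j * ∫ x, F x := by
  induction j with
  | zero => simp
  | succ j ih =>
    rw [Function.iterate_succ_apply', (hF.avg_iterate hh j).integral_avg hh, ih]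
    ring

theorem integral_one_add_shift_pow (hF : BddSupp a b F) (hh : 0 ≤ h) (j : ℕ) :
    ∫ x, ((1 + WaveletFrame.shift h) ^ j) F x = 2 ^ j * ∫ x, F x := by
  induction j with
  | zero => simp
  | succ j ih =>
    have := hF.one_add_shift_pow hh j
    rw [pow_succ', Module.End.mul_apply]
    simp only [LinearMap.add_apply, Module.End.one_apply, Pi.add_apply]
    rw [integral_add this.integrable (this.shift h).integrable]
    simp only [shift_apply]
    rw [integral_sub_right_eq_self (fun x => ((1 + WaveletFrame.shift h) ^ j) F x) h, ih]
    ring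

theorem avg_one_sub_shift (hF : BddSupp a b F) :
    WaveletFrame.avg h ((1 - WaveletFrame.shift h) F) =
      (1 - WaveletFrame.shift h) (WaveletFrame.avg h F) := by
  funext x
  simp only [WaveletFrame.avg, LinearMap.sub_apply, Module.End.one_apply, Pi.sub_apply, shift_apply]
  have i (y : ℝ) : IntervalIntegrable (fun t => F (y - t)) volume 0 h :=
    (hF.integrable.comp_sub_left y).intervalIntegrable
  rw [← intervalIntegral.integral_sub (i x) (i (x - h))]
  refine intervalIntegral.integral_congr fun t _ => ?_
  rw [sub_right_comm]

theorem avg_one_sub_shift_pow (hF : BddSupp a b F) (hh : 0 ≤ h) (j : ℕ) :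
    WaveletFrame.avg h (((1 - WaveletFrame.shift h) ^ j) F) =
      ((1 - WaveletFrame.shift h) ^ j) (WaveletFrame.avg h F) := by
  induction j with
  | zero => simp
  | succ j ih =>
    rw [pow_succ', Module.End.mul_apply, (hF.one_sub_shift_pow hh j).avg_one_sub_shift, ih,
      Module.End.mul_apply]

theorem prim_one_sub_shift (hF : BddSupp a b F) :
    prim ((1 - WaveletFrame.shift h) F) = WaveletFrame.avg h F := by
  funext x
  have e : ∫ t in Set.Iic x, F (t - h) = ∫ t in Set.Iic (x - h), F t := by
    rw [← integral_indicator measurableSet_Iic, ← integral_indicator measurableSet_Iic,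
      ← integral_sub_right_eq_self (fun t => (Set.Iic (x - h)).indicator (fun t => F t) t) h]
    refine integral_congr_ae (Eventually.of_forall fun t => ?_)
    simp [Set.indicator_apply]
  simp only [prim, LinearMap.sub_apply, Module.End.one_apply, Pi.sub_apply, shift_apply]
  rw [integral_sub hF.integrable.integrableOn (hF.integrable.comp_sub_right h).integrableOn, e,
    intervalIntegral.integral_Iic_sub_Iic hF.integrable.integrableOn hF.integrable.integrableOn,
    avg_eq]

theorem prim_iterate_one_sub_shift_pow (hF : BddSupp a b F) (hh : 0 ≤ h) (j : ℕ) :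
    prim^[j] (((1 - WaveletFrame.shift h) ^ j) F) = (WaveletFrame.avg h)^[j] F := by
  -- Each averaging enlarges the support, so the right end point has to vary in the induction.
  induction j generalizing b F with
  | zero => simp
  | succ j ih =>
    rw [Function.iterate_succ_apply, pow_succ', Module.End.mul_apply,
      (hF.one_sub_shift_pow hh j).prim_one_sub_shift, hF.avg_one_sub_shift_pow hh, ih (hF.avg hh),
      Function.iterate_succ_apply]

end BddSupp

/-! ### Integration by parts on the line -/

/-- `f` is an `a`-fold primitive of `g`, in the sense of integration by parts against smooth
functions; the derivatives of the smooth function are given as a sequence. -/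
def IsPrim (a : ℕ) (g f : ℝ → ℝ) : Prop :=
  ∀ U : ℕ → ℝ → ℝ, (∀ i x, HasDerivAt (U i) (U (i + 1) x) x) →
    ∫ x, U 0 x * g x = (-1) ^ a * ∫ x, U a x * f x

theorem IsPrim.smul {a : ℕ} {g f : ℝ → ℝ} (h : IsPrim a g f) (c : ℝ) :
    IsPrim a (c • g) (c • f) := by
  intro U hU
  simp only [Pi.smul_apply, smul_eq_mul, mul_left_comm _ c, integral_const_mul]
  rw [h U hU]

/-- Integration by parts is compatible with affine changes of variables. -/
theorem IsPrim.comp_affine {a : ℕ} {g f : ℝ → ℝ} (h : IsPrim a g f) {l : ℝ} (hl : 0 < l) (κ : ℝ) :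
    IsPrim a (fun x => l ^ a * g (l * x - κ)) fun x => f (l * x - κ) := by
  intro U hU
  have hsub (w : ℝ → ℝ) : ∫ x, w (l * x - κ) = l⁻¹ * ∫ y, w y := by
    rw [Measure.integral_comp_mul_left (fun y => w (y - κ)) l,
      integral_sub_right_eq_self (fun y => w y) κ, abs_of_pos (inv_pos.2 hl), smul_eq_mul]
  -- By the chain rule these are again the successive derivatives of one function, namely `U 0` in
  -- the new variable.
  have hk := h (fun i y => (l⁻¹) ^ i * U i ((y + κ) * l⁻¹)) fun i y => by
    have h1 : HasDerivAt (fun y : ℝ => (y + κ) * l⁻¹) (1 * l⁻¹) y :=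
      ((hasDerivAt_id y).add_const κ).mul_const _
    have := ((hU i ((y + κ) * l⁻¹)).comp y h1).const_mul (l⁻¹ ^ i)
    refine this.congr_deriv ?_
    rw [one_mul, pow_succ]
    ring
  have e (x : ℝ) : (l * x - κ + κ) * l⁻¹ = x := by field_simp; simp
  have e1 := hsub fun y => (l⁻¹) ^ 0 * U 0 ((y + κ) * l⁻¹) * g y
  have e2 := hsub fun y => (l⁻¹) ^ a * U a ((y + κ) * l⁻¹) * f y
  simp only [e, pow_zero, one_mul] at e1 e2 hk
  simp only [mul_assoc, integral_const_mul] at e2 hk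
  simp only [mul_left_comm _ (l ^ a), integral_const_mul]
  have hla : l ^ a ≠ 0 := (pow_pos hl a).ne'
  rw [e1, hk, mul_left_comm l⁻¹, ← e2, inv_pow, mul_left_comm (l ^ a), mul_inv_cancel_left₀ hla]

/-- Summation by parts, one factor at a time: a translation moves the difference onto `U`, where `U
x - U (x + h)` is minus the integral of `U'` over `[x, x + h]`, and Fubini's theorem moves that
average back onto `F`. No regularity of `F` beyond boundedness and measurability is needed. -/
theorem isPrim_one_sub_shift_pow {a b h : ℝ} {F : ℝ → ℝ} (hF : BddSupp a b F) (hh : 0 ≤ h) (j : ℕ) :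
    IsPrim j (((1 - shift h) ^ j) F) ((avg h)^[j] F) := by
  induction j generalizing b F with
  | zero => intro U _; simp
  | succ j ih =>
    intro U hU
    have hc (i : ℕ) : Continuous (U i) :=
      continuous_iff_continuousAt.2 fun x => (hU i x).continuousAt
    have step {b' : ℝ} {G : ℝ → ℝ} (hG : BddSupp a b' G) :
        ∫ x, U 0 x * (1 - shift h) G x = - ∫ x, U 1 x * avg h G x := by
      have i1 := hG.integrable_mul (hc 0)
      have i2 : Integrable fun x => U 0 (x + h) * G x :=
        hG.integrable_mul (U := fun x => U 0 (x + h)) ((hc 0).comp (by fun_prop))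
      have i3 : Integrable fun x => U 0 x * G (x - h) := (hG.shift h).integrable_mul (hc 0)
      have e : ∫ x, U 0 x * G (x - h) = ∫ x, U 0 (x + h) * G x := by
        rw [← integral_add_right_eq_self (fun x => U 0 x * G (x - h)) h]
        simp
      rw [hG.integral_mul_avg hh (hc 1)]
      simp only [LinearMap.sub_apply, Module.End.one_apply, Pi.sub_apply, shift_apply, mul_sub]
      rw [integral_sub i1 i3, e, ← integral_sub i1 i2, ← integral_neg]
      refine integral_congr_ae (Eventually.of_forall fun x => ?_)
      simp only
      rw [intervalIntegral.integral_comp_add_left (fun t => U 1 t) x,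
        intervalIntegral.integral_eq_sub_of_hasDerivAt (fun y _ => hU 0 y)
          ((hc 1).intervalIntegrable _ _)]
      simp
      ring
    rw [pow_succ' (1 - shift h), Module.End.mul_apply, step (hF.one_sub_shift_pow hh j),
      hF.avg_one_sub_shift_pow hh, ih (hF.avg hh) (fun i => U (i + 1)) fun i x => hU (i + 1) x,
      ← Function.iterate_succ_apply]
    ring

/-! ### B-splines -/

theorem bddSupp_bspline (m : ℕ) : BddSupp 0 (m + 1 : ℕ) (bspline (m + 1)) := by
  induction m with
  | zero =>
    refine ⟨measurable_one.indicator measurableSet_Icc, ⟨1, fun x => ?_⟩, fun x hx => ?_⟩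
    · simp only [bspline, Set.indicator_apply]
      split_ifs <;> simp
    · have := Set.mem_of_indicator_ne_zero hx
      simpa using this
  | succ m ih =>
    have := ih.avg zero_le_one
    exact this.mono le_rfl (by push_cast; rfl)

theorem integral_bspline (m : ℕ) : ∫ x, bspline (m + 1) x = 1 := by
  induction m with
  | zero =>
    simp only [bspline]
    rw [integral_indicator measurableSet_Icc]
    simp
  | succ m ih =>
    have := (bddSupp_bspline m).integral_avg zero_le_one
    rw [ih, mul_one] at this
    exact this

theorem bspline_nonneg (m : ℕ) (x : ℝ) : 0 ≤ bspline (m + 1) x := by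
  induction m generalizing x with
  | zero => exact Set.indicator_nonneg (fun _ _ => zero_le_one) x
  | succ m ih => exact intervalIntegral.integral_nonneg zero_le_one fun t _ => ih _

/-- Strict positivity identifies the support of the spline exactly, which is needed to turn the
support condition defining `M_n` into inequalities. -/
theorem bspline_pos (m : ℕ) {x : ℝ} (hx : x ∈ Set.Ioo (0 : ℝ) (m + 1 : ℕ)) :
    0 < bspline (m + 1) x := by
  induction m generalizing x with
  | zero =>
    have : x ∈ Set.Icc (0 : ℝ) 1 := ⟨hx.1.le, by simpa using hx.2.le⟩
    simp [bspline, this]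
  | succ m ih =>
    change 0 < ∫ t in (0 : ℝ)..1, bspline (m + 1) (x - t)
    push_cast at hx
    rw [intervalIntegral.integral_of_le zero_le_one, setIntegral_pos_iff_support_of_nonneg_ae
      (Eventually.of_forall fun t => bspline_nonneg m _)
      ((bddSupp_bspline m).integrable.comp_sub_left x).integrableOn]
    -- The `t ∈ (0, 1)` with `x - t` inside the open support of the lower-order spline form this
    -- interval, so it must be shown to be nonempty.
    have hlt : max 0 (x - (m + 1)) < min 1 x := by
      rw [max_lt_iff, lt_min_iff, lt_min_iff]
      refine ⟨⟨one_pos, hx.1⟩, by linarith [hx.2], ?_⟩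
      have : (0 : ℝ) ≤ m := m.cast_nonneg
      linarith
    refine lt_of_lt_of_le (b := volume (Set.Ioo (max 0 (x - (m + 1))) (min 1 x))) ?_
      (measure_mono fun t ht => ?_)
    · simpa using hlt
    · obtain ⟨h1, h2⟩ := ht
      rw [max_lt_iff] at h1
      rw [lt_min_iff] at h2
      refine ⟨(ih ⟨by linarith, ?_⟩).ne', h1.1, h2.1.le⟩
      push_cast
      linarith

/-- `⌊m/2⌋`, as a real number. -/
abbrev floorHalf (m : ℕ) : ℝ := (m / 2 : ℕ)

theorem floorHalf_nonneg (m : ℕ) : 0 ≤ floorHalf m := Nat.cast_nonneg _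

theorem floorHalf_le (m : ℕ) : floorHalf m ≤ m := Nat.cast_le.2 (Nat.div_le_self m 2)

section

variable {m : ℕ}

theorem bddSupp_phi₁ (h : 1 ≤ m) : BddSupp (-floorHalf m) (m - floorHalf m) (phi₁ m) := by
  obtain ⟨m, rfl⟩ := Nat.exists_eq_add_of_le' h
  have := (bddSupp_bspline m).comp_affine (l := 1) (κ := -floorHalf (m + 1)) one_pos
  simp only [one_mul, sub_neg_eq_add, div_one, ← sub_eq_add_neg, zero_sub] at this
  exact this

theorem integral_phi₁ (h : 1 ≤ m) : ∫ x, phi₁ m x = 1 := by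
  obtain ⟨m, rfl⟩ := Nat.exists_eq_add_of_le' h
  rw [← integral_bspline m]
  exact integral_add_right_eq_self (fun x => bspline (m + 1) x) _

theorem phi₁_pos (h : 1 ≤ m) {x : ℝ} (hx : x ∈ Set.Ioo (-floorHalf m) (m - floorHalf m)) : 0 < phi₁ m x := by
  obtain ⟨m, rfl⟩ := Nat.exists_eq_add_of_le' h
  exact bspline_pos m ⟨by linarith [hx.1], by linarith [hx.2]⟩

/-! ### Filters -/

/-- The constant in front of the filter polynomial. -/
def fcst (m a : ℕ) : ℝ := (-1) ^ (a / 2) * √(m.choose a) / 2 ^ m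

theorem fcst_ne_zero {a : ℕ} (ha : a ≤ m) : fcst m a ≠ 0 := by
  have : (0 : ℝ) < m.choose a := Nat.cast_pos.2 (Nat.choose_pos ha)
  have := Real.sqrt_pos.2 this
  unfold fcst
  positivity

/-- The filter polynomial. -/
def fpoly (m a : ℕ) : Polynomial ℝ := (1 - Polynomial.X) ^ a * (1 + Polynomial.X) ^ (m - a)

theorem natDegree_fpoly {a : ℕ} (ha : a ≤ m) : (fpoly m a).natDegree ≤ m := by
  refine (Polynomial.natDegree_mul_le).trans ?_
  have h1 : ((1 - Polynomial.X : Polynomial ℝ) ^ a).natDegree ≤ a := by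
    refine (Polynomial.natDegree_pow_le_of_le (m := 1) a ?_).trans (by simp)
    exact (Polynomial.natDegree_sub_le _ _).trans (by simp)
  have h2 : ((1 + Polynomial.X : Polynomial ℝ) ^ (m - a)).natDegree ≤ m - a := by
    refine (Polynomial.natDegree_pow_le_of_le (m := 1) (m - a) ?_).trans (by simp)
    exact (Polynomial.natDegree_add_le _ _).trans (by simp)
  omega

theorem filter₁_eq (m a j : ℕ) :
    filter₁ m a ((j : ℤ) - (m / 2 : ℕ)) = fcst m a * (fpoly m a).coeff j := by
  rw [filter₁, if_pos (by simp)]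
  simp [fcst, fpoly]

/-- The low-pass coefficients are nonzero multiples of binomial coefficients. The low-pass filter
therefore fills the whole box, and it alone encodes the constraint defining `K_n`. -/
theorem filter₁_zero_ne_zero {k : ℤ} (hk : k ∈ box₁ m) : filter₁ m 0 k ≠ 0 := by
  rw [box₁, Finset.mem_Icc] at hk
  obtain ⟨j, hj⟩ := Int.eq_ofNat_of_zero_le (a := k + (m / 2 : ℕ)) (by linarith [hk.1])
  obtain rfl : k = (j : ℤ) - (m / 2 : ℕ) := by linarith
  have hjm : j ≤ m := by omega
  rw [filter₁_eq]
  refine mul_ne_zero (fcst_ne_zero (Nat.zero_le _)) ?_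
  rw [fpoly, pow_zero, one_mul, Nat.sub_zero, Polynomial.coeff_one_add_X_pow]
  exact Nat.cast_ne_zero.2 (Nat.choose_pos hjm).ne'

theorem mem_box₁_of_filter₁_ne_zero {a : ℕ} (ha : a ≤ m) {k : ℤ} (hk : filter₁ m a k ≠ 0) :
    k ∈ box₁ m := by
  have h0 : 0 ≤ k + (m / 2 : ℕ) := by
    by_contra h
    exact hk (if_neg h)
  obtain ⟨j, hj⟩ := Int.eq_ofNat_of_zero_le h0
  obtain rfl : k = (j : ℤ) - (m / 2 : ℕ) := by linarith
  rw [filter₁_eq] at hk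
  have := (Polynomial.le_natDegree_of_ne_zero (right_ne_zero_of_mul hk)).trans (natDegree_fpoly ha)
  rw [box₁, Finset.mem_Icc]
  omega

/-- `∑_k q_a[k] F(x - k)`. -/
def fsum (m a : ℕ) (F : ℝ → ℝ) (x : ℝ) : ℝ := ∑ k ∈ box₁ m, filter₁ m a k * F (x - k)

/-- The filter coefficients are those of `fcst · (1 - z)^a (1 + z)^(m-a)` up to an index shift.
Evaluating this polynomial at the unit translation gives the filter sum, and the index shift becomes
the translation by `⌊m/2⌋`. -/
theorem fsum_eq {a : ℕ} (ha : a ≤ m) (F : ℝ → ℝ) :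
    fsum m a F = fcst m a •
      ((1 - shift 1) ^ a) (((1 + shift 1) ^ (m - a)) fun x => F (x + floorHalf m)) := by
  have e : ((1 - shift 1) ^ a) (((1 + shift 1) ^ (m - a)) fun x => F (x + floorHalf m)) =
      Polynomial.aeval (shift 1) (fpoly m a) fun x => F (x + floorHalf m) := by
    simp [fpoly, Module.End.mul_apply]
  rw [e, Polynomial.aeval_eq_sum_range' (Nat.lt_succ_of_le (natDegree_fpoly ha))]
  funext x
  rw [Pi.smul_apply, LinearMap.sum_apply, Finset.sum_apply, Finset.smul_sum, fsum]
  refine Finset.sum_nbij' (fun k => (k + (m / 2 : ℕ)).toNat) (fun j => (j : ℤ) - (m / 2 : ℕ))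
    ?_ ?_ ?_ ?_ ?_
  · intro k hk
    rw [box₁, Finset.mem_Icc] at hk
    rw [Finset.mem_range]
    omega
  · intro j hj
    rw [Finset.mem_range] at hj
    rw [box₁, Finset.mem_Icc]
    omega
  · intro k hk
    rw [box₁, Finset.mem_Icc] at hk
    omega
  · intro j hj
    omega
  · intro k hk
    rw [box₁, Finset.mem_Icc] at hk
    obtain ⟨j, hj⟩ := Int.eq_ofNat_of_zero_le (a := k + (m / 2 : ℕ)) (by linarith [hk.1])
    obtain rfl : k = (j : ℤ) - (m / 2 : ℕ) := by linarith
    rw [filter₁_eq]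
    simp only [sub_add_cancel, Int.toNat_natCast, LinearMap.smul_apply, Pi.smul_apply,
      shift_pow_apply, smul_eq_mul, mul_one]
    rw [mul_assoc, Int.cast_sub, Int.cast_natCast, Int.cast_natCast]
    congr 3
    ring

/-- The averaged function which turns the filter `q_a` into an `a`-th derivative. -/
def smear (m a : ℕ) (F : ℝ → ℝ) : ℝ → ℝ :=
  ((2 : ℝ) ^ (m - a))⁻¹ • (avg 1)^[a] (((1 + shift 1) ^ (m - a)) fun x => F (x + floorHalf m))

theorem bddSupp_comp_add {F : ℝ → ℝ} {r s : ℝ} (hF : BddSupp r s F) (c : ℝ) :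
    BddSupp (r - c) (s - c) fun x => F (x + c) := by
  have := hF.comp_affine (l := 1) (κ := -c) one_pos
  simpa [sub_eq_add_neg] using this

/-- The `m - a` shifts and `a` averages each extend the support by one to the right, `m` in all,
after a translation by `⌊m/2⌋` to the left. One smearing thus raises `r` by one, whatever `a` is. -/
theorem bddSupp_smear {a : ℕ} (ha : a ≤ m) {F : ℝ → ℝ} {r : ℝ}
    (hF : BddSupp (-(r * floorHalf m)) (r * (m - floorHalf m)) F) :
    BddSupp (-((r + 1) * floorHalf m)) ((r + 1) * (m - floorHalf m)) (smear m a F) := by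
  have := (((bddSupp_comp_add hF (floorHalf m)).one_add_shift_pow zero_le_one (m - a)).avg_iterate
    zero_le_one a).smul ((2 : ℝ) ^ (m - a))⁻¹
  refine this.mono (by linarith) ?_
  rw [Nat.cast_sub ha]
  linarith

/-- Each factor `1 + τ` doubles the integral and averaging over a unit window preserves it; the
normalization in `smear` cancels the resulting `2^(m-a)`. -/
theorem integral_smear {F : ℝ → ℝ} {r s : ℝ} (hF : BddSupp r s F) (a : ℕ) :
    ∫ x, smear m a F x = ∫ x, F x := by
  have h1 := bddSupp_comp_add hF (floorHalf m)
  have h2 := h1.one_add_shift_pow zero_le_one (m - a)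
  simp only [smear, Pi.smul_apply, smul_eq_mul, integral_const_mul]
  rw [h2.integral_avg_iterate zero_le_one, h1.integral_one_add_shift_pow zero_le_one,
    integral_add_right_eq_self (fun x => F x) (floorHalf m)]
  simp

/-- The constant relating filtered functions to averaged ones. -/
def scst (m a : ℕ) : ℝ := fcst m a * 2 ^ (m - a)

theorem scst_ne_zero {a : ℕ} (ha : a ≤ m) : scst m a ≠ 0 :=
  mul_ne_zero (fcst_ne_zero ha) (by positivity)

theorem scst_smul_smear (a : ℕ) (F : ℝ → ℝ) : scst m a • smear m a F =
    fcst m a • (avg 1)^[a] (((1 + shift 1) ^ (m - a)) fun x => F (x + floorHalf m)) := by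
  rw [smear, smul_smul, scst, mul_assoc, mul_inv_cancel₀ (by positivity), mul_one]

theorem isPrim_fsum_smear {a : ℕ} (ha : a ≤ m) {F : ℝ → ℝ} {r s : ℝ} (hF : BddSupp r s F) :
    IsPrim a ((scst m a)⁻¹ • fsum m a F) (smear m a F) := by
  have h1 := (isPrim_one_sub_shift_pow ((bddSupp_comp_add hF (floorHalf m)).one_add_shift_pow
    zero_le_one (m - a)) zero_le_one a).smul (fcst m a)
  rw [← fsum_eq ha, ← scst_smul_smear] at h1
  simpa [smul_smul, inv_mul_cancel₀ (scst_ne_zero ha)] using h1.smul (scst m a)⁻¹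

/-! ### Dilated primitives and the constants of the framelets -/

theorem prim_smul (c : ℝ) (g : ℝ → ℝ) : prim (c • g) = c • prim g := by
  funext x
  simp [prim, integral_const_mul]

theorem prim_iterate_smul (c : ℝ) (g : ℝ → ℝ) (a : ℕ) : prim^[a] (c • g) = c • prim^[a] g := by
  induction a generalizing g with
  | zero => rfl
  | succ a ih => rw [Function.iterate_succ_apply, prim_smul, ih, Function.iterate_succ_apply]

theorem prim_comp_mul {l : ℝ} (hl : 0 < l) (g : ℝ → ℝ) :
    prim (fun y => g (l * y)) = l⁻¹ • fun y => prim g (l * y) := by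
  funext x
  simp only [prim, Pi.smul_apply, smul_eq_mul]
  rw [← integral_indicator measurableSet_Iic, ← integral_indicator measurableSet_Iic]
  have := Measure.integral_comp_mul_left (fun y => (Set.Iic (l * x)).indicator (fun y => g y) y) l
  rw [abs_of_pos (inv_pos.2 hl), smul_eq_mul] at this
  rw [← this]
  refine integral_congr_ae (Eventually.of_forall fun t => ?_)
  simp [Set.indicator_apply, hl]

theorem prim_iterate_comp_mul {l : ℝ} (hl : 0 < l) (g : ℝ → ℝ) (a : ℕ) :
    prim^[a] (fun y => g (l * y)) = (l⁻¹) ^ a • fun y => prim^[a] g (l * y) := by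
  induction a generalizing g with
  | zero => simp
  | succ a ih =>
    rw [Function.iterate_succ_apply, prim_comp_mul hl, prim_iterate_smul, ih, smul_smul,
      ← pow_succ', Function.iterate_succ_apply]

theorem prim_iterate_fsum {a : ℕ} (ha : a ≤ m) {F : ℝ → ℝ} {r s : ℝ} (hF : BddSupp r s F) {l : ℝ}
    (hl : 0 < l) : prim^[a] (fun y => l * fsum m a F (l * y)) =
      fun y => l * (scst m a * (l ^ a)⁻¹) * smear m a F (l * y) := by
  have h2 := (bddSupp_comp_add hF (floorHalf m)).one_add_shift_pow zero_le_one (m - a)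
  have e : (fun y => l * fsum m a F (l * y)) = l • fun y => fsum m a F (l * y) := rfl
  rw [e, prim_iterate_smul, prim_iterate_comp_mul hl, fsum_eq ha, prim_iterate_smul,
    h2.prim_iterate_one_sub_shift_pow zero_le_one, ← scst_smul_smear]
  funext y
  simp only [Pi.smul_apply, smul_eq_mul]
  rw [inv_pow]
  ring

theorem integral_scaled {F : ℝ → ℝ} (hF : ∫ x, F x = 1) {l : ℝ} (hl : 0 < l) (c : ℝ) :
    ∫ y, l * c * F (l * y) = c := by
  rw [integral_const_mul, Measure.integral_comp_mul_left, hF, abs_of_pos (inv_pos.2 hl),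
    smul_eq_mul]
  field_simp

theorem integral_smear_phi₁ (h : 1 ≤ m) (a : ℕ) : ∫ x, smear m a (phi₁ m) x = 1 := by
  rw [integral_smear (bddSupp_phi₁ h), integral_phi₁ h]

theorem bddSupp_smear_phi₁ (h : 1 ≤ m) {a : ℕ} (ha : a ≤ m) :
    BddSupp (-(2 * floorHalf m)) (2 * (m - floorHalf m)) (smear m a (phi₁ m)) := by
  have h1 : BddSupp (-(1 * floorHalf m)) (1 * (m - floorHalf m)) (phi₁ m) := by simpa using bddSupp_phi₁ h
  exact (bddSupp_smear ha h1).mono (by linarith) (by linarith)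

theorem bddSupp_smear_smear_phi₁ (h : 1 ≤ m) {a b : ℕ} (ha : a ≤ m) (hb : b ≤ m) :
    BddSupp (-(3 * floorHalf m)) (3 * (m - floorHalf m)) (smear m b (smear m a (phi₁ m))) :=
  (bddSupp_smear hb (bddSupp_smear_phi₁ h ha)).mono (by linarith) (by linarith)

theorem integral_smear_smear_phi₁ (h : 1 ≤ m) {a : ℕ} (ha : a ≤ m) (b : ℕ) :
    ∫ x, smear m b (smear m a (phi₁ m)) x = 1 := by
  rw [integral_smear (bddSupp_smear_phi₁ h ha), integral_smear_phi₁ h]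

theorem vphi₁_eq_scst (h : 1 ≤ m) {a : ℕ} (ha : a ≤ m) :
    vphi₁ m a = fun y => 2 * (scst m a * (2 ^ a)⁻¹) * smear m a (phi₁ m) (2 * y) :=
  prim_iterate_fsum ha (bddSupp_phi₁ h) two_pos

/-- The framelet is a filtered spline dilated by `2`, and each of the `a` primitives of a dilate
costs a factor `1/2`. The explicit value shows that the constant does not vanish and cancels against
the weights of the transform. -/
theorem c₁_eq (h : 1 ≤ m) {a : ℕ} (ha : a ≤ m) : c₁ m a = scst m a * (2 ^ a)⁻¹ := by
  rw [c₁, vphi₁_eq_scst h ha, integral_scaled (integral_smear_phi₁ h a) two_pos]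

theorem c₁_ne_zero (h : 1 ≤ m) {a : ℕ} (ha : a ≤ m) : c₁ m a ≠ 0 := by
  rw [c₁_eq h ha]
  exact mul_ne_zero (scst_ne_zero ha) (by positivity)

theorem vphi₁_eq (h : 1 ≤ m) {a : ℕ} (ha : a ≤ m) (y : ℝ) :
    vphi₁ m a y = 2 * c₁ m a * smear m a (phi₁ m) (2 * y) := by
  rw [c₁_eq h ha, vphi₁_eq_scst h ha]

/-- The half-integer shifts combine with the dilation already in `vphi₁` to give integer shifts at
dilation `4`. The function to be integrated is therefore a filtered `smear m a φ` at that scale, and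
each primitive now costs `1/4`. -/
theorem c₂_eq (h : 1 ≤ m) {a b : ℕ} (ha : a ≤ m) (hb : b ≤ m) :
    c₂ m b a = scst m b * (4 ^ b)⁻¹ := by
  have e : (fun y : ℝ => 2 * (c₁ m a)⁻¹ *
      ∑ k ∈ box₁ m, filter₁ m b k * vphi₁ m a (2 * y - k / 2)) =
      fun y => 4 * fsum m b (smear m a (phi₁ m)) (4 * y) := by
    funext y
    rw [fsum, Finset.mul_sum, Finset.mul_sum]
    refine Finset.sum_congr rfl fun k _ => ?_
    have hc := c₁_ne_zero h ha
    rw [vphi₁_eq h ha, show 2 * (2 * y - (k : ℝ) / 2) = 4 * y - k by ring]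
    field_simp
    ring
  rw [c₂, vphi₂, e, prim_iterate_fsum hb (bddSupp_smear_phi₁ h ha) four_pos,
    integral_scaled (integral_smear_smear_phi₁ h ha b) four_pos]

end

/-! ### The index sets -/

open Classical in
theorem mem_M_iff {m : ℕ} (h : 1 ≤ m) {n : ℕ} {k : ℤ × ℤ} :
    k ∈ M m n ↔ (((m / 2 : ℕ) : ℤ) ≤ k.1 ∧ k.1 + m - (m / 2 : ℕ) ≤ 2 ^ n) ∧
      (((m / 2 : ℕ) : ℤ) ≤ k.2 ∧ k.2 + m - (m / 2 : ℕ) ≤ 2 ^ n) := by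
  have h2 : (0 : ℝ) < 2 ^ n := by positivity
  have hm0 : (0 : ℝ) < m := Nat.cast_pos.2 h
  have cast (j : ℤ) : (0 ≤ ((j : ℝ) - floorHalf m) / 2 ^ n ∧ ((j : ℝ) + m - floorHalf m) / 2 ^ n ≤ 1) ↔
      (((m / 2 : ℕ) : ℤ) ≤ j ∧ j + m - (m / 2 : ℕ) ≤ 2 ^ n) := by
    rw [div_le_one h2, div_nonneg_iff]
    have : (((m / 2 : ℕ) : ℤ) ≤ j ∧ j + m - (m / 2 : ℕ) ≤ 2 ^ n) ↔
        ((((m / 2 : ℕ) : ℤ) : ℝ) ≤ j ∧ ((j + m - (m / 2 : ℕ) : ℤ) : ℝ) ≤ ((2 ^ n : ℤ) : ℝ)) := by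
      rw [Int.cast_le, Int.cast_le]
    rw [this, Int.cast_sub, Int.cast_add, Int.cast_natCast, Int.cast_natCast]
    push_cast
    constructor
    · rintro ⟨h1 | h1, h3⟩
      · exact ⟨by linarith [h1.1], h3⟩
      · linarith [h1.2]
    · rintro ⟨h1, h3⟩
      exact ⟨Or.inl ⟨by linarith, h2.le⟩, h3⟩
  rw [M, Finset.mem_filter, closure_Ω]
  constructor
  · rintro ⟨-, hs⟩
    have hlt (j : ℤ) : ((j : ℝ) - floorHalf m) / 2 ^ n < ((j : ℝ) + m - floorHalf m) / 2 ^ n := by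
      gcongr
      linarith
    have hsub : Set.Ioo (((k.1 : ℝ) - floorHalf m) / 2 ^ n) (((k.1 : ℝ) + m - floorHalf m) / 2 ^ n) ×ˢ
        Set.Ioo (((k.2 : ℝ) - floorHalf m) / 2 ^ n) (((k.2 : ℝ) + m - floorHalf m) / 2 ^ n) ⊆
          Set.Icc (0 : ℝ) 1 ×ˢ Set.Icc (0 : ℝ) 1 := by
      refine Set.Subset.trans ?_ ((subset_tsupport _).trans hs)
      rintro ⟨x, y⟩ ⟨hx, hy⟩
      have key {j : ℤ} {x : ℝ}
          (hx : x ∈ Set.Ioo (((j : ℝ) - floorHalf m) / 2 ^ n) (((j : ℝ) + m - floorHalf m) / 2 ^ n)) :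
          0 < phi₁ m (2 ^ n * x - j) := by
        obtain ⟨h3, h4⟩ := hx
        rw [div_lt_iff₀ h2] at h3
        rw [lt_div_iff₀ h2] at h4
        exact phi₁_pos h ⟨by linarith, by linarith⟩
      exact (mul_pos h2 (mul_pos (key hx) (key hy))).ne'
    -- Positivity only puts the open rectangle into the square; the end points needed for the
    -- non-strict inequalities come from its closure.
    have hcl := closure_mono hsub
    rw [closure_prod_eq, closure_Ioo (hlt _).ne, closure_Ioo (hlt _).ne,
      (isClosed_Icc.prod isClosed_Icc).closure_eq] at hcl
    have hl := hcl (show ((((k.1 : ℝ) - floorHalf m) / 2 ^ n), (((k.2 : ℝ) - floorHalf m) / 2 ^ n)) ∈ _ from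
      ⟨⟨le_rfl, (hlt _).le⟩, ⟨le_rfl, (hlt _).le⟩⟩)
    have hr := hcl (show ((((k.1 : ℝ) + m - floorHalf m) / 2 ^ n), (((k.2 : ℝ) + m - floorHalf m) / 2 ^ n)) ∈ _
      from ⟨⟨(hlt _).le, le_rfl⟩, ⟨(hlt _).le, le_rfl⟩⟩)
    exact ⟨(cast _).1 ⟨hl.1.1, hr.1.2⟩, (cast _).1 ⟨hl.2.1, hr.2.2⟩⟩
  · rintro ⟨hk1, hk2⟩
    constructor
    · have := Nat.div_le_self m 2
      simp only [O, Finset.mem_product, Finset.mem_Icc]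
      exact ⟨⟨by omega, by omega⟩, ⟨by omega, by omega⟩⟩
    · refine closure_minimal ?_ (isClosed_Icc.prod isClosed_Icc)
      rintro ⟨x, y⟩ hxy
      have key {j : ℤ} {x : ℝ} (hj : ((m / 2 : ℕ) : ℤ) ≤ j ∧ j + m - (m / 2 : ℕ) ≤ 2 ^ n)
          (hx : phi₁ m (2 ^ n * x - j) ≠ 0) : x ∈ Set.Icc (0 : ℝ) 1 := by
        obtain ⟨h3, h4⟩ := (bddSupp_phi₁ h).supp _ hx
        obtain ⟨h5, h6⟩ := (cast j).2 hj
        rw [div_le_one h2] at h6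
        rw [le_div_iff₀ h2] at h5
        constructor
        · by_contra hneg
          nlinarith
        · by_contra hneg
          nlinarith
      have hne := right_ne_zero_of_mul hxy
      exact ⟨key hk1 (left_ne_zero_of_mul hne), key hk2 (right_ne_zero_of_mul hne)⟩

section

variable {m C n : ℕ}

open Classical in
theorem add_smul_mem_M {k : ℤ × ℤ} (hk : k ∈ K m C n) {l : ℤ × ℤ} (h1 : l.1 ∈ box₁ m)
    (h2 : l.2 ∈ box₁ m) : k + (C : ℤ) • l ∈ M m n :=
  (Finset.mem_filter.1 hk).2 (0, 0) (Nat.zero_le _) (Nat.zero_le _) l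
    (mul_ne_zero (filter₁_zero_ne_zero h1) (filter₁_zero_ne_zero h2))

/-- The defining condition at the two extreme corners of the low-pass box gives a margin of `C + 1 ≥
3` box lengths on each side. One is used by the spline itself and one by each of two smearings. -/
theorem bounds_of_mem_K (h : 1 ≤ m) (hC : 2 ≤ C) {k : ℤ × ℤ} (hk : k ∈ K m C n) :
    (3 * ((m / 2 : ℕ) : ℤ) ≤ k.1 ∧ k.1 + 3 * (m - (m / 2 : ℕ)) ≤ 2 ^ n) ∧
      (3 * ((m / 2 : ℕ) : ℤ) ≤ k.2 ∧ k.2 + 3 * (m - (m / 2 : ℕ)) ≤ 2 ^ n) := by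
  have hle : ((m / 2 : ℕ) : ℤ) ≤ m := Int.ofNat_le.2 (Nat.div_le_self m 2)
  have h0 : 0 ≤ ((m / 2 : ℕ) : ℤ) := Int.natCast_nonneg _
  have hlo : -((m / 2 : ℕ) : ℤ) ∈ box₁ m := by
    rw [box₁, Finset.mem_Icc]
    omega
  have hhi : (m : ℤ) - (m / 2 : ℕ) ∈ box₁ m := by
    rw [box₁, Finset.mem_Icc]
    omega
  have e1 := (mem_M_iff h).1 (add_smul_mem_M hk (l := (_, _)) hlo hlo)
  have e2 := (mem_M_iff h).1 (add_smul_mem_M hk (l := (_, _)) hhi hhi)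
  have hC' : (2 : ℤ) ≤ C := Int.ofNat_le.2 hC
  simp only [Prod.fst_add, Prod.snd_add, Prod.smul_fst, Prod.smul_snd, smul_eq_mul] at e1 e2
  obtain ⟨⟨a1, -⟩, a2, -⟩ := e1
  obtain ⟨⟨-, b1⟩, -, b2⟩ := e2
  generalize ((m / 2 : ℕ) : ℤ) = H at *
  refine ⟨⟨?_, ?_⟩, ?_, ?_⟩ <;> nlinarith

theorem add_mem_M (h : 1 ≤ m) (hC : 2 ≤ C) {k : ℤ × ℤ} (hk : k ∈ K m C n) {l : ℤ × ℤ}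
    (h1 : l.1 ∈ box₁ m) (h2 : l.2 ∈ box₁ m) : k + l ∈ M m n := by
  have hle : ((m / 2 : ℕ) : ℤ) ≤ m := Int.ofNat_le.2 (Nat.div_le_self m 2)
  obtain ⟨⟨a1, a2⟩, a3, a4⟩ := bounds_of_mem_K h hC hk
  rw [box₁, Finset.mem_Icc] at h1 h2
  rw [mem_M_iff h, Prod.fst_add, Prod.snd_add]
  omega

open Classical in
-- The margin is not sharp; it only has to be a number of cells independent of `n`.
theorem mem_K_of_bounds (h : 1 ≤ m) {k : ℤ × ℤ}
    (h1 : ((C + 1) * m : ℤ) ≤ k.1 ∧ k.1 + (C + 1) * m ≤ 2 ^ n)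
    (h2 : ((C + 1) * m : ℤ) ≤ k.2 ∧ k.2 + (C + 1) * m ≤ 2 ^ n) : k ∈ K m C n := by
  have hle : ((m / 2 : ℕ) : ℤ) ≤ m := Int.ofNat_le.2 (Nat.div_le_self m 2)
  have h0 : 0 ≤ ((m / 2 : ℕ) : ℤ) := Int.natCast_nonneg _
  have hC0 : (0 : ℤ) ≤ C := Int.natCast_nonneg _
  rw [K, Finset.mem_filter, mem_M_iff h]
  constructor
  · generalize ((m / 2 : ℕ) : ℤ) = H at *
    refine ⟨⟨?_, ?_⟩, ?_, ?_⟩ <;> nlinarith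
  · intro β hβ1 hβ2 l hl
    have hl1 := mem_box₁_of_filter₁_ne_zero hβ1 (left_ne_zero_of_mul hl)
    have hl2 := mem_box₁_of_filter₁_ne_zero hβ2 (right_ne_zero_of_mul hl)
    rw [box₁, Finset.mem_Icc] at hl1 hl2
    rw [mem_M_iff h]
    simp only [Prod.fst_add, Prod.snd_add, Prod.smul_fst, Prod.smul_snd, smul_eq_mul]
    generalize ((m / 2 : ℕ) : ℤ) = H at *
    refine ⟨⟨?_, ?_⟩, ?_, ?_⟩ <;> nlinarith

theorem cell_of_mem_K (h : 1 ≤ m) (hC : 2 ≤ C) {k : ℤ × ℤ} (hk : k ∈ K m C n) :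
    (0 ≤ k.1 ∧ k.1 + 1 ≤ 2 ^ n) ∧ (0 ≤ k.2 ∧ k.2 + 1 ≤ 2 ^ n) := by
  obtain ⟨⟨a1, a2⟩, a3, a4⟩ := bounds_of_mem_K h hC hk
  omega

/-! ### Piecewise constant functions -/

/-- The index of the dyadic cell of side `2^{-n}` containing `x`. -/
def cellIdx (n : ℕ) (x : ℝ × ℝ) : ℤ × ℤ := (⌊2 ^ n * x.1⌋, ⌊2 ^ n * x.2⌋)

theorem measurable_cellIdx (n : ℕ) : Measurable (cellIdx n) :=
  (Int.measurable_floor.comp (by fun_prop)).prodMk (Int.measurable_floor.comp (by fun_prop))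

theorem cellIdx_preimage (n : ℕ) (k : ℤ × ℤ) : cellIdx n ⁻¹' {k} =
    Set.Ico ((k.1 : ℝ) / 2 ^ n) ((k.1 + 1) / 2 ^ n) ×ˢ
      Set.Ico ((k.2 : ℝ) / 2 ^ n) ((k.2 + 1) / 2 ^ n) := by
  have h2 : (0 : ℝ) < 2 ^ n := by positivity
  ext x
  obtain ⟨k1, k2⟩ := k
  simp only [cellIdx, Set.mem_preimage, Set.mem_singleton_iff, Prod.mk.injEq, Int.floor_eq_iff,
    Set.mem_prod, Set.mem_Ico, div_le_iff₀ h2, lt_div_iff₀ h2, mul_comm]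

theorem μΩ_cell {k : ℤ × ℤ} (hk : (0 ≤ k.1 ∧ k.1 + 1 ≤ 2 ^ n) ∧ (0 ≤ k.2 ∧ k.2 + 1 ≤ 2 ^ n)) :
    μΩ.real (cellIdx n ⁻¹' {k}) = (2 ^ (2 * n))⁻¹ := by
  have h2 : (0 : ℝ) < 2 ^ n := by positivity
  have hsub {j : ℤ} (hj : 0 ≤ j ∧ j + 1 ≤ 2 ^ n) :
      Set.Ico ((j : ℝ) / 2 ^ n) ((j + 1) / 2 ^ n) ⊆ Set.Ico 0 1 := by
    refine Set.Ico_subset_Ico (div_nonneg (Int.cast_nonneg hj.1) h2.le) ?_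
    rw [div_le_one h2]
    exact_mod_cast hj.2
  have hvol (j : ℤ) : volume (Set.Ico ((j : ℝ) / 2 ^ n) ((j + 1) / 2 ^ n)) =
      ENNReal.ofReal (2 ^ n)⁻¹ := by
    rw [Real.volume_Ico]
    congr 1
    ring
  rw [Measure.real, μΩ, Measure.restrict_congr_set Ω_ae_eq_Ico, Measure.restrict_apply
    (measurable_cellIdx n (measurableSet_singleton k)), cellIdx_preimage,
    Set.inter_eq_left.2 (Set.prod_mono (hsub hk.1) (hsub hk.2)), Measure.volume_eq_prod,
    Measure.prod_prod, hvol, hvol, ENNReal.toReal_mul, ENNReal.toReal_ofReal (by positivity),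
    ← mul_inv, ← pow_add, two_mul]

/-- The piecewise constant function with the values of an array on `K_n`. -/
def step (a : K m C n → ℝ) (x : ℝ × ℝ) : ℝ :=
  if h : cellIdx n x ∈ K m C n then a ⟨cellIdx n x, h⟩ else 0

theorem measurable_step (a : K m C n → ℝ) : Measurable (step a) :=
  (measurable_of_countable fun k : ℤ × ℤ => if h : k ∈ K m C n then a ⟨k, h⟩ else 0).comp
    (measurable_cellIdx n)

theorem memLp_step (a : K m C n → ℝ) (p : ℝ≥0∞) : MemLp (step a) p μΩ := by
  refine MemLp.of_bound (measurable_step a).aestronglyMeasurable (∑ k, ‖a k‖)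
    (Eventually.of_forall fun x => ?_)
  rw [step]
  split_ifs with hx
  · exact Finset.single_le_sum (f := fun k => ‖a k‖) (fun _ _ => norm_nonneg _)
      (Finset.mem_univ _)
  · simpa using Finset.sum_nonneg fun k _ => norm_nonneg (a k)

theorem integral_step (h : 1 ≤ m) (hC : 2 ≤ C) (a : K m C n → ℝ) :
    ∫ x, step a x ∂μΩ = (2 ^ (2 * n))⁻¹ * ∑ k, a k := by
  have e : step a = fun x => ∑ k : K m C n, (cellIdx n ⁻¹' {k.1}).indicator (fun _ => a k) x := by
    funext x
    rw [step]
    split_ifs with hx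
    · rw [Finset.sum_eq_single ⟨cellIdx n x, hx⟩]
      · simp
      · intro k _ hk
        refine Set.indicator_of_notMem (fun hx' => hk ?_) _
        exact Subtype.ext hx'.symm
      · simp
    · refine (Finset.sum_eq_zero fun k _ => Set.indicator_of_notMem (fun hx' => hx ?_) _).symm
      rw [show cellIdx n x = k.1 from hx']
      exact k.2
  have hms (k : ℤ × ℤ) : MeasurableSet (cellIdx n ⁻¹' {k}) :=
    measurable_cellIdx n (measurableSet_singleton k)
  rw [e, integral_finsetSum _ fun k _ => (integrable_const _).indicator (hms _), Finset.mul_sum]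
  refine Finset.sum_congr rfl fun k _ => ?_
  rw [integral_indicator_const _ (hms _), μΩ_cell (cell_of_mem_K h hC k.2), smul_eq_mul]

end

/-- Discrete norms are norms of piecewise constant functions. -/
theorem arrayNorm_eq_vecNorm {m C n : ℕ} (h : 1 ≤ m) (hC : 2 ≤ C) {ι : Type} [Fintype ι]
    {p : ℝ≥0∞} (hp : 1 ≤ p) (hp' : p ≠ ⊤) (a : ι → K m C n → ℝ) :
    arrayNorm p a = vecNorm p fun i => step (a i) := by
  have h0 : 0 < p.toReal := ENNReal.toReal_pos (zero_lt_one.trans_le hp).ne' hp'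
  rw [arrayNorm, ← integral_step h hC, vecNorm]
  congr 2
  funext x
  simp only [step]
  split_ifs with hx
  · rfl
  · simp [h0.ne']

/-! ### Mixed norms and their convergence -/

section

variable {ι : Type} [Fintype ι] {p : ℝ≥0∞}

theorem memLp_sqrt_sum {g : ι → ℝ × ℝ → ℝ} (hg : ∀ i, MemLp (g i) p μΩ) :
    MemLp (fun x => √(∑ i, |g i x| ^ 2)) p μΩ := by
  have h1 : MemLp (fun x => ∑ i, ‖g i x‖) p μΩ := memLp_finsetSum _ fun i _ => (hg i).norm
  refine h1.mono ?_ (Eventually.of_forall fun x => ?_)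
  · refine Real.continuous_sqrt.comp_aestronglyMeasurable ?_
    exact Finset.aestronglyMeasurable_fun_sum _ fun i _ => ((hg i).1.norm).pow 2
  · rw [Real.norm_of_nonneg (Real.sqrt_nonneg _),
      Real.norm_of_nonneg (Finset.sum_nonneg fun i _ => norm_nonneg _)]
    refine Real.sqrt_le_iff.2 ⟨Finset.sum_nonneg fun i _ => norm_nonneg _, ?_⟩
    exact Finset.sum_sq_le_sq_sum_of_nonneg fun i _ => norm_nonneg (g i x)

/-- The reverse triangle inequality in Euclidean space, followed by the bound of the `ℓ_2` norm by
the `ℓ_1` norm. It reduces convergence in the mixed norm to convergence of each component. -/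
theorem abs_sqrt_sum_sub_le (a b : ι → ℝ) :
    |√(∑ i, |a i| ^ 2) - √(∑ i, |b i| ^ 2)| ≤ ∑ i, |a i - b i| := by
  have e (c : ι → ℝ) : √(∑ i, |c i| ^ 2) = ‖(WithLp.toLp 2 c : EuclideanSpace ℝ ι)‖ := by
    rw [EuclideanSpace.norm_eq]
    rfl
  rw [e, e]
  refine (abs_norm_sub_norm_le _ _).trans ?_
  rw [← WithLp.toLp_sub, ← e]
  refine Real.sqrt_le_iff.2 ⟨Finset.sum_nonneg fun i _ => abs_nonneg _, ?_⟩
  exact Finset.sum_sq_le_sq_sum_of_nonneg fun i _ => abs_nonneg ((a - b) i)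

theorem vecNorm_eq_eLpNorm (hp : 1 ≤ p) (hp' : p ≠ ⊤) {g : ι → ℝ × ℝ → ℝ}
    (hg : ∀ i, MemLp (g i) p μΩ) :
    vecNorm p g = (eLpNorm (fun x => √(∑ i, |g i x| ^ 2)) p μΩ).toReal := by
  rw [(memLp_sqrt_sum hg).eLpNorm_eq_integral_rpow_norm (zero_lt_one.trans_le hp).ne' hp',
    ENNReal.toReal_ofReal (by positivity), vecNorm, one_div]
  congr 2
  funext x
  have h0 : 0 ≤ ∑ i, |g i x| ^ 2 := Finset.sum_nonneg fun i _ => by positivity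
  rw [Real.norm_of_nonneg (Real.sqrt_nonneg _), Real.sqrt_eq_rpow, ← Real.rpow_mul h0]
  congr 1
  ring

theorem tendsto_vecNorm (hp : 1 ≤ p) (hp' : p ≠ ⊤) {G : ℕ → ι → ℝ × ℝ → ℝ}
    {g : ι → ℝ × ℝ → ℝ} (hG : ∀ n i, MemLp (G n i) p μΩ) (hg : ∀ i, MemLp (g i) p μΩ)
    (hlim : ∀ i, Tendsto (fun n => eLpNorm (G n i - g i) p μΩ) atTop (𝓝 0)) :
    Tendsto (fun n => vecNorm p (G n)) atTop (𝓝 (vecNorm p g)) := by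
  have : Fact (1 ≤ p) := ⟨hp⟩
  simp only [vecNorm_eq_eLpNorm hp hp' (hG _), vecNorm_eq_eLpNorm hp hp' hg]
  have key : Tendsto (fun n => eLpNorm ((fun x => √(∑ i, |G n i x| ^ 2)) -
      fun x => √(∑ i, |g i x| ^ 2)) p μΩ) atTop (𝓝 0) := by
    have hsum : Tendsto (fun n => ∑ i, eLpNorm (G n i - g i) p μΩ) atTop (𝓝 0) := by
      simpa using tendsto_finsetSum Finset.univ fun i _ => hlim i
    refine tendsto_of_tendsto_of_tendsto_of_le_of_le tendsto_const_nhds hsum (fun _ => zero_le)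
      fun n => ?_
    calc _ ≤ eLpNorm (∑ i, fun x => ‖(G n i - g i) x‖) p μΩ := by
          refine eLpNorm_mono_real fun x => ?_
          rw [Finset.sum_apply]
          exact abs_sqrt_sum_sub_le (fun i => G n i x) fun i => g i x
      _ ≤ ∑ i, eLpNorm (fun x => ‖(G n i - g i) x‖) p μΩ :=
          eLpNorm_sum_le (fun i _ => ((hG n i).sub (hg i)).1.norm) hp
      _ = _ := by simp only [eLpNorm_norm]
  have h2 := (Lp.tendsto_Lp_iff_tendsto_eLpNorm'' _ (fun n => memLp_sqrt_sum (hG n)) _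
    (memLp_sqrt_sum hg)).2 key
  simpa [Lp.norm_toLp] using h2.norm

end

/-! ### Smooth approximation of functions with weak derivatives -/

theorem contDiff_pd_iterate (e : ℝ × ℝ) (k : ℕ) {η : ℝ × ℝ → ℝ} (h : ContDiff ℝ ∞ η) :
    ContDiff ℝ ∞ ((pd e)^[k] η) := by
  induction k with
  | zero => exact h
  | succ k ih =>
    rw [Function.iterate_succ_apply']
    exact (ih.fderiv_right (m := ∞) (by simp)).clm_apply contDiff_const

theorem contDiff_pderiv (α : ℕ × ℕ) {η : ℝ × ℝ → ℝ} (h : ContDiff ℝ ∞ η) :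
    ContDiff ℝ ∞ (pderiv α η) :=
  contDiff_pd_iterate _ _ (contDiff_pd_iterate _ _ h)

theorem differentiable_of_smooth {η : ℝ × ℝ → ℝ} (h : ContDiff ℝ ∞ η) : Differentiable ℝ η :=
  h.differentiable (by simp)

theorem pd_iterate_comp_affine (e : ℝ × ℝ) (k : ℕ) {η : ℝ × ℝ → ℝ} (h : ContDiff ℝ ∞ η)
    (c l : ℝ) (b : ℝ × ℝ) : (pd e)^[k] (fun x => c * η (l • x + b)) =
      fun x => c * l ^ k * (pd e)^[k] η (l • x + b) := by
  induction k with
  | zero => simp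
  | succ k ih =>
    rw [Function.iterate_succ_apply', ih, Function.iterate_succ_apply']
    funext x
    set ζ := (pd e)^[k] η
    have hζ : HasFDerivAt ζ (fderiv ℝ ζ (l • x + b)) (l • x + b) :=
      (differentiable_of_smooth (contDiff_pd_iterate e k h) _).hasFDerivAt
    have hL : HasFDerivAt (fun x : ℝ × ℝ => l • x + b) (l • ContinuousLinearMap.id ℝ (ℝ × ℝ)) x :=
      ((hasFDerivAt_id x).const_smul l).add_const b
    have := (hζ.comp x hL).const_mul (c * l ^ k)
    have h2 : fderiv ℝ (fun x => c * l ^ k * ζ (l • x + b)) x = _ := this.fderiv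
    rw [pd, h2]
    simp only [smul_apply, ContinuousLinearMap.comp_apply,
      ContinuousLinearMap.id_apply, map_smul, smul_eq_mul, pd]
    ring

theorem pderiv_comp_affine (α : ℕ × ℕ) {η : ℝ × ℝ → ℝ} (h : ContDiff ℝ ∞ η) (l : ℝ) (b : ℝ × ℝ) :
    pderiv α (fun x => η (l • x + b)) =
      fun x => l ^ (α.1 + α.2) * pderiv α η (l • x + b) := by
  have h1 := pd_iterate_comp_affine (0, 1) α.2 h 1 l b
  simp only [one_mul] at h1
  simp only [pderiv]
  rw [h1, pd_iterate_comp_affine _ _ (contDiff_pd_iterate _ _ h), pow_add]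
  funext x
  ring

/-- The convolution with respect to Lebesgue measure on the plane. -/
def cv (f ρ : ℝ × ℝ → ℝ) : ℝ × ℝ → ℝ :=
  convolution f ρ (ContinuousLinearMap.lsmul ℝ ℝ) volume

theorem contDiff_cv {f ρ : ℝ × ℝ → ℝ} (hf : LocallyIntegrable f) (h : ContDiff ℝ ∞ ρ)
    (hρ : HasCompactSupport ρ) : ContDiff ℝ ∞ (cv f ρ) :=
  hρ.contDiff_convolution_right (n := (⊤ : ℕ∞)) _ hf h

theorem pd_iterate_cv (e : ℝ × ℝ) (k : ℕ) {f ρ : ℝ × ℝ → ℝ} (hf : LocallyIntegrable f)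
    (h : ContDiff ℝ ∞ ρ ∧ HasCompactSupport ρ) : (pd e)^[k] (cv f ρ) = cv f ((pd e)^[k] ρ) := by
  induction k with
  | zero => rfl
  | succ k ih =>
    rw [Function.iterate_succ_apply', ih, Function.iterate_succ_apply']
    obtain ⟨h1, h2⟩ := pd_iterate_smooth e k h
    funext x
    have h1' : ContDiff ℝ 1 ((pd e)^[k] ρ) := h1.of_le (by simp)
    rw [pd, cv, (h2.hasFDerivAt_convolution_right _ hf h1' x).fderiv,
      convolution_precompR_apply _ hf (h2.fderiv ℝ) (h1'.continuous_fderiv (by simp))]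
    rfl

theorem pderiv_cv (α : ℕ × ℕ) {f ρ : ℝ × ℝ → ℝ} (hf : LocallyIntegrable f)
    (h : ContDiff ℝ ∞ ρ ∧ HasCompactSupport ρ) : pderiv α (cv f ρ) = cv f (pderiv α ρ) := by
  simp only [pderiv]
  rw [pd_iterate_cv _ _ hf h, pd_iterate_cv _ _ hf (pd_iterate_smooth _ _ h)]

/-- A smooth bump function supported in the ball of radius `2^{-n-2}`. -/
def bump (n : ℕ) : ContDiffBump (0 : ℝ × ℝ) where
  rIn := (2 ^ (n + 3))⁻¹
  rOut := (2 ^ (n + 2))⁻¹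
  rIn_pos := by positivity
  rIn_lt_rOut := by
    gcongr
    · norm_num
    · omega

/-- A smooth mollifier supported in the ball of radius `2^{-n-2}`. -/
def moll (n : ℕ) : ℝ × ℝ → ℝ := (bump n).normed volume

theorem moll_smooth (n : ℕ) : ContDiff ℝ ∞ (moll n) ∧ HasCompactSupport (moll n) :=
  ⟨(bump n).contDiff_normed (n := (⊤ : ℕ∞)), (bump n).hasCompactSupport_normed⟩

theorem moll_le (n : ℕ) (x : ℝ × ℝ) : ‖moll n x‖ ≤ 16 * 4 ^ n := by
  rw [moll, Real.norm_of_nonneg ((bump n).nonneg_normed x)]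
  refine ((bump n).normed_le_div_measure_closedBall_rIn volume x).trans (le_of_eq ?_)
  rw [Measure.real, volume_closedBall_prod, ← ENNReal.ofReal_mul (by simp [bump]),
    ENNReal.toReal_ofReal (mul_self_nonneg _)]
  simp only [bump]
  have : (4 : ℝ) ^ n = 2 ^ n * 2 ^ n := by rw [← mul_pow]; norm_num
  rw [this, pow_add]
  field_simp
  norm_num

theorem integral_moll (n : ℕ) : ∫ x, moll n x = 1 := (bump n).integral_normed

theorem tsupport_moll (n : ℕ) : tsupport (moll n) = Metric.closedBall 0 (2 ^ (n + 2))⁻¹ :=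
  (bump n).tsupport_normed_eq

/-- The ratio of the contraction of the square towards its centre. -/
def ratio (n : ℕ) : ℝ := 1 - (2 ^ n)⁻¹

/-- The contraction of the square towards its centre. -/
def contr (n : ℕ) (x : ℝ × ℝ) : ℝ × ℝ := ratio n • x + (2⁻¹ * (2 ^ n)⁻¹, 2⁻¹ * (2 ^ n)⁻¹)

/-- The contraction takes `Ω` to points at distance more than `2^{-n}/2` from the boundary and moves
each point by at most `2^{-n}/2`. The mollifier's radius `2^{-n}/4` therefore fits inside `Ω` and
keeps the total displacement below `2^{-n}`. -/
theorem contr_mem {n : ℕ} {x : ℝ × ℝ} (hx : x ∈ Ω) {y : ℝ × ℝ}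
    (hy : contr n x - y ∈ tsupport (moll n)) : y ∈ Ω ∧ dist x y ≤ 1 * (2 ^ n)⁻¹ := by
  obtain ⟨x1, x2⟩ := x
  obtain ⟨y1, y2⟩ := y
  rw [tsupport_moll, mem_closedBall_zero_iff, Prod.norm_def, max_le_iff, pow_add, mul_inv] at hy
  have hq : 0 < ((2 : ℝ) ^ n)⁻¹ := by positivity
  have hq1 : ((2 : ℝ) ^ n)⁻¹ ≤ 1 := inv_le_one_of_one_le₀ (one_le_pow₀ one_le_two)
  simp only [contr, ratio, Prod.smul_mk, Prod.mk_add_mk, Prod.mk_sub_mk, smul_eq_mul,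
    Real.norm_eq_abs, abs_le] at hy
  obtain ⟨⟨h1, h1'⟩, h2, h2'⟩ := hy
  obtain ⟨⟨hx1, hx1'⟩, hx2, hx2'⟩ := hx
  simp only at hx1 hx1' hx2 hx2'
  generalize ((2 : ℝ) ^ n)⁻¹ = q at *
  refine ⟨⟨⟨?_, ?_⟩, ?_, ?_⟩, ?_⟩
  · simp only; nlinarith
  · simp only; nlinarith
  · simp only; nlinarith
  · simp only; nlinarith
  · rw [Prod.dist_eq, max_le_iff, Real.dist_eq, Real.dist_eq, abs_le, abs_le]
    simp only
    refine ⟨⟨?_, ?_⟩, ?_, ?_⟩ <;> nlinarith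

/-- The mollifying kernel. -/
def mollKer (n : ℕ) (x y : ℝ × ℝ) : ℝ := moll n (contr n x - y)

theorem continuous_contr (n : ℕ) : Continuous (contr n) := by
  unfold contr
  fun_prop

theorem approxKernel_mollKer : ApproxKernel mollKer (4 * 16 * 1 ^ 2) 1 := by
  refine ApproxKernel.of_bound zero_le_one (fun n => ?_) (fun n x y => moll_le n _)
    (fun n x hx y hy => (contr_mem hx (subset_tsupport _ hy)).2)
    fun x hx => Eventually.of_forall fun n => ?_
  · exact ((moll_smooth n).1.continuous.comp
      (((continuous_contr n).comp continuous_fst).sub continuous_snd)).measurable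
  · rw [setIntegral_eq_integral_of_forall_compl_eq_zero, ← integral_moll n]
    · exact integral_sub_left_eq_self (moll n) volume (contr n x)
    · intro y hy
      by_contra hne
      exact hy (contr_mem hx (subset_tsupport _ hne)).1

/-- The smooth approximations of a function on `Ω`. -/
def smth (n : ℕ) (u : ℝ × ℝ → ℝ) (x : ℝ × ℝ) : ℝ := cv (Ω.indicator u) (moll n) (contr n x)

section

variable {u g : ℝ × ℝ → ℝ}

theorem locallyIntegrable_indicator (hu : Integrable u μΩ) : LocallyIntegrable (Ω.indicator u) :=
  ((integrable_indicator_iff measurableSet_Ω).2 hu).locallyIntegrable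

theorem contDiff_smth (n : ℕ) (hu : Integrable u μΩ) : ContDiff ℝ ∞ (smth n u) := by
  refine (contDiff_cv (locallyIntegrable_indicator hu) (moll_smooth n).1 (moll_smooth n).2).comp ?_
  unfold contr
  fun_prop

theorem isTest_moll (n : ℕ) {x : ℝ × ℝ} (hx : x ∈ Ω) : IsTest fun y => moll n (contr n x - y) := by
  have hcl : tsupport (fun y => moll n (contr n x - y)) ⊆
      (fun y => contr n x - y) ⁻¹' tsupport (moll n) :=
    tsupport_comp_subset_preimage (moll n) (by fun_prop)
  have hcpt : IsCompact ((fun y => contr n x - y) ⁻¹' tsupport (moll n)) :=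
    (Homeomorph.subLeft (contr n x)).isCompact_preimage.2 (moll_smooth n).2
  refine ⟨(moll_smooth n).1.comp (by fun_prop), ?_, fun y hy => (contr_mem hx (hcl hy)).1⟩
  exact hcpt.of_isClosed_subset (isClosed_tsupport _) hcl

/-- Derivatives of the convolution fall on the mollifier, and for `x ∈ Ω` the mollifier centred at
the contracted point is an admissible test function. The sign in the definition of the weak
derivative cancels the one from reflecting the mollifier, and the chain rule for the contraction
leaves powers of `ratio n`, which tend to one. -/
theorem pderiv_smth {α : ℕ × ℕ} (n : ℕ) (hu : Integrable u μΩ) (h : HasWeakDeriv α u g)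
    {x : ℝ × ℝ} (hx : x ∈ Ω) :
    pderiv α (smth n u) x = kop (mollKer n) (fun y => ratio n ^ (α.1 + α.2) * g y) x := by
  have hloc := locallyIntegrable_indicator hu
  have h1 := pderiv_comp_affine α (contDiff_cv hloc (moll_smooth n).1 (moll_smooth n).2)
    (ratio n) (2⁻¹ * (2 ^ n)⁻¹, 2⁻¹ * (2 ^ n)⁻¹)
  have h2 : pderiv α (smth n u) x =
      ratio n ^ (α.1 + α.2) * pderiv α (cv (Ω.indicator u) (moll n)) (contr n x) :=
    congrFun h1 x
  have h3 := h _ (isTest_moll n hx)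
  have h4 := pderiv_comp_affine α (moll_smooth n).1 (-1) (contr n x)
  have h5 : (fun y => moll n ((-1 : ℝ) • y + contr n x)) = fun y => moll n (contr n x - y) := by
    funext y
    congr 1
    rw [neg_one_smul]
    abel
  rw [h5] at h4
  rw [h4] at h3
  have e1 : cv (Ω.indicator u) (pderiv α (moll n)) (contr n x) =
      ∫ y, u y * pderiv α (moll n) (contr n x - y) ∂μΩ := by
    rw [cv, convolution, ← integral_indicator measurableSet_Ω]
    refine integral_congr_ae (Eventually.of_forall fun y => ?_)
    by_cases hy : y ∈ Ω <;> simp [hy]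
  have e2 (y : ℝ × ℝ) : (-1 : ℝ) • y + contr n x = contr n x - y := by
    rw [neg_one_smul]
    abel
  have hs : ((-1 : ℝ) ^ (α.1 + α.2)) ≠ 0 := pow_ne_zero _ (by norm_num)
  simp only [e2, mul_left_comm _ ((-1 : ℝ) ^ (α.1 + α.2)), integral_const_mul] at h3
  rw [h2, pderiv_cv α hloc (moll_smooth n), e1, mul_left_cancel₀ hs h3, kop]
  simp only [mollKer, mul_left_comm _ (ratio n ^ (α.1 + α.2)), integral_const_mul]
  simp only [mul_comm]

theorem tendsto_ratio (k : ℕ) : Tendsto (fun n => ratio n ^ k) atTop (𝓝 1) := by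
  have : Tendsto (fun n : ℕ => ((2 : ℝ) ^ n)⁻¹) atTop (𝓝 0) := by
    exact tendsto_inv_atTop_zero.comp (tendsto_pow_atTop_atTop_of_one_lt (one_lt_two (α := ℝ)))
  simpa [ratio] using (this.const_sub 1).pow k

theorem tendsto_pderiv_smth {α : ℕ × ℕ} (hu : Integrable u μΩ) (hg : Integrable g μΩ)
    (h : HasWeakDeriv α u g) :
    Tendsto (fun n => eLpNorm (pderiv α (smth n u) - g) 1 μΩ) atTop (𝓝 0) := by
  have hg1 := memLp_one_iff_integrable.2 hg
  have key := approxKernel_mollKer.tendsto (by norm_num) le_rfl ENNReal.one_ne_top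
    (g := fun n y => ratio n ^ (α.1 + α.2) * g y) (fun n => hg1.const_mul _) hg1 ?_
  · refine key.congr fun n => eLpNorm_congr_ae ?_
    filter_upwards [ae_mem_Ω] with x hx
    rw [Pi.sub_apply, Pi.sub_apply, pderiv_smth n hu h hx]
  · have e (n : ℕ) : eLpNorm ((fun y => ratio n ^ (α.1 + α.2) * g y) - g) 1 μΩ =
        ‖ratio n ^ (α.1 + α.2) - 1‖ₑ * eLpNorm g 1 μΩ := by
      rw [← eLpNorm_const_smul]
      congr 1
      funext y
      simp [sub_mul]
    simp only [e]
    have h1 := ((tendsto_ratio (α.1 + α.2)).sub_const 1).enorm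
    simp only [sub_self, enorm_zero] at h1
    simpa using ENNReal.Tendsto.mul_const h1 (Or.inr hg1.eLpNorm_ne_top)

theorem hasWeakDeriv_zero (u : ℝ × ℝ → ℝ) : HasWeakDeriv (0, 0) u u := by
  intro η _
  simp [pderiv]

theorem tendsto_smth (hu : Integrable u μΩ) :
    Tendsto (fun n => eLpNorm (smth n u - u) 1 μΩ) atTop (𝓝 0) := by
  have := tendsto_pderiv_smth hu hu (hasWeakDeriv_zero u)
  simpa only [pderiv, Function.iterate_zero, id_eq] using this

end

/-! ### Integration by parts on the square -/

theorem integral_μΩ_eq {w : ℝ × ℝ → ℝ}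
    (hw : ∀ x, w x ≠ 0 → x.1 ∈ Set.Icc (0 : ℝ) 1 ∧ x.2 ∈ Set.Icc (0 : ℝ) 1) :
    ∫ x, w x ∂μΩ = ∫ x, w x := by
  rw [setIntegral_congr_set Ω_ae_eq_Icc, setIntegral_eq_integral_of_forall_compl_eq_zero]
  intro x hx
  by_contra hne
  exact hx (hw x hne)

section

variable {f₁ f₂ g₁ g₂ : ℝ → ℝ} {r₁ s₁ r₂ s₂ : ℝ}

theorem BddSupp.integrable_mul_prod (h₁ : BddSupp r₁ s₁ f₁) (h₂ : BddSupp r₂ s₂ f₂)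
    {η : ℝ × ℝ → ℝ} (hη : Continuous η) :
    Integrable fun x => η x * (f₁ x.1 * f₂ x.2) := by
  obtain ⟨B₁, hB₁⟩ := h₁.bdd
  obtain ⟨B₂, hB₂⟩ := h₂.bdd
  rw [← integrableOn_iff_integrable_of_support_subset (s := Set.Icc r₁ s₁ ×ˢ Set.Icc r₂ s₂)]
  · refine (hη.continuousOn.integrableOn_compact (isCompact_Icc.prod isCompact_Icc)).mul_bdd
      (c := B₁ * B₂) ((h₁.meas.comp measurable_fst).mul
        (h₂.meas.comp measurable_snd)).aestronglyMeasurable (Eventually.of_forall fun x => ?_)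
    rw [norm_mul]
    exact mul_le_mul (hB₁ _) (hB₂ _) (norm_nonneg _) ((norm_nonneg _).trans (hB₁ x.1))
  · intro x hx
    have := right_ne_zero_of_mul hx
    exact ⟨h₁.supp _ (left_ne_zero_of_mul this), h₂.supp _ (right_ne_zero_of_mul this)⟩

theorem hasDerivAt_pd_fst {η : ℝ × ℝ → ℝ} (h : ContDiff ℝ ∞ η) (i : ℕ) (x y : ℝ) :
    HasDerivAt (fun x => (pd (1, 0))^[i] η (x, y)) ((pd (1, 0))^[i + 1] η (x, y)) x := by
  rw [Function.iterate_succ_apply']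
  exact (differentiable_of_smooth (contDiff_pd_iterate (1, 0) i h) (x, y)).hasFDerivAt.comp_hasDerivAt
    x ((hasDerivAt_id x).prodMk (hasDerivAt_const x y))

theorem hasDerivAt_pd_snd {η : ℝ × ℝ → ℝ} (h : ContDiff ℝ ∞ η) (i : ℕ) (x y : ℝ) :
    HasDerivAt (fun y => (pd (0, 1))^[i] η (x, y)) ((pd (0, 1))^[i + 1] η (x, y)) y := by
  rw [Function.iterate_succ_apply']
  exact (differentiable_of_smooth (contDiff_pd_iterate (0, 1) i h) (x, y)).hasFDerivAt.comp_hasDerivAt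
    y ((hasDerivAt_const y x).prodMk (hasDerivAt_id y))

/-- Fubini's theorem and one-dimensional integration by parts, first in the second variable and then
in the first, matching the order of differentiation in `pderiv`. The supports lie in `[0, 1]`, so
the integrals extend to the plane and no boundary terms appear. -/
theorem integral_smooth_mul_prod {a b : ℕ} (hf₁ : BddSupp 0 1 f₁) (hf₂ : BddSupp 0 1 f₂)
    (hg₁ : BddSupp 0 1 g₁) (hg₂ : BddSupp 0 1 g₂) (h₁ : IsPrim a g₁ f₁) (h₂ : IsPrim b g₂ f₂)
    {η : ℝ × ℝ → ℝ} (hη : ContDiff ℝ ∞ η) :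
    ∫ x, η x * (g₁ x.1 * g₂ x.2) ∂μΩ =
      (-1) ^ (a + b) * ∫ x, pderiv (a, b) η x * (f₁ x.1 * f₂ x.2) ∂μΩ := by
  set ζ := (pd (0, 1))^[b] η with hζ
  have hζs : ContDiff ℝ ∞ ζ := contDiff_pd_iterate _ _ hη
  have ext {w : ℝ × ℝ → ℝ} {v₁ v₂ : ℝ → ℝ} (hv₁ : BddSupp 0 1 v₁) (hv₂ : BddSupp 0 1 v₂) :
      ∫ x, w x * (v₁ x.1 * v₂ x.2) ∂μΩ = ∫ x, w x * (v₁ x.1 * v₂ x.2) ∂(volume.prod volume) := by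
    refine integral_μΩ_eq fun x hx => ?_
    have := right_ne_zero_of_mul hx
    exact ⟨hv₁.supp _ (left_ne_zero_of_mul this), hv₂.supp _ (right_ne_zero_of_mul this)⟩
  have step₂ : ∫ x, η x * (g₁ x.1 * g₂ x.2) ∂μΩ =
      (-1) ^ b * ∫ x, ζ x * (g₁ x.1 * f₂ x.2) ∂μΩ := by
    rw [ext hg₁ hg₂, ext hg₁ hf₂, integral_prod _ (hg₁.integrable_mul_prod hg₂ hη.continuous),
      integral_prod _ (hg₁.integrable_mul_prod hf₂ hζs.continuous), ← integral_const_mul]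
    refine integral_congr_ae (Eventually.of_forall fun x => ?_)
    have := h₂ (fun i y => (pd (0, 1))^[i] η (x, y)) fun i y => hasDerivAt_pd_snd hη i x y
    simp only [mul_left_comm _ (g₁ x), integral_const_mul]
    simp only [Function.iterate_zero, id_eq] at this
    rw [this, mul_left_comm]
  have step₁ : ∫ x, ζ x * (g₁ x.1 * f₂ x.2) ∂μΩ =
      (-1) ^ a * ∫ x, pderiv (a, b) η x * (f₁ x.1 * f₂ x.2) ∂μΩ := by
    rw [ext hg₁ hf₂, ext hf₁ hf₂,
      integral_prod_symm _ (hg₁.integrable_mul_prod hf₂ hζs.continuous),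
      integral_prod_symm _ (hf₁.integrable_mul_prod hf₂ (contDiff_pderiv (a, b) hη).continuous),
      ← integral_const_mul]
    refine integral_congr_ae (Eventually.of_forall fun y => ?_)
    have := h₁ (fun i x => (pd (1, 0))^[i] ζ (x, y)) fun i x => hasDerivAt_pd_fst hζs i x y
    simp only [← mul_assoc, integral_mul_const]
    simp only [Function.iterate_zero, id_eq] at this
    rw [this]
    rfl
  rw [step₂, step₁, pow_add]
  ring

theorem tendsto_integral_mul_of_bdd {w : ℝ × ℝ → ℝ} (hw : Measurable w) {B : ℝ}
    (hB : ∀ x, ‖w x‖ ≤ B) {F : ℕ → ℝ × ℝ → ℝ} {f : ℝ × ℝ → ℝ} (hF : ∀ n, Integrable (F n) μΩ)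
    (hf : Integrable f μΩ) (h : Tendsto (fun n => eLpNorm (F n - f) 1 μΩ) atTop (𝓝 0)) :
    Tendsto (fun n => ∫ x, F n x * w x ∂μΩ) atTop (𝓝 (∫ x, f x * w x ∂μΩ)) := by
  have int {g : ℝ × ℝ → ℝ} (hg : Integrable g μΩ) : Integrable (fun x => g x * w x) μΩ :=
    hg.mul_bdd hw.aestronglyMeasurable (Eventually.of_forall hB)
  refine tendsto_integral_of_L1' _ (int hf).aestronglyMeasurable
    (Eventually.of_forall fun n => int (hF n)) ?_
  have h2 : Tendsto (fun n => ENNReal.ofReal B * eLpNorm (F n - f) 1 μΩ) atTop (𝓝 0) := by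
    simpa using ENNReal.Tendsto.const_mul h (Or.inr ENNReal.ofReal_ne_top)
  refine tendsto_of_tendsto_of_tendsto_of_le_of_le tendsto_const_nhds h2 (fun _ => zero_le)
    fun n => ?_
  refine eLpNorm_le_mul_eLpNorm_of_ae_le_mul (Eventually.of_forall fun x => ?_) 1
  simp only [Pi.sub_apply]
  rw [← sub_mul, norm_mul, mul_comm]
  gcongr
  exact hB x

theorem integrable_of_smooth {η : ℝ × ℝ → ℝ} (h : ContDiff ℝ ∞ η) : Integrable η μΩ := by
  rw [μΩ, Measure.restrict_congr_set Ω_ae_eq_Icc]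
  exact h.continuous.continuousOn.integrableOn_compact (isCompact_Icc.prod isCompact_Icc)

theorem BddSupp.prod_bdd (h₁ : BddSupp r₁ s₁ f₁) (h₂ : BddSupp r₂ s₂ f₂) :
    Measurable (fun x : ℝ × ℝ => f₁ x.1 * f₂ x.2) ∧ ∃ B, ∀ x : ℝ × ℝ, ‖f₁ x.1 * f₂ x.2‖ ≤ B := by
  obtain ⟨B₁, hB₁⟩ := h₁.bdd
  obtain ⟨B₂, hB₂⟩ := h₂.bdd
  refine ⟨(h₁.meas.comp measurable_fst).mul (h₂.meas.comp measurable_snd), B₁ * B₂, fun x => ?_⟩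
  rw [norm_mul]
  exact mul_le_mul (hB₁ _) (hB₂ _) (norm_nonneg _) ((norm_nonneg _).trans (hB₁ x.1))

/-- Weak derivatives may be tested with functions that are as smooth as needed in the sense of
`IsPrim`, and whose support may touch the boundary. -/
theorem HasWeakDeriv.integral_mul_prod {a b : ℕ} (hf₁ : BddSupp 0 1 f₁) (hf₂ : BddSupp 0 1 f₂)
    (hg₁ : BddSupp 0 1 g₁) (hg₂ : BddSupp 0 1 g₂) (h₁ : IsPrim a g₁ f₁) (h₂ : IsPrim b g₂ f₂)
    {u g : ℝ × ℝ → ℝ} (hu : Integrable u μΩ) (hg : Integrable g μΩ)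
    (h : HasWeakDeriv (a, b) u g) :
    ∫ x, u x * (g₁ x.1 * g₂ x.2) ∂μΩ = (-1) ^ (a + b) * ∫ x, g x * (f₁ x.1 * f₂ x.2) ∂μΩ := by
  obtain ⟨mf, Bf, hBf⟩ := hf₁.prod_bdd hf₂
  obtain ⟨mg, Bg, hBg⟩ := hg₁.prod_bdd hg₂
  have l1 := tendsto_integral_mul_of_bdd mg hBg
    (fun n => integrable_of_smooth (contDiff_smth n hu)) hu (tendsto_smth hu)
  have l2 := (tendsto_integral_mul_of_bdd mf hBf
    (fun n => integrable_of_smooth (contDiff_pderiv (a, b) (contDiff_smth n hu))) hg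
      (tendsto_pderiv_smth hu hg h)).const_mul ((-1) ^ (a + b))
  -- The identity holds for the smooth approximations of `u`. Both sides pass to the limit because
  -- the approximations and their derivatives converge in `L_1` while the weights are bounded.
  refine tendsto_nhds_unique l1 (l2.congr fun n => ?_)
  exact (integral_smooth_mul_prod hf₁ hf₂ hg₁ hg₂ h₁ h₂ (contDiff_smth n hu)).symm

end

/-! ### The embedding of `W_1^1(Ω)` into `L_2(Ω)` -/

/-- The fundamental theorem of calculus bounds the value at `x` by the value at any `t` plus the
total variation; averaging over `t` in the unit interval gives the claim. -/
theorem enorm_le_lintegral_add_lintegral_deriv {w w' : ℝ → ℝ} (h : ∀ x, HasDerivAt w (w' x) x)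
    (hc : Continuous w') {x : ℝ} (hx : x ∈ Set.Ioo (0 : ℝ) 1) :
    ‖w x‖ₑ ≤ ∫⁻ t in Set.Ioo (0 : ℝ) 1, (‖w t‖ₑ + ‖w' t‖ₑ) := by
  have hw : Continuous w := continuous_iff_continuousAt.2 fun x => (h x).continuousAt
  have key {t : ℝ} (ht : t ∈ Set.Ioo (0 : ℝ) 1) :
      ‖w x‖ₑ ≤ ‖w t‖ₑ + ∫⁻ s in Set.Ioo (0 : ℝ) 1, ‖w' s‖ₑ := by
    have e : w x = w t + ∫ s in t..x, w' s := by
      rw [intervalIntegral.integral_eq_sub_of_hasDerivAt (fun y _ => h y)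
        (hc.intervalIntegrable _ _)]
      ring
    rw [e]
    refine (enorm_add_le _ _).trans ?_
    gcongr
    rw [← ofReal_norm, intervalIntegral.norm_intervalIntegral_eq, ofReal_norm]
    refine (enorm_integral_le_lintegral_enorm _).trans (lintegral_mono_set fun s hs => ?_)
    rcases le_total t x with htx | htx
    · rw [Set.uIoc_of_le htx] at hs
      exact ⟨ht.1.trans hs.1, hs.2.trans_lt hx.2⟩
    · rw [Set.uIoc_of_ge htx] at hs
      exact ⟨hx.1.trans hs.1, hs.2.trans_lt ht.2⟩
  calc ‖w x‖ₑ = ∫⁻ _ in Set.Ioo (0 : ℝ) 1, ‖w x‖ₑ := by simp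
    _ ≤ ∫⁻ t in Set.Ioo (0 : ℝ) 1, (‖w t‖ₑ + ∫⁻ s in Set.Ioo (0 : ℝ) 1, ‖w' s‖ₑ) :=
        setLIntegral_mono' measurableSet_Ioo fun t ht => key ht
    _ = _ := by
        rw [lintegral_add_left hw.measurable.enorm, lintegral_add_left hw.measurable.enorm]
        simp

/-- The Gagliardo–Nirenberg argument: `|η(x, y)|` is bounded both by a function `B` of `x` alone and
by a function `A` of `y` alone. The integral of `|η|²` is then at most the product of two
one-dimensional integrals, each bounded by the right-hand side `S`. -/
theorem eLpNorm_two_le_of_smooth {η : ℝ × ℝ → ℝ} (hη : ContDiff ℝ ∞ η) :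
    eLpNorm η 2 μΩ ≤ eLpNorm η 1 μΩ + eLpNorm (pderiv (1, 0) η) 1 μΩ +
      eLpNorm (pderiv (0, 1) η) 1 μΩ := by
  set ν : Measure ℝ := volume.restrict (Set.Ioo (0 : ℝ) 1) with hν
  have c0 := hη.continuous
  have c1 := (contDiff_pderiv (1, 0) hη).continuous
  have c2 := (contDiff_pderiv (0, 1) hη).continuous
  have hm1 : Measurable fun z : ℝ × ℝ => ‖η z‖ₑ + ‖pderiv (1, 0) η z‖ₑ :=
    c0.measurable.enorm.add c1.measurable.enorm
  have hm2 : Measurable fun z : ℝ × ℝ => ‖η z‖ₑ + ‖pderiv (0, 1) η z‖ₑ :=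
    c0.measurable.enorm.add c2.measurable.enorm
  set S := eLpNorm η 1 μΩ + eLpNorm (pderiv (1, 0) η) 1 μΩ + eLpNorm (pderiv (0, 1) η) 1 μΩ
  set A : ℝ → ℝ≥0∞ := fun y => ∫⁻ t, (‖η (t, y)‖ₑ + ‖pderiv (1, 0) η (t, y)‖ₑ) ∂ν with hA
  set B : ℝ → ℝ≥0∞ := fun x => ∫⁻ t, (‖η (x, t)‖ₑ + ‖pderiv (0, 1) η (x, t)‖ₑ) ∂ν with hB
  have hAm : Measurable A := hm1.lintegral_prod_left'
  have hBm : Measurable B := hm2.lintegral_prod_right'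
  have hAS : ∫⁻ y, A y ∂ν ≤ S := by
    rw [hA, ← lintegral_prod_symm _ hm1.aemeasurable, ← μΩ_eq_prod,
      lintegral_add_left c0.measurable.enorm, ← eLpNorm_one_eq_lintegral_enorm,
      ← eLpNorm_one_eq_lintegral_enorm]
    exact le_self_add
  have hBS : ∫⁻ x, B x ∂ν ≤ S := by
    rw [hB, ← lintegral_prod _ hm2.aemeasurable, ← μΩ_eq_prod,
      lintegral_add_left c0.measurable.enorm, ← eLpNorm_one_eq_lintegral_enorm,
      ← eLpNorm_one_eq_lintegral_enorm]
    exact add_le_add le_self_add le_rfl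
  have hpt : ∀ z ∈ Ω, ‖η z‖ₑ ^ (2 : ℝ) ≤ B z.1 * A z.2 := by
    rintro ⟨x, y⟩ ⟨hx, hy⟩
    have hd1 (t : ℝ) := hasDerivAt_pd_fst hη 0 t y
    have hd2 (t : ℝ) := hasDerivAt_pd_snd hη 0 x t
    have h1 : ‖η (x, y)‖ₑ ≤ A y := enorm_le_lintegral_add_lintegral_deriv hd1
      (w' := fun t => pderiv (1, 0) η (t, y)) (c1.comp (by fun_prop)) hx
    have h2 : ‖η (x, y)‖ₑ ≤ B x := enorm_le_lintegral_add_lintegral_deriv hd2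
      (w' := fun t => pderiv (0, 1) η (x, t)) (c2.comp (by fun_prop)) hy
    rw [ENNReal.rpow_two, pow_two]
    exact mul_le_mul' h2 h1
  rw [eLpNorm_eq_lintegral_rpow_enorm_toReal two_ne_zero ENNReal.ofNat_ne_top, ENNReal.toReal_ofNat]
  calc (∫⁻ z, ‖η z‖ₑ ^ (2 : ℝ) ∂μΩ) ^ (1 / (2 : ℝ))
      ≤ (∫⁻ z, B z.1 * A z.2 ∂μΩ) ^ (1 / (2 : ℝ)) := by
        gcongr ?_ ^ _
        exact lintegral_mono_ae (ae_mem_Ω.mono hpt)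
    _ ≤ (S * S) ^ (1 / (2 : ℝ)) := by
        rw [μΩ_eq_prod, lintegral_prod_mul hBm.aemeasurable hAm.aemeasurable]
        gcongr
    _ = S := by
        rw [← pow_two, ← ENNReal.rpow_two, ← ENNReal.rpow_mul]
        norm_num

/-- The smooth inequality passes to the limit by Fatou's lemma along a subsequence of smooth
approximations converging almost everywhere. -/
theorem eLpNorm_two_le_of_hasWeakDeriv {u g₁ g₂ : ℝ × ℝ → ℝ} (hu : Integrable u μΩ)
    (hg₁ : Integrable g₁ μΩ) (hg₂ : Integrable g₂ μΩ) (h₁ : HasWeakDeriv (1, 0) u g₁)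
    (h₂ : HasWeakDeriv (0, 1) u g₂) :
    eLpNorm u 2 μΩ ≤ eLpNorm u 1 μΩ + eLpNorm g₁ 1 μΩ + eLpNorm g₂ 1 μΩ := by
  have sm (n : ℕ) := contDiff_smth n hu
  have mu (n : ℕ) : AEStronglyMeasurable (smth n u) μΩ := (sm n).continuous.aestronglyMeasurable
  obtain ⟨ns, hns, hae⟩ := (tendstoInMeasure_of_tendsto_eLpNorm one_ne_zero mu
    hu.aestronglyMeasurable (tendsto_smth hu)).exists_seq_tendsto_ae
  refine (Lp.eLpNorm_lim_le_liminf_eLpNorm (fun n => mu (ns n)) u hae).trans ?_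
  set S := eLpNorm u 1 μΩ + eLpNorm g₁ 1 μΩ + eLpNorm g₂ 1 μΩ
  have t0 := (tendsto_smth hu).comp hns.tendsto_atTop
  have t1 := (tendsto_pderiv_smth hu hg₁ h₁).comp hns.tendsto_atTop
  have t2 := (tendsto_pderiv_smth hu hg₂ h₂).comp hns.tendsto_atTop
  have lim : Tendsto (fun n => S + (eLpNorm (smth (ns n) u - u) 1 μΩ +
      eLpNorm (pderiv (1, 0) (smth (ns n) u) - g₁) 1 μΩ +
      eLpNorm (pderiv (0, 1) (smth (ns n) u) - g₂) 1 μΩ)) atTop (𝓝 (S + (0 + 0 + 0))) :=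
    ((t0.add t1).add t2).const_add S
  simp only [add_zero] at lim
  rw [← lim.liminf_eq]
  refine liminf_le_liminf (Eventually.of_forall fun n => ?_)
  refine (eLpNorm_two_le_of_smooth (sm (ns n))).trans ?_
  have tri {F f : ℝ × ℝ → ℝ} (hF : AEStronglyMeasurable F μΩ) (hf : AEStronglyMeasurable f μΩ) :
      eLpNorm F 1 μΩ ≤ eLpNorm f 1 μΩ + eLpNorm (F - f) 1 μΩ := by
    calc eLpNorm F 1 μΩ = eLpNorm (f + (F - f)) 1 μΩ := by rw [add_sub_cancel]
      _ ≤ _ := eLpNorm_add_le hf (hF.sub hf) le_rfl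
  have md (α : ℕ × ℕ) : AEStronglyMeasurable (pderiv α (smth (ns n) u)) μΩ :=
    (contDiff_pderiv α (sm (ns n))).continuous.aestronglyMeasurable
  refine (add_le_add (add_le_add (tri (mu (ns n)) hu.aestronglyMeasurable)
    (tri (md (1, 0)) hg₁.aestronglyMeasurable)) (tri (md (0, 1)) hg₂.aestronglyMeasurable)).trans
    (le_of_eq ?_)
  simp only [S]
  ring

/-! ### Bounds and convergence for elements of Sobolev spaces -/

theorem eLpNorm_coe_le {p r : ℝ≥0∞} (u : Lp ℝ p μΩ) (hr : r ≤ p) :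
    eLpNorm u r μΩ ≤ ENNReal.ofReal ‖u‖ := by
  rw [Lp.norm_def, ENNReal.ofReal_toReal (Lp.eLpNorm_ne_top u)]
  exact eLpNorm_le_eLpNorm_of_exponent_le hr (Lp.aestronglyMeasurable u)

section

variable {k : ℕ} {p : ℝ≥0∞} [hp : Fact (1 ≤ p)]

theorem integrable_coe (u : Lp ℝ p μΩ) : Integrable u μΩ := (Lp.memLp u).integrable hp.out

theorem hasWeakDeriv_wderiv (u : Sobolev k p) (α : ℕ × ℕ) (hα : α.1 + α.2 ≤ k) :
    HasWeakDeriv α (fn u) (wderiv u α hα) :=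
  u.2 ⟨α, mem_multiIdx hα⟩

theorem norm_wderiv_le (u : Sobolev k p) (α : ℕ × ℕ) (hα : α.1 + α.2 ≤ k) :
    ‖wderiv u α hα‖ ≤ ‖u‖ :=
  PiLp.norm_apply_le u.1 _

/-- The embedding of Sobolev spaces of positive order into `L_2(Ω)`. -/
theorem eLpNorm_two_fn_le (hk : 1 ≤ k) (u : Sobolev k p) :
    eLpNorm (fn u) 2 μΩ ≤ 3 * ENNReal.ofReal ‖u‖ := by
  have h (α : ℕ × ℕ) (hα : α.1 + α.2 ≤ k) : eLpNorm (wderiv u α hα) 1 μΩ ≤ ENNReal.ofReal ‖u‖ :=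
    (eLpNorm_coe_le _ hp.out).trans (ENNReal.ofReal_le_ofReal (norm_wderiv_le u α hα))
  refine (eLpNorm_two_le_of_hasWeakDeriv (integrable_coe _) (integrable_coe _) (integrable_coe _)
    (hasWeakDeriv_wderiv u (1, 0) (by simpa using hk))
    (hasWeakDeriv_wderiv u (0, 1) (by simpa using hk))).trans ?_
  refine (add_le_add (add_le_add (h (0, 0) (by simp)) (h _ _)) (h _ _)).trans (le_of_eq ?_)
  ring

theorem memLp_two_fn (hk : 1 ≤ k) (u : Sobolev k p) : MemLp (fn u) 2 μΩ :=
  ⟨Lp.aestronglyMeasurable _, (eLpNorm_two_fn_le hk u).trans_lt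
    (ENNReal.mul_lt_top (by simp) ENNReal.ofReal_lt_top)⟩

theorem fn_sub (u v : Sobolev k p) : fn (u - v) = fn u - fn v := rfl

theorem wderiv_sub (u v : Sobolev k p) (α : ℕ × ℕ) (hα : α.1 + α.2 ≤ k) :
    wderiv (u - v) α hα = wderiv u α hα - wderiv v α hα := rfl

variable {u : ℕ → Sobolev k p} {u₀ : Sobolev k p}

theorem tendsto_ofReal_norm_sub (h : Tendsto u atTop (𝓝 u₀)) :
    Tendsto (fun n => ENNReal.ofReal ‖u n - u₀‖) atTop (𝓝 0) := by
  simpa using ENNReal.tendsto_ofReal (tendsto_iff_norm_sub_tendsto_zero.1 h)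

theorem tendsto_eLpNorm_fn_sub (hk : 1 ≤ k) (h : Tendsto u atTop (𝓝 u₀))
    {r : ℝ≥0∞} (hr : r ≤ 2) :
    Tendsto (fun n => eLpNorm (fn (u n) - fn u₀ : ℝ × ℝ → ℝ) r μΩ) atTop (𝓝 0) := by
  have h3 : Tendsto (fun n => 3 * ENNReal.ofReal ‖u n - u₀‖) atTop (𝓝 0) := by
    simpa using ENNReal.Tendsto.const_mul (tendsto_ofReal_norm_sub h) (Or.inr (by simp))
  refine tendsto_of_tendsto_of_tendsto_of_le_of_le tendsto_const_nhds h3 (fun _ => zero_le)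
    fun n => ?_
  refine (eLpNorm_le_eLpNorm_of_exponent_le hr ((Lp.aestronglyMeasurable _).sub
    (Lp.aestronglyMeasurable _))).trans ?_
  rw [eLpNorm_congr_ae (Lp.coeFn_sub (fn (u n)) (fn u₀)).symm, ← fn_sub]
  exact eLpNorm_two_fn_le hk _

theorem tendsto_eLpNorm_wderiv_sub (h : Tendsto u atTop (𝓝 u₀)) (α : ℕ × ℕ)
    (hα : α.1 + α.2 ≤ k) :
    Tendsto (fun n => eLpNorm (wderiv (u n) α hα - wderiv u₀ α hα : ℝ × ℝ → ℝ) p μΩ) atTop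
      (𝓝 0) := by
  refine tendsto_of_tendsto_of_tendsto_of_le_of_le tendsto_const_nhds (tendsto_ofReal_norm_sub h)
    (fun _ => zero_le) fun n => ?_
  rw [eLpNorm_congr_ae (Lp.coeFn_sub (wderiv (u n) α hα) (wderiv u₀ α hα)).symm, ← wderiv_sub,
    ← ENNReal.ofReal_toReal (Lp.eLpNorm_ne_top _), ← Lp.norm_def]
  exact ENNReal.ofReal_le_ofReal (norm_wderiv_le _ _ _)

end

/-! ### Sampling -/

/-- `4^n ∫ g θ₁(2^n y₁ - k₁) θ₂(2^n y₂ - k₂) dy`. -/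
def samp (θ₁ θ₂ : ℝ → ℝ) (n : ℕ) (g : ℝ × ℝ → ℝ) (k : ℤ × ℤ) : ℝ :=
  4 ^ n * ∫ y, g y * (θ₁ (2 ^ n * y.1 - k.1) * θ₂ (2 ^ n * y.2 - k.2)) ∂μΩ

section

variable {m C n : ℕ}

/-- For `k ∈ K_n` the sampling functions live in the closed square, so restricting the integral to
`Ω` cuts nothing off. Both the normalization and the integration by parts depend on this. -/
theorem bddSupp_scaled (h : 1 ≤ m) (hC : 2 ≤ C) {k : ℤ × ℤ} (hk : k ∈ K m C n) {θ : ℝ → ℝ}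
    (hθ : BddSupp (-(3 * floorHalf m)) (3 * (m - floorHalf m)) θ) :
    BddSupp 0 1 (fun y => θ (2 ^ n * y - k.1)) ∧ BddSupp 0 1 (fun y => θ (2 ^ n * y - k.2)) := by
  have h2 : (0 : ℝ) < 2 ^ n := by positivity
  have key {j : ℤ} (hj : 3 * ((m / 2 : ℕ) : ℤ) ≤ j ∧ j + 3 * (m - (m / 2 : ℕ)) ≤ 2 ^ n) :
      BddSupp 0 1 (fun y => θ (2 ^ n * y - j)) := by
    have a1 : ((3 * ((m / 2 : ℕ) : ℤ) : ℤ) : ℝ) ≤ j := Int.cast_le.2 hj.1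
    have a2 : ((j + 3 * (m - (m / 2 : ℕ)) : ℤ) : ℝ) ≤ ((2 ^ n : ℤ) : ℝ) := Int.cast_le.2 hj.2
    rw [Int.cast_mul, Int.cast_natCast, Int.cast_ofNat] at a1
    rw [Int.cast_add, Int.cast_mul, Int.cast_sub, Int.cast_natCast, Int.cast_natCast,
      Int.cast_ofNat, Int.cast_pow, Int.cast_ofNat] at a2
    refine (hθ.comp_affine (κ := j) h2).mono (div_nonneg (by linarith) h2.le) ?_
    rw [div_le_one h2]
    linarith
  obtain ⟨b1, b2⟩ := bounds_of_mem_K h hC hk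
  exact ⟨key b1, key b2⟩

/-- The kernel of the sampling operator. -/
def sampKer (m C : ℕ) (θ₁ θ₂ : ℝ → ℝ) (n : ℕ) (x y : ℝ × ℝ) : ℝ :=
  if cellIdx n x ∈ K m C n then
    4 ^ n * (θ₁ (2 ^ n * y.1 - (cellIdx n x).1) * θ₂ (2 ^ n * y.2 - (cellIdx n x).2)) else 0

theorem kop_sampKer (θ₁ θ₂ : ℝ → ℝ) (g : ℝ × ℝ → ℝ) :
    kop (sampKer m C θ₁ θ₂ n) g = step fun k : K m C n => samp θ₁ θ₂ n g k.1 := by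
  funext x
  rw [step]
  split_ifs with hx
  · simp only [kop, sampKer, if_pos hx, samp]
    rw [← integral_const_mul]
    refine integral_congr_ae (Eventually.of_forall fun y => ?_)
    simp only
    ring
  · simp [kop, sampKer, hx]

/-- The cells excluded from `K_n` lie in a boundary strip of a fixed number of cells, whose width
shrinks with `2^{-n}`. The threshold depends on `x`, hence the pointwise form of the mass condition
for kernels. -/
theorem eventually_cellIdx_mem_K (h : 1 ≤ m) (C : ℕ) {x : ℝ × ℝ} (hx : x ∈ Ω) :
    ∀ᶠ n in atTop, cellIdx n x ∈ K m C n := by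
  have hpow : Tendsto (fun n : ℕ => (2 : ℝ) ^ n) atTop atTop :=
    tendsto_pow_atTop_atTop_of_one_lt one_lt_two
  have key {t : ℝ} (ht : t ∈ Set.Ioo (0 : ℝ) 1) : ∀ᶠ n : ℕ in atTop,
      ((C + 1) * m : ℤ) ≤ ⌊2 ^ n * t⌋ ∧ ⌊2 ^ n * t⌋ + (C + 1) * m ≤ 2 ^ n := by
    filter_upwards [(hpow.atTop_mul_const ht.1).eventually_ge_atTop (((C + 1) * m : ℤ) : ℝ),
      (hpow.atTop_mul_const (sub_pos.2 ht.2)).eventually_ge_atTop (((C + 1) * m : ℤ) : ℝ)]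
      with n h1 h2
    refine ⟨Int.le_floor.2 h1, ?_⟩
    have h3 := Int.floor_le (2 ^ n * t)
    have : ((⌊2 ^ n * t⌋ + (C + 1) * m : ℤ) : ℝ) ≤ ((2 ^ n : ℤ) : ℝ) := by
      rw [Int.cast_add, Int.cast_pow, Int.cast_ofNat]
      linarith
    exact_mod_cast this
  filter_upwards [key hx.1, key hx.2] with n h1 h2
  exact mem_K_of_bounds h h1 h2

theorem integral_scaled_prod {θ₁ θ₂ : ℝ → ℝ} (h₁ : ∫ x, θ₁ x = 1) (h₂ : ∫ x, θ₂ x = 1)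
    (κ : ℝ × ℝ) :
    ∫ y : ℝ × ℝ, 4 ^ n * (θ₁ (2 ^ n * y.1 - κ.1) * θ₂ (2 ^ n * y.2 - κ.2)) = 1 := by
  have h2 : (0 : ℝ) < 2 ^ n := by positivity
  have e {θ : ℝ → ℝ} (h : ∫ x, θ x = 1) (c : ℝ) : ∫ y, θ (2 ^ n * y - c) = (2 ^ n)⁻¹ := by
    rw [Measure.integral_comp_mul_left (fun y => θ (y - c)) (2 ^ n),
      integral_sub_right_eq_self (fun y => θ y) c, h, abs_of_pos (inv_pos.2 h2), smul_eq_mul,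
      mul_one]
  rw [integral_const_mul, Measure.volume_eq_prod,
    integral_prod_mul (fun y => θ₁ (2 ^ n * y - κ.1)) fun y => θ₂ (2 ^ n * y - κ.2), e h₁, e h₂]
  have : (4 : ℝ) ^ n = 2 ^ n * 2 ^ n := by rw [← mul_pow]; norm_num
  rw [this]
  field_simp

theorem approxKernel_sampKer (h : 1 ≤ m) (hC : 2 ≤ C) {θ₁ θ₂ : ℝ → ℝ}
    (hθ₁ : BddSupp (-(3 * floorHalf m)) (3 * (m - floorHalf m)) θ₁) (h₁ : ∫ x, θ₁ x = 1)
    (hθ₂ : BddSupp (-(3 * floorHalf m)) (3 * (m - floorHalf m)) θ₂) (h₂ : ∫ x, θ₂ x = 1) :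
    ∃ D R, 0 ≤ D ∧ ApproxKernel (sampKer m C θ₁ θ₂) D R := by
  obtain ⟨B₁, hB₁⟩ := hθ₁.bdd
  obtain ⟨B₂, hB₂⟩ := hθ₂.bdd
  have n1 : 0 ≤ B₁ := (norm_nonneg _).trans (hB₁ 0)
  have n2 : 0 ≤ B₂ := (norm_nonneg _).trans (hB₂ 0)
  -- In units of `2^{-n}`, the support of a sampling function reaches at most `3m` from its index,
  -- and a point lies within `1` of the index of its cell.
  refine ⟨_, 3 * m + 1, ?_, ApproxKernel.of_bound (B := B₁ * B₂) (by positivity) (fun n => ?_)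
    (fun n x y => ?_) (fun n x _ y hy => ?_) fun x hx => ?_⟩
  · positivity
  · have hm1 : Measurable fun z : (ℝ × ℝ) × (ℝ × ℝ) => ((cellIdx n z.1).1 : ℝ) :=
      (measurable_from_top (f := fun j : ℤ => (j : ℝ))).comp
        (measurable_fst.comp ((measurable_cellIdx n).comp measurable_fst))
    have hm2 : Measurable fun z : (ℝ × ℝ) × (ℝ × ℝ) => ((cellIdx n z.1).2 : ℝ) :=
      (measurable_from_top (f := fun j : ℤ => (j : ℝ))).comp
        (measurable_snd.comp ((measurable_cellIdx n).comp measurable_fst))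
    refine Measurable.ite (((measurable_cellIdx n).comp measurable_fst)
      (K m C n : Set (ℤ × ℤ)).to_countable.measurableSet) ?_ measurable_const
    exact ((hθ₁.meas.comp (by fun_prop)).mul (hθ₂.meas.comp (by fun_prop))).const_mul _
  · rw [sampKer]
    split_ifs
    · rw [norm_mul, norm_mul, mul_comm, Real.norm_of_nonneg (by positivity : (0 : ℝ) ≤ 4 ^ n)]
      gcongr
      · exact hB₁ _
      · exact hB₂ _
    · simp only [norm_zero]
      positivity
  · rw [sampKer] at hy
    split_ifs at hy
    · have h2 : (0 : ℝ) < 2 ^ n := by positivity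
      have hb := floorHalf_nonneg m
      have hb' := floorHalf_le m
      have key {θ : ℝ → ℝ} (hθ : BddSupp (-(3 * floorHalf m)) (3 * (m - floorHalf m)) θ) {s t : ℝ}
          (hne : θ (2 ^ n * t - ⌊2 ^ n * s⌋) ≠ 0) : dist s t ≤ (3 * m + 1) * (2 ^ n)⁻¹ := by
        obtain ⟨a1, a2⟩ := hθ.supp _ hne
        have a3 := Int.floor_le (2 ^ n * s)
        have a4 := Int.lt_floor_add_one (2 ^ n * s)
        rw [← div_eq_mul_inv, le_div_iff₀ h2, Real.dist_eq, ← abs_of_pos h2, ← abs_mul, abs_le]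
        constructor <;> linarith
      have := right_ne_zero_of_mul hy
      rw [Prod.dist_eq]
      exact max_le (key hθ₁ (left_ne_zero_of_mul this)) (key hθ₂ (right_ne_zero_of_mul this))
    · exact absurd rfl hy
  · filter_upwards [eventually_cellIdx_mem_K h C hx] with n hn
    have s1 := (bddSupp_scaled h hC hn hθ₁).1
    have s2 := (bddSupp_scaled h hC hn hθ₂).2
    simp only [sampKer, if_pos hn]
    rw [integral_μΩ_eq fun y hy => ?_]
    · exact integral_scaled_prod h₁ h₂ (((cellIdx n x).1 : ℝ), ((cellIdx n x).2 : ℝ))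
    · have := right_ne_zero_of_mul hy
      exact ⟨s1.supp _ (left_ne_zero_of_mul this), s2.supp _ (right_ne_zero_of_mul this)⟩

theorem tendsto_step_samp (h : 1 ≤ m) (hC : 2 ≤ C) {θ₁ θ₂ : ℝ → ℝ}
    (hθ₁ : BddSupp (-(3 * floorHalf m)) (3 * (m - floorHalf m)) θ₁) (h₁ : ∫ x, θ₁ x = 1)
    (hθ₂ : BddSupp (-(3 * floorHalf m)) (3 * (m - floorHalf m)) θ₂) (h₂ : ∫ x, θ₂ x = 1) {r : ℝ≥0∞}
    (hr : 1 ≤ r) (hr' : r ≠ ⊤) {g : ℕ → ℝ × ℝ → ℝ} {g₀ : ℝ × ℝ → ℝ} (hg : ∀ n, MemLp (g n) r μΩ)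
    (hg₀ : MemLp g₀ r μΩ) (hlim : Tendsto (fun n => eLpNorm (g n - g₀) r μΩ) atTop (𝓝 0)) :
    Tendsto (fun n => eLpNorm ((step fun k : K m C n => samp θ₁ θ₂ n (g n) k.1) - g₀) r μΩ) atTop
      (𝓝 0) := by
  obtain ⟨D, R, hD, hk⟩ := approxKernel_sampKer h hC hθ₁ h₁ hθ₂ h₂
  simpa only [kop_sampKer] using hk.tendsto hD hr hr' hg hg₀ hlim

/-! ### The sampling operators and the transforms as sampling with averaged functions -/

theorem T_eq_samp (m n : ℕ) (g : ℝ × ℝ → ℝ) (k : M m n) :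
    T m n g k = samp (phi₁ m) (phi₁ m) n g k.1 := by
  have : (4 : ℝ) ^ n = 2 ^ n * 2 ^ n := by rw [← mul_pow]; norm_num
  simp only [T, samp, phi, mul_left_comm _ ((2 : ℝ) ^ n), integral_const_mul]
  rw [this, mul_assoc]

/-- Each factor `vphi₁` is `2 c₁` times a smeared spline at twice its argument. The doubling turns
`2^{n-1} x - k/2` into `2^n x - k`, and the two factors `2` raise `2^{n-2}` to `2^n`. -/
theorem S_eq_samp (h : 1 ≤ m) {J : ℕ} {α : Fin J → ℕ × ℕ} {j : Fin J} (h1 : (α j).1 ≤ m)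
    (h2 : (α j).2 ≤ m) (v : Fin J → ℝ × ℝ → ℝ) (k : M m n) :
    S m n α v j k = samp (smear m (α j).1 (phi₁ m)) (smear m (α j).2 (phi₁ m)) n (v j) k.1 := by
  have h4 : (4 : ℝ) ^ n = 2 ^ n * 2 ^ n := by rw [← mul_pow]; norm_num
  have e1 : (2 : ℝ) ^ ((n : ℤ) - 1) = 2 ^ n / 2 := by
    rw [zpow_sub₀ two_ne_zero, zpow_natCast, zpow_one]
  have e2 : (2 : ℝ) ^ ((n : ℤ) - 2) = 2 ^ n / 4 := by
    rw [zpow_sub₀ two_ne_zero, zpow_natCast]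
    norm_num
  have c1 := c₁_ne_zero h h1
  have c2 := c₁_ne_zero h h2
  rw [S, samp, ← integral_const_mul, ← integral_const_mul]
  refine integral_congr_ae (Eventually.of_forall fun y => ?_)
  simp only [vphi, vphi₁_eq h h1, vphi₁_eq h h2, e1, e2, cst, h4]
  rw [show 2 * ((2 : ℝ) ^ n / 2 * y.1 - (k.1.1 : ℝ) / 2) = 2 ^ n * y.1 - k.1.1 by ring,
    show 2 * ((2 : ℝ) ^ n / 2 * y.2 - (k.1.2 : ℝ) / 2) = 2 ^ n * y.2 - k.1.2 by ring]
  field_simp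
  ring

theorem bddSupp_fsum {a : ℕ} (ha : a ≤ m) {F : ℝ → ℝ}
    (hF : BddSupp (-(2 * floorHalf m)) (2 * (m - floorHalf m)) F) :
    BddSupp (-(3 * floorHalf m)) (3 * (m - floorHalf m)) (fsum m a F) := by
  rw [fsum_eq ha]
  refine ((((bddSupp_comp_add hF (floorHalf m)).one_add_shift_pow zero_le_one (m - a)).one_sub_shift_pow
    zero_le_one a).smul (fcst m a)).mono (by linarith) ?_
  rw [Nat.cast_sub ha]
  linarith

/-- Filtering the samples of `u` amounts to sampling `u` against the filtered functions, which are
derivatives of the smeared ones up to `scst`. Integrating by parts at scale `2^{-n}` produces the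
power of `2^n`, and its sign cancels the sign in the weight. -/
theorem sum_filt_samp (h : 1 ≤ m) (hC : 2 ≤ C) {a b : ℕ} (ha : a ≤ m) (hb : b ≤ m)
    {F₁ F₂ : ℝ → ℝ} (hF₁ : BddSupp (-(2 * floorHalf m)) (2 * (m - floorHalf m)) F₁)
    (hF₂ : BddSupp (-(2 * floorHalf m)) (2 * (m - floorHalf m)) F₂) {u g : ℝ × ℝ → ℝ} (hu : Integrable u μΩ)
    (hg : Integrable g μΩ) (hw : HasWeakDeriv (a, b) u g) {k : ℤ × ℤ} (hk : k ∈ K m C n) :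
    (scst m a)⁻¹ * (scst m b)⁻¹ * (-1) ^ (a + b) * (2 ^ n) ^ (a + b) *
        ∑ l ∈ box₁ m ×ˢ box₁ m, filt m (a, b) l * samp F₁ F₂ n u (k + l) =
      samp (smear m a F₁) (smear m b F₂) n g k := by
  have h2 : (0 : ℝ) < 2 ^ n := by positivity
  have p1 := (isPrim_fsum_smear ha hF₁).comp_affine h2 (k.1 : ℝ)
  have p2 := (isPrim_fsum_smear hb hF₂).comp_affine h2 (k.2 : ℝ)
  have f1 := (bddSupp_scaled h hC hk ((bddSupp_smear ha hF₁).mono (by linarith) (by linarith))).1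
  have f2 := (bddSupp_scaled h hC hk ((bddSupp_smear hb hF₂).mono (by linarith) (by linarith))).2
  have g1 := (bddSupp_scaled h hC hk ((bddSupp_fsum ha hF₁).smul (scst m a)⁻¹)).1.smul
    ((2 ^ n) ^ a)
  have g2 := (bddSupp_scaled h hC hk ((bddSupp_fsum hb hF₂).smul (scst m b)⁻¹)).2.smul
    ((2 ^ n) ^ b)
  have key := hw.integral_mul_prod f1 f2 g1 g2 p1 p2 hu hg
  have hs : ((-1 : ℝ) ^ (a + b)) * (-1) ^ (a + b) = 1 := by
    rw [← mul_pow]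
    norm_num
  have int (l : ℤ × ℤ) : Integrable (fun y => u y *
      (F₁ (2 ^ n * y.1 - (k + l).1) * F₂ (2 ^ n * y.2 - (k + l).2))) μΩ := by
    obtain ⟨mf, B, hB⟩ := (hF₁.comp_affine (κ := (((k + l).1 : ℤ) : ℝ)) h2).prod_bdd
      (hF₂.comp_affine (κ := (((k + l).2 : ℤ) : ℝ)) h2)
    exact hu.mul_bdd mf.aestronglyMeasurable (Eventually.of_forall hB)
  have e : ∑ l ∈ box₁ m ×ˢ box₁ m, filt m (a, b) l * samp F₁ F₂ n u (k + l) =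
      4 ^ n * ∫ y, u y * (fsum m a F₁ (2 ^ n * y.1 - k.1) * fsum m b F₂ (2 ^ n * y.2 - k.2))
        ∂μΩ := by
    simp only [samp, mul_left_comm _ ((4 : ℝ) ^ n)]
    rw [← Finset.mul_sum]
    congr 1
    simp only [← integral_const_mul]
    rw [← integral_finsetSum _ fun l _ => (int l).const_mul _]
    refine integral_congr_ae (Eventually.of_forall fun y => ?_)
    simp only [fsum]
    rw [Finset.sum_mul_sum, ← Finset.sum_product', Finset.mul_sum]
    refine Finset.sum_congr rfl fun l _ => ?_
    rw [filt, Prod.fst_add, Prod.snd_add, Int.cast_add, Int.cast_add, sub_add_eq_sub_sub,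
      sub_add_eq_sub_sub]
    ring
  have e3 : ∫ y, u y * (((fun x => (2 ^ n) ^ a * ((scst m a)⁻¹ • fsum m a F₁) (2 ^ n * x - k.1))
        y.1) * ((fun x => (2 ^ n) ^ b * ((scst m b)⁻¹ • fsum m b F₂) (2 ^ n * x - k.2)) y.2)) ∂μΩ =
      (scst m a)⁻¹ * (scst m b)⁻¹ * (2 ^ n) ^ (a + b) *
        ∫ y, u y * (fsum m a F₁ (2 ^ n * y.1 - k.1) * fsum m b F₂ (2 ^ n * y.2 - k.2)) ∂μΩ := by
    rw [← integral_const_mul]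
    refine integral_congr_ae (Eventually.of_forall fun y => ?_)
    simp only [Pi.smul_apply, smul_eq_mul, pow_add]
    ring
  have key' := e3.symm.trans key
  rw [e, samp]
  calc _ = 4 ^ n * (-1) ^ (a + b) * ((scst m a)⁻¹ * (scst m b)⁻¹ * (2 ^ n) ^ (a + b) *
        ∫ y, u y * (fsum m a F₁ (2 ^ n * y.1 - k.1) * fsum m b F₂ (2 ^ n * y.2 - k.2)) ∂μΩ) := by
        ring
    _ = 4 ^ n * (((-1) ^ (a + b) * (-1) ^ (a + b)) *
        ∫ y, g y * (smear m a F₁ (2 ^ n * y.1 - k.1) * smear m b F₂ (2 ^ n * y.2 - k.2)) ∂μΩ) := by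
        rw [key']
        ring
    _ = _ := by rw [hs, one_mul]

theorem conv_eq_sum_samp (h : 1 ≤ m) (hC : 2 ≤ C) (β : ℕ × ℕ) {x : M m n → ℝ} {F₁ F₂ : ℝ → ℝ}
    {g : ℝ × ℝ → ℝ} (hx : ∀ k, x k = samp F₁ F₂ n g k.1) (k : K m C n) :
    conv C β x k = ∑ l ∈ box₁ m ×ˢ box₁ m, filt m β l * samp F₁ F₂ n g (k.1 + l) := by
  refine Finset.sum_congr rfl fun l hl => ?_
  rw [Finset.mem_product] at hl
  rw [ext, dif_pos (add_mem_M h hC k.2 hl.1 hl.2), hx]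

theorem two_zpow_mul (c : ℕ) (n s : ℕ) :
    (2 : ℝ) ^ (((n : ℤ) - c) * s) * (2 ^ c) ^ s = (2 ^ n) ^ s := by
  rw [zpow_mul, zpow_sub₀ two_ne_zero, zpow_natCast, zpow_natCast, zpow_natCast, ← mul_pow,
    div_mul_cancel₀ _ (by positivity)]

theorem W'_eq_samp (h : 1 ≤ m) (hC : 2 ≤ C) {J : ℕ} {α : Fin J → ℕ × ℕ} {j : Fin J}
    (h1 : (α j).1 ≤ m) (h2 : (α j).2 ≤ m) {u g : ℝ × ℝ → ℝ} (hu : Integrable u μΩ)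
    (hg : Integrable g μΩ) (hw : HasWeakDeriv (α j) u g) (k : K m C n) :
    W' m C n α (T m n u) j k =
      samp (smear m (α j).1 (phi₁ m)) (smear m (α j).2 (phi₁ m)) n g k.1 := by
  have hb := floorHalf_nonneg m
  have hb' := floorHalf_le m
  have hF : BddSupp (-(2 * floorHalf m)) (2 * (m - floorHalf m)) (phi₁ m) :=
    (bddSupp_phi₁ h).mono (by linarith) (by linarith)
  rw [W', conv_eq_sum_samp h hC (α j) (T_eq_samp m n u) k,
    ← sum_filt_samp h hC h1 h2 hF hF hu hg hw k.2]
  congr 1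
  have e := two_zpow_mul 1 n (ord (α j))
  rw [pow_one, Nat.cast_one] at e
  -- The factors `2^{-a}` in the constants `c₁`, once inverted, raise `2^{(n-1)s}` to `2^{ns}`.
  rw [cst, c₁_eq h h1, c₁_eq h h2, show (α j).1 + (α j).2 = ord (α j) from rfl, ← e,
    ord, pow_add (2 : ℝ) (α j).1]
  have := scst_ne_zero h1
  have := scst_ne_zero h2
  field_simp

theorem W''_eq_samp (h : 1 ≤ m) (hC : 2 ≤ C) {J : ℕ} {α : Fin J → ℕ × ℕ}
    (hα : ∀ j, (α j).1 ≤ m ∧ (α j).2 ≤ m) {v : Fin J → ℝ × ℝ → ℝ} {g : ℝ × ℝ → ℝ} {i j : Fin J}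
    (hv : Integrable (v j) μΩ) (hg : Integrable g μΩ) (hw : HasWeakDeriv (α i) (v j) g)
    (k : K m C n) :
    W'' m C n α (S m n α v) (i, j) k =
      samp (smear m (α i).1 (smear m (α j).1 (phi₁ m)))
        (smear m (α i).2 (smear m (α j).2 (phi₁ m))) n g k.1 := by
  obtain ⟨h1, h2⟩ := hα i
  obtain ⟨h3, h4⟩ := hα j
  rw [W'', conv_eq_sum_samp h hC (α i) (S_eq_samp h h3 h4 v) k,
    ← sum_filt_samp h hC h1 h2 (bddSupp_smear_phi₁ h h3) (bddSupp_smear_phi₁ h h4) hv hg hw k.2]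
  congr 1
  have e := two_zpow_mul 2 n (ord (α i))
  rw [Nat.cast_ofNat, show (2 : ℝ) ^ 2 = 4 by norm_num] at e
  rw [cst₂, c₂_eq h h3 h1, c₂_eq h h4 h2, show (α i).1 + (α i).2 = ord (α i) from rfl, ← e,
    ord, pow_add (4 : ℝ) (α i).1]
  have := scst_ne_zero h1
  have := scst_ne_zero h2
  field_simp

end

/-! ### The data term -/

section

variable {m C n : ℕ}

theorem arrayNorm₂_eq (a : K m C n → ℝ) :
    arrayNorm₂ a = (2 ^ n)⁻¹ * ‖(WithLp.toLp 2 a : EuclideanSpace ℝ (K m C n))‖ := by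
  have e : ((2 : ℝ) ^ (2 * n))⁻¹ = ((2 ^ n)⁻¹) ^ 2 := by rw [inv_pow, ← pow_mul, mul_comm]
  rw [arrayNorm₂, EuclideanSpace.norm_eq, e, Real.sqrt_mul (by positivity),
    Real.sqrt_sq (by positivity)]
  rfl

theorem arrayNorm₂_add_le (a b : K m C n → ℝ) :
    arrayNorm₂ (a + b) ≤ arrayNorm₂ a + arrayNorm₂ b := by
  rw [arrayNorm₂_eq, arrayNorm₂_eq, arrayNorm₂_eq, ← mul_add, WithLp.toLp_add]
  gcongr
  exact norm_add_le _ _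

theorem arrayNorm₂_smul (c : ℝ) (a : K m C n → ℝ) :
    arrayNorm₂ (c • a) = ‖c‖ * arrayNorm₂ a := by
  rw [arrayNorm₂_eq, arrayNorm₂_eq, WithLp.toLp_smul, norm_smul]
  ring

theorem abs_arrayNorm₂_sub_le (a b : K m C n → ℝ) :
    |arrayNorm₂ a - arrayNorm₂ b| ≤ arrayNorm₂ (a - b) := by
  rw [arrayNorm₂_eq, arrayNorm₂_eq, arrayNorm₂_eq, ← mul_sub, WithLp.toLp_sub, abs_mul,
    abs_of_pos (by positivity)]
  gcongr
  exact abs_norm_sub_norm_le _ _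

theorem arrayNorm₂_nonneg (a : K m C n → ℝ) : 0 ≤ arrayNorm₂ a := Real.sqrt_nonneg _

theorem continuous_arrayNorm₂ : Continuous (arrayNorm₂ : (K m C n → ℝ) → ℝ) := by
  unfold arrayNorm₂
  fun_prop

theorem arrayNorm₂_eq_arrayNorm (a : K m C n → ℝ) :
    arrayNorm₂ a = arrayNorm 2 fun _ : Unit => a := by
  simp [arrayNorm₂, arrayNorm, Real.sqrt_eq_rpow]

theorem vecNorm_two_unit (g : Lp ℝ 2 μΩ) : vecNorm 2 (fun _ : Unit => (g : ℝ × ℝ → ℝ)) = ‖g‖ := by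
  rw [vecNorm_eq_eLpNorm one_le_two ENNReal.ofNat_ne_top fun _ => Lp.memLp g, Lp.norm_def]
  congr 1
  refine eLpNorm_congr_norm_ae (Eventually.of_forall fun x => ?_)
  simp [Real.sqrt_sq_eq_abs]

theorem phi_bdd (h : 1 ≤ m) (n : ℕ) (k : ℤ × ℤ) :
    Measurable (fun y => phi m n k y) ∧ ∃ B, ∀ y, ‖phi m n k y‖ ≤ B := by
  have h2 : (0 : ℝ) < 2 ^ n := by positivity
  obtain ⟨hm, B, hB⟩ := ((bddSupp_phi₁ h).comp_affine (κ := (k.1 : ℝ)) h2).prod_bdd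
    ((bddSupp_phi₁ h).comp_affine (κ := (k.2 : ℝ)) h2)
  refine ⟨hm.const_mul _, 2 ^ n * B, fun y => ?_⟩
  rw [phi, norm_mul, Real.norm_of_nonneg h2.le]
  gcongr
  exact hB y

theorem integrable_mul_phi (h : 1 ≤ m) (n : ℕ) (k : ℤ × ℤ) (u : Lp ℝ 2 μΩ) :
    Integrable (fun x => u x * phi m n k x) μΩ := by
  obtain ⟨hm, B, hB⟩ := phi_bdd h n k
  exact (integrable_coe u).mul_bdd hm.aestronglyMeasurable (Eventually.of_forall hB)

theorem T_congr {g g' : ℝ × ℝ → ℝ} (hg : g =ᵐ[μΩ] g') : T m n g = T m n g' := by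
  funext k
  have : (fun x => g x * phi m n k x) =ᵐ[μΩ] fun x => g' x * phi m n k x :=
    hg.mono fun x hx => by dsimp only; rw [hx]
  rw [T, T, integral_congr_ae this]

/-- The sampling operator as a linear map on `L_2(Ω)`. -/
def Tlin (h : 1 ≤ m) (n : ℕ) : Lp ℝ 2 μΩ →ₗ[ℝ] (M m n → ℝ) where
  toFun u := T m n u
  map_add' u v := by
    rw [T_congr (Lp.coeFn_add u v)]
    funext k
    simp only [T, Pi.add_apply, add_mul]
    rw [integral_add (integrable_mul_phi h n k u) (integrable_mul_phi h n k v), mul_add]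
  map_smul' c u := by
    rw [T_congr (Lp.coeFn_smul c u)]
    funext k
    simp only [T, Pi.smul_apply, smul_eq_mul, mul_assoc, integral_const_mul, RingHom.id_apply]
    ring

theorem continuous_Tlin (h : 1 ≤ m) (n : ℕ) : Continuous (Tlin h n) := by
  refine continuous_pi fun k => ?_
  refine continuous_iff_seqContinuous.2 fun u u₀ hu => ?_
  obtain ⟨hm, B, hB⟩ := phi_bdd h n k
  refine (tendsto_integral_mul_of_bdd hm hB (fun i => integrable_coe (u i)) (integrable_coe u₀)
    ?_).const_mul (2 ^ n)
  have h2 : Tendsto (fun i => ENNReal.ofReal ‖u i - u₀‖) atTop (𝓝 0) := by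
    simpa using ENNReal.tendsto_ofReal (tendsto_iff_norm_sub_tendsto_zero.1 hu)
  refine tendsto_of_tendsto_of_tendsto_of_le_of_le tendsto_const_nhds h2 (fun _ => zero_le)
    fun i => ?_
  rw [eLpNorm_congr_ae (Lp.coeFn_sub (u i) u₀).symm]
  exact eLpNorm_coe_le _ one_le_two

/-- The sampling operators are asymptotically isometric on `L_2`. In particular the arrays `T_n A v`
are bounded for fixed `v`, which feeds the uniform boundedness principle. -/
theorem tendsto_arrayNorm₂_T (h : 1 ≤ m) (hC : 2 ≤ C) (g : Lp ℝ 2 μΩ) :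
    Tendsto (fun n => arrayNorm₂ fun k : K m C n => T m n g (toM k)) atTop (𝓝 ‖g‖) := by
  have hb := floorHalf_nonneg m
  have hb' := floorHalf_le m
  have hF : BddSupp (-(3 * floorHalf m)) (3 * (m - floorHalf m)) (phi₁ m) :=
    (bddSupp_phi₁ h).mono (by linarith) (by linarith)
  rw [← vecNorm_two_unit]
  simp only [arrayNorm₂_eq_arrayNorm, arrayNorm_eq_vecNorm h hC one_le_two ENNReal.ofNat_ne_top]
  refine tendsto_vecNorm one_le_two ENNReal.ofNat_ne_top (fun n _ => memLp_step _ 2)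
    (fun _ => Lp.memLp g) fun _ => ?_
  have := tendsto_step_samp (C := C) h hC hF (integral_phi₁ h) hF (integral_phi₁ h) one_le_two
    ENNReal.ofNat_ne_top (g := fun _ => g) (fun _ => Lp.memLp g) (Lp.memLp g) (by simp)
  simpa only [T_eq_samp, toM] using this

/-- The seminorm `u ↦ ‖A_n T_n u‖` on `L_2(Ω)`. -/
def discSeminorm (h : 1 ≤ m) (n : ℕ) (A : (M m n → ℝ) →ₗ[ℝ] (K m C n → ℝ)) :
    Seminorm ℝ (Lp ℝ 2 μΩ) :=
  Seminorm.of (fun u => arrayNorm₂ (A (Tlin h n u)))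
    (fun u v => by rw [map_add, map_add]; exact arrayNorm₂_add_le _ _)
    fun c u => by rw [map_smul, map_smul]; exact arrayNorm₂_smul _ _

theorem discSeminorm_apply (h : 1 ≤ m) (n : ℕ) (A : (M m n → ℝ) →ₗ[ℝ] (K m C n → ℝ))
    (u : Lp ℝ 2 μΩ) : discSeminorm h n A u = arrayNorm₂ (A (T m n u)) := rfl

/-- By the uniform boundedness principle, consistent discretizations of `A` are stable. -/
theorem tendsto_data_term (h : 1 ≤ m) (hC : 2 ≤ C) {A : Lp ℝ 2 μΩ →ₗ[ℝ] Lp ℝ 2 μΩ}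
    {A' : ∀ n : ℕ, (M m n → ℝ) →ₗ[ℝ] (K m C n → ℝ)}
    (hA : ∀ u : Lp ℝ 2 μΩ, Tendsto
      (fun n => arrayNorm₂ (fun k : K m C n => T m n (A u) (toM k) - A' n (T m n u) k))
      atTop (𝓝 0)) (f : Lp ℝ 2 μΩ) {u : ℕ → Lp ℝ 2 μΩ} {u₀ : Lp ℝ 2 μΩ}
    (hu : Tendsto u atTop (𝓝 u₀)) :
    Tendsto (fun n => arrayNorm₂ fun k : K m C n => A' n (T m n (u n)) k - T m n f (toM k)) atTop
      (𝓝 ‖A u₀ - f‖) := by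
  have hcont (n : ℕ) : Continuous (discSeminorm h n (A' n)) :=
    continuous_arrayNorm₂.comp
      ((A' n).continuous_of_finiteDimensional.comp (continuous_Tlin h n))
  have hbdd : BddAbove (Set.range fun n => discSeminorm h n (A' n)) := by
    rw [Seminorm.bddAbove_range_iff]
    intro v
    -- Pointwise boundedness: `‖A_n T_n v‖` is at most the consistency error plus `‖T_n A v‖`, and
    -- both sequences converge.
    obtain ⟨c, hc⟩ := ((hA v).add (tendsto_arrayNorm₂_T (C := C) h hC (A v))).bddAbove_range
    refine ⟨c, ?_⟩
    rintro _ ⟨n, rfl⟩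
    refine le_trans ?_ (hc ⟨n, rfl⟩)
    have := abs_arrayNorm₂_sub_le (A' n (T m n v)) fun k => T m n (A v) (toM k)
    have e := arrayNorm₂_smul (-1) (fun k : K m C n => T m n (A v) (toM k) - A' n (T m n v) k)
    have e' : (-1 : ℝ) • (fun k : K m C n => T m n (A v) (toM k) - A' n (T m n v) k) =
        A' n (T m n v) - fun k => T m n (A v) (toM k) := by
      funext k
      simp
    rw [e', norm_neg, norm_one, one_mul] at e
    rw [e] at this
    simp only [discSeminorm_apply]
    linarith [le_abs_self (arrayNorm₂ (A' n (T m n v)) -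
      arrayNorm₂ fun k : K m C n => T m n (A v) (toM k))]
  -- Banach–Steinhaus in seminorm form: the supremum of the discrete seminorms is continuous, so it
  -- tends to zero along `u n - u₀`. No continuity of `A` enters.
  have hsup := Seminorm.continuous_iSup _ hcont hbdd
  have hlim : Tendsto (fun n => arrayNorm₂ (A' n (T m n (u n - u₀ : Lp ℝ 2 μΩ)))) atTop (𝓝 0) := by
    have h0 : Tendsto (fun n => u n - u₀) atTop (𝓝 0) := by
      simpa using hu.sub_const u₀
    have h1 := (hsup.tendsto 0).comp h0
    have h2 : (⨆ n, ⇑(discSeminorm h n (A' n))) (0 : Lp ℝ 2 μΩ) = 0 := by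
      rw [iSup_apply]
      simp
    rw [h2] at h1
    refine tendsto_of_tendsto_of_tendsto_of_le_of_le tendsto_const_nhds h1
      (fun _ => arrayNorm₂_nonneg _) fun n => ?_
    simp only [Function.comp_apply, iSup_apply, ← discSeminorm_apply h]
    exact le_ciSup (Seminorm.bddAbove_range_iff.1 hbdd (u n - u₀)) n
  have hT (n : ℕ) (x y : Lp ℝ 2 μΩ) : T m n (x - y : Lp ℝ 2 μΩ) = T m n x - T m n y :=
    map_sub (Tlin h n) x y
  rw [← sub_zero ‖A u₀ - f‖]
  refine tendsto_of_tendsto_of_dist ((tendsto_arrayNorm₂_T (C := C) h hC (A u₀ - f)).sub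
    (tendsto_const_nhds (x := (0 : ℝ)))) ?_
  have hsum := hlim.add (hA u₀)
  rw [add_zero] at hsum
  refine tendsto_of_tendsto_of_tendsto_of_le_of_le tendsto_const_nhds hsum
    (fun _ => dist_nonneg) fun n => ?_
  rw [sub_zero, dist_comm, Real.dist_eq]
  refine (abs_arrayNorm₂_sub_le _ _).trans ?_
  -- Against the exact samples of `A u₀ - f`, the residual differs by a stability error in `u n -
  -- u₀` and a consistency error at the fixed function `u₀`.
  have e : ((fun k : K m C n => A' n (T m n (u n)) k - T m n f (toM k)) -
      fun k : K m C n => T m n (A u₀ - f : Lp ℝ 2 μΩ) (toM k)) =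
      A' n (T m n (u n - u₀ : Lp ℝ 2 μΩ)) +
        (-1 : ℝ) • fun k : K m C n => T m n (A u₀) (toM k) - A' n (T m n u₀) k := by
    funext k
    rw [hT, hT, map_sub]
    simp only [Pi.sub_apply, Pi.add_apply, Pi.smul_apply, smul_eq_mul]
    ring
  rw [e]
  refine (arrayNorm₂_add_le _ _).trans (le_of_eq ?_)
  rw [arrayNorm₂_smul, norm_neg, norm_one, one_mul]

end

/-! ### Convergence of the energies -/

theorem toL2_coe_ae {p : ℝ≥0∞} {u : Lp ℝ p μΩ} (hu : MemLp u 2 μΩ) : (toL2 u : ℝ × ℝ → ℝ) =ᵐ[μΩ] u := by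
  rw [toL2, dif_pos hu]
  exact hu.coeFn_toLp

section

variable {m C J : ℕ} {α : Fin J → ℕ × ℕ} {p q : ℝ≥0∞} [hp1 : Fact (1 ≤ p)] [hq1 : Fact (1 ≤ q)]

theorem one_le_order (hJ : 1 ≤ J) (hα : ∀ j, α j ≠ (0, 0)) : 1 ≤ order α := by
  refine le_trans ?_ (ord_le_order α ⟨0, hJ⟩)
  by_contra hlt
  refine hα ⟨0, hJ⟩ (Prod.ext ?_ ?_) <;> simp only <;> omega

theorem tendsto_toL2 {k : ℕ} (hk : 1 ≤ k) {u : ℕ → Sobolev k p} {u₀ : Sobolev k p}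
    (h : Tendsto u atTop (𝓝 u₀)) :
    Tendsto (fun n => toL2 (fn (u n))) atTop (𝓝 (toL2 (fn u₀))) := by
  rw [Lp.tendsto_Lp_iff_tendsto_eLpNorm']
  refine (tendsto_eLpNorm_fn_sub hk h le_rfl).congr fun n => eLpNorm_congr_ae ?_
  exact (toL2_coe_ae (memLp_two_fn hk _)).symm.sub (toL2_coe_ae (memLp_two_fn hk _)).symm

/-- Both arrays sample with the same kernel, so their difference samples `D_j u - v_j`, which
converges in `L_p`: the derivative by the Sobolev norm, and `v_j` by the embedding into `L_2`
together with `p ≤ 2`. -/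
theorem tendsto_first_term (hm : 1 ≤ m) (hC : 2 ≤ C) (hα : ∀ j, (α j).1 ≤ m ∧ (α j).2 ≤ m)
    (hs : 1 ≤ order α) (hp : p ≤ 2) {w : ℕ → Space α p q} {w₀ : Space α p q}
    (hw : Tendsto w atTop (𝓝 w₀)) :
    Tendsto (fun n => arrayNorm p fun (j : Fin J) (k : K m C n) =>
        W' m C n α (T m n (fn (w n).1)) j k - S m n α (fun j => fn ((w n).2 j)) j (toM k)) atTop
      (𝓝 (vecNorm p fun j x =>
        wderiv w₀.1 (α j) (ord_le_two_order α j) x - fn (w₀.2 j) x)) := by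
  have hpt : p ≠ ⊤ := (hp.trans_lt (by simp)).ne
  have hb := floorHalf_nonneg m
  have hb' := floorHalf_le m
  have hv (w : Space α p q) (j : Fin J) : MemLp (fn (w.2 j)) p μΩ :=
    (memLp_two_fn hs _).mono_exponent hp
  have hD (w : Space α p q) (j : Fin J) :
      MemLp (fun x => wderiv w.1 (α j) (ord_le_two_order α j) x - fn (w.2 j) x) p μΩ :=
    (Lp.memLp _).sub (hv w j)
  simp only [arrayNorm_eq_vecNorm hm hC hp1.out hpt]
  refine tendsto_vecNorm hp1.out hpt (fun n j => memLp_step _ p) (hD w₀) fun j => ?_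
  have hF : BddSupp (-(3 * floorHalf m)) (3 * (m - floorHalf m))
      (smear m (α j).1 (phi₁ m)) :=
    (bddSupp_smear_phi₁ hm (hα j).1).mono (by linarith) (by linarith)
  have hF' : BddSupp (-(3 * floorHalf m)) (3 * (m - floorHalf m))
      (smear m (α j).2 (phi₁ m)) :=
    (bddSupp_smear_phi₁ hm (hα j).2).mono (by linarith) (by linarith)
  have hw1 : Tendsto (fun n => (w n).1) atTop (𝓝 w₀.1) := (continuous_fst.tendsto _).comp hw
  have hw2 : Tendsto (fun n => (w n).2 j) atTop (𝓝 (w₀.2 j)) :=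
    (((continuous_apply j).comp continuous_snd).tendsto _).comp hw
  have key := tendsto_step_samp (C := C) hm hC hF (integral_smear_phi₁ hm _) hF'
    (integral_smear_phi₁ hm _) hp1.out hpt (fun n => hD (w n) j) (hD w₀ j) ?_
  · refine key.congr fun n => ?_
    congr 3
    funext k
    rw [W'_eq_samp hm hC (hα j).1 (hα j).2 (integrable_coe _) (integrable_coe _)
      (hasWeakDeriv_wderiv (w n).1 (α j) (ord_le_two_order α j)),
      S_eq_samp hm (hα j).1 (hα j).2]
    have h2 : (0 : ℝ) < 2 ^ n := by positivity
    obtain ⟨mf, B, hB⟩ := (hF.comp_affine (κ := (k.1.1 : ℝ)) h2).prod_bdd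
      (hF'.comp_affine (κ := (k.1.2 : ℝ)) h2)
    simp only [samp, toM, sub_mul]
    rw [integral_sub, mul_sub]
    · exact (integrable_coe _).mul_bdd mf.aestronglyMeasurable (Eventually.of_forall hB)
    · exact (integrable_coe _).mul_bdd mf.aestronglyMeasurable (Eventually.of_forall hB)
  · have hsum := (tendsto_eLpNorm_wderiv_sub hw1 (α j) (ord_le_two_order α j)).add
      (tendsto_eLpNorm_fn_sub hs hw2 hp)
    rw [add_zero] at hsum
    refine tendsto_of_tendsto_of_tendsto_of_le_of_le tendsto_const_nhds hsum (fun _ => zero_le)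
      fun n => ?_
    refine le_trans (le_of_eq ?_) (eLpNorm_sub_le ((Lp.aestronglyMeasurable _).sub
      (Lp.aestronglyMeasurable _)) ((Lp.aestronglyMeasurable _).sub
        (Lp.aestronglyMeasurable _)) hp1.out)
    congr 1
    funext x
    simp only [Pi.sub_apply]
    ring

theorem tendsto_second_term (hm : 1 ≤ m) (hC : 2 ≤ C) (hα : ∀ j, (α j).1 ≤ m ∧ (α j).2 ≤ m)
    (hq : q ≤ 2) {v : ℕ → Fin J → Sobolev (order α) q} {v₀ : Fin J → Sobolev (order α) q}
    (hv : Tendsto v atTop (𝓝 v₀)) :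
    Tendsto (fun n => arrayNorm q (W'' m C n α (S m n α fun j => fn (v n j)))) atTop
      (𝓝 (vecNorm q fun (ij : Fin J × Fin J) x =>
        wderiv (v₀ ij.2) (α ij.1) (ord_le_order α ij.1) x)) := by
  have hqt : q ≠ ⊤ := (hq.trans_lt (by simp)).ne
  simp only [arrayNorm_eq_vecNorm hm hC hq1.out hqt]
  refine tendsto_vecNorm hq1.out hqt (fun n j => memLp_step _ q) (fun _ => Lp.memLp _) ?_
  rintro ⟨i, j⟩
  have hvj : Tendsto (fun n => v n j) atTop (𝓝 (v₀ j)) :=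
    ((continuous_apply j).tendsto _).comp hv
  refine (tendsto_step_samp (C := C) hm hC (bddSupp_smear_smear_phi₁ hm (hα j).1 (hα i).1)
    (integral_smear_smear_phi₁ hm (hα j).1 _) (bddSupp_smear_smear_phi₁ hm (hα j).2 (hα i).2)
    (integral_smear_smear_phi₁ hm (hα j).2 _) hq1.out hqt (fun n => Lp.memLp _) (Lp.memLp _)
    (tendsto_eLpNorm_wderiv_sub hvj (α i) (ord_le_order α i))).congr fun n => ?_
  congr 3
  funext k
  exact (W''_eq_samp hm hC hα (v := fun j => fn (v n j)) (integrable_coe _) (integrable_coe _)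
    (hasWeakDeriv_wderiv (v n j) (α i) (ord_le_order α i)) k).symm

end

/-- Convergence along every convergent sequence gives the lower bound at once, and a constant
sequence attains the upper one. -/
theorem GammaConverges.of_tendsto {X : Type} [TopologicalSpace X] {G : ℕ → X → ℝ} {G₀ : X → ℝ}
    (h : ∀ (w : ℕ → X) (w₀ : X), Tendsto w atTop (𝓝 w₀) →
      Tendsto (fun n => G n (w n)) atTop (𝓝 (G₀ w₀))) : GammaConverges G G₀ := by
  have h' (w : ℕ → X) (w₀ : X) (hw : Tendsto w atTop (𝓝 w₀)) :
      Tendsto (fun n => (G n (w n) : EReal)) atTop (𝓝 (G₀ w₀ : EReal)) :=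
    (continuous_coe_real_ereal.tendsto _).comp (h w w₀ hw)
  exact ⟨fun w w₀ hw => (h' w w₀ hw).liminf_eq.ge, fun w₀ => ⟨fun _ => w₀, tendsto_const_nhds,
    (h' _ w₀ tendsto_const_nhds).limsup_eq.le⟩⟩

end

end WaveletFrame

theorem theorem3p1 (m : ℕ) (hm : 1 ≤ m) (J : ℕ) (hJ : 1 ≤ J) (α : Fin J → ℕ × ℕ)
    (hα : ∀ j, α j ≠ (0, 0) ∧ (α j).1 ≤ m ∧ (α j).2 ≤ m)
    (C : ℕ) (hC : 2 ≤ C)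
    (p q : ℝ≥0∞) [Fact (1 ≤ p)] [Fact (1 ≤ q)] (hp : p ≤ 2) (hq : q ≤ 2) (ν₁ ν₂ : ℝ)
    (A : Lp ℝ 2 μΩ →ₗ[ℝ] Lp ℝ 2 μΩ) (f : Lp ℝ 2 μΩ)
    (A' : ∀ n : ℕ, (M m n → ℝ) →ₗ[ℝ] (K m C n → ℝ))
    (hA : ∀ u : Lp ℝ 2 μΩ, Tendsto
      (fun n => arrayNorm₂ (fun k : K m C n => T m n (A u) (toM k) - A' n (T m n u) k))
      atTop (𝓝 0)) :
    -- all terms of the limit energy are finite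
    (∀ w : Space α p q, MemLp (fn w.1) 2 μΩ ∧ ∀ j, MemLp (fn (w.2 j)) p μΩ) ∧
    (∀ (w : ℕ → Space α p q) (w₀ : Space α p q), Tendsto w atTop (𝓝 w₀) →
      Tendsto (fun n => En m C n α p q ν₁ ν₂ (A' n) f (w n)) atTop
        (𝓝 (E α p q ν₁ ν₂ A f w₀))) ∧
    GammaConverges (fun n => En m C n α p q ν₁ ν₂ (A' n) f) (E α p q ν₁ ν₂ A f) := by
  have hs : 1 ≤ order α := one_le_order hJ fun j => (hα j).1
  have hs2 : 1 ≤ 2 * order α := by omega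
  have hα' (j : Fin J) : (α j).1 ≤ m ∧ (α j).2 ≤ m := (hα j).2
  have hp0 : 0 < p.toReal := ENNReal.toReal_pos
    (zero_lt_one.trans_le (Fact.out : 1 ≤ p)).ne' (hp.trans_lt (by simp)).ne
  have hq0 : 0 < q.toReal := ENNReal.toReal_pos
    (zero_lt_one.trans_le (Fact.out : 1 ≤ q)).ne' (hq.trans_lt (by simp)).ne
  have hlim : ∀ (w : ℕ → Space α p q) (w₀ : Space α p q), Tendsto w atTop (𝓝 w₀) →
      Tendsto (fun n => En m C n α p q ν₁ ν₂ (A' n) f (w n)) atTop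
        (𝓝 (E α p q ν₁ ν₂ A f w₀)) := by
    intro w w₀ hw
    have hw1 : Tendsto (fun n => (w n).1) atTop (𝓝 w₀.1) := (continuous_fst.tendsto _).comp hw
    have hw2 : Tendsto (fun n => (w n).2) atTop (𝓝 w₀.2) := (continuous_snd.tendsto _).comp hw
    have t1 := (tendsto_first_term hm hC hα' hs hp hw).rpow_const
      (p := p.toReal) (Or.inr hp0.le)
    have t2 := (tendsto_second_term hm hC hα' hq hw2).rpow_const
      (p := q.toReal) (Or.inr hq0.le)
    have t3 := (tendsto_data_term hm hC hA f (tendsto_toL2 hs2 hw1)).pow 2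
    -- The data term was treated for elements of `L_2`, whereas the discrete energy samples the
    -- `L_p` representative; sampling sees only the class almost everywhere.
    have e (n : ℕ) : T m n (toL2 (fn (w n).1)) = T m n (fn (w n).1) :=
      T_congr (toL2_coe_ae (memLp_two_fn hs2 _))
    simp only [e] at t3
    exact ((t1.const_mul ν₁).add (t2.const_mul ν₂)).add (t3.const_mul (1 / 2))
  exact ⟨fun w => ⟨memLp_two_fn hs2 w.1, fun j => (memLp_two_fn hs (w.2 j)).mono_exponent hp⟩,
    hlim, GammaConverges.of_tendsto hlim⟩
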